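/- Let $n\in\mathbb N$, $\gamma\in(0,\frac n2)$, $s=\frac n2+\gamma$. On the unit ball $\mathbb B^{n+1}\subset\mathbb R^{n+1}$ put $r=|x|$, $\rho=\frac{1-r^2}{2}$, let $g_{\mathbb B}=\frac{4}{(1-|x|^2)^2}|dx|^2$ be the hyperbolic metric, and let $f:\mathbb S^n\to\mathbb R$. Let $u$ be a solution of $$-\Delta_{g_{\mathbb B}}u-s(n-s)u=0\ \text{ in }\mathbb B^{n+1},\qquad u=F\rho^{n-s}+H\rho^{s},\qquad F|_{\mathbb S^n}=f, \tag{1}$$ with $F,H$ smooth on the closed ball $\overline{\mathbb B^{n+1}}$ (so $f\in C^\infty(\mathbb S^n)$), and let $f=\sum_{l\ge0}Y_l$ be the $L^2(\mathbb S^n)$-expansion of $f$ in spherical harmonics $Y_l$ of degree $l$. Write $(a)_0=1$, $(a)_k=a(a+1)\cdots(a+k-1)$, $F(a,b;c;z)=\sum_{k\ge0}\frac{(a)_k(b)_k}{(c)_k}\frac{z^k}{k!}$, and, for $\gamma\notin\{0,\frac12,1,\frac32,\dots\}$, $$A_l(\rho)=F\big(l+\tfrac n2-\gamma,\tfrac12-\gamma;1-2\gamma;2\rho\big),\qquad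 B_l(\rho)=\frac{\Gamma(l+\frac n2+\gamma)}{\Gamma(l+\frac n2-\gamma)}F\big(\tfrac12+\gamma,l+\tfrac n2+\gamma;1+2\gamma;2\rho\big),\qquad c_\gamma=\frac{\Gamma(-\gamma)}{2^{2\gamma}\Gamma(\gamma)} .$$ (a) If $\gamma\notin\frac12\mathbb N=\{0,\frac12,1,\dots\}$, then for every $x=r\xi$ with $0<r<1$, $\xi\in\mathbb S^n$, $$u(x)=\sum_{l=0}^\infty\Big(\rho^{n-s}A_l(\rho)+\rho^{s}c_\gamma B_l(\rho)\Big)r^lY_l(\xi),$$ the series being absolutely convergent. At such a point, the series $\sum_l A_l(\rho)r^lY_l(\xi)$ converges if and only if $\sum_l B_l(\rho)r^lY_l(\xi)$ does (as is the case, for instance, if only finitely many $Y_l$ are nonzero), and then $$u(x)=\rho^{n-s}\sum_{l=0}^\infty A_l(\rho)r^lY_l(\xi)+\rho^{s}c_\gamma\sum_{l=0}^\infty B_l(\rho)r^lY_l(\xi).$$ (b) If $\gamma=m+\frac12$ with an integer $m\ge0$ (so $m<\frac{n-1}2$), then for every $x=r\xi$ with $0\le r<1$, $\xi\in\mathbb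 S^n$, with absolute convergence, $$u(x)=\rho^{\frac{n-1}2-m}\sum_{l=0}^\infty\Big(\sum_{k=0}^m\frac{(l+\frac{n-1}2-m)_k(-m)_k}{(-2m)_k}\frac{(2\rho)^k}{k!}\Big)r^lY_l(\xi).$$ (c) Let $\vartheta_s$ be a solution of (1) for $f\equiv1$. If $\gamma\notin\frac12\mathbb N$, then for $0<|x|<1$ $$\vartheta_s=\rho^{\frac n2-\gamma}F\big(\tfrac n2-\gamma,\tfrac12-\gamma;1-2\gamma;2\rho\big)+\rho^{\frac n2+\gamma}\frac{\Gamma(-\gamma)}{2^{2\gamma}\Gamma(\gamma)}\frac{\Gamma(\frac n2+\gamma)}{\Gamma(\frac n2-\gamma)}F\big(\tfrac12+\gamma,\tfrac n2+\gamma;1+2\gamma;2\rho\big).$$ If $\gamma=m+\frac12$ with an integer $m\ge0$, then for $|x|<1$ $$\vartheta_s=\rho^{\frac{n-1}2-m}\sum_{k=0}^m\frac{(\frac{n-1}2-m)_k(-m)_k}{(-2m)_k}\frac{(2\rho)^k}{k!}.$$ -/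

import Mathlib

open Filter Topology MeasureTheory
open scoped ContDiff

noncomputable section

namespace HypPoisson

/-- `ℝ^d` with its Euclidean norm. -/
abbrev Euc (d : ℕ) : Type := EuclideanSpace ℝ (Fin d)

/-- The unit sphere `𝕊ⁿ` of `ℝ^{n+1}`. -/
abbrev Sph (n : ℕ) : Type := Metric.sphere (0 : Euc (n + 1)) 1

/-- Partial derivative `∂ᵢ u` at `x`. -/
def partialDeriv {d : ℕ} (i : Fin d) (u : Euc d → ℝ) (x : Euc d) : ℝ :=
  fderiv ℝ u x (EuclideanSpace.single i 1)

/-- The Laplace-Beltrami operator of the Riemannian metric with coefficient matrix `g`,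
`Δ_g u = |g|^{-1/2} ∑ᵢ ∂ᵢ (|g|^{1/2} ∑ⱼ g^{ij} ∂ⱼ u)`. -/
def laplaceBeltrami {d : ℕ} (g : Euc d → Matrix (Fin d) (Fin d) ℝ) (u : Euc d → ℝ)
    (x : Euc d) : ℝ :=
  (Real.sqrt (g x).det)⁻¹ *
    ∑ i, partialDeriv i
      (fun y => Real.sqrt (g y).det * ∑ j, (g y)⁻¹ i j * partialDeriv j u y) x

/-- The hyperbolic metric `4 (1 - |x|²)⁻² |dx|²` on the unit ball. -/
def ballMetric (d : ℕ) (x : Euc d) : Matrix (Fin d) (Fin d) ℝ :=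
  (4 / (1 - ‖x‖ ^ 2) ^ 2) • (1 : Matrix (Fin d) (Fin d) ℝ)

/-- The defining function `ρ = (1 - |x|²) / 2`, as a function of `r = |x|`. -/
def rho (r : ℝ) : ℝ := (1 - r ^ 2) / 2

/-- `u` solves `-Δ u - s (n - s) u = 0` in the hyperbolic ball `𝔹^{n+1}`, with
`u = F ρ^{n-s} + H ρ^s`, where `F` and `H` are smooth up to the boundary and `F = f` on `𝕊ⁿ`
(so that `f` is automatically smooth). -/
def IsPoissonSolution (n : ℕ) (s : ℝ) (f : Sph n → ℝ) (u : Euc (n + 1) → ℝ) : Prop :=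
  (∀ x ∈ Metric.ball (0 : Euc (n + 1)) 1,
    -laplaceBeltrami (ballMetric (n + 1)) u x - s * (n - s) * u x = 0) ∧
  ∃ F H : Euc (n + 1) → ℝ,
    ContDiffOn ℝ ∞ F (Metric.closedBall 0 1) ∧
    ContDiffOn ℝ ∞ H (Metric.closedBall 0 1) ∧
    (∀ x ∈ Metric.ball (0 : Euc (n + 1)) 1,
      u x = F x * rho ‖x‖ ^ ((n : ℝ) - s) + H x * rho ‖x‖ ^ s) ∧
    ∀ ξ : Sph n, F ξ = f ξ

/-- `Y` is a spherical harmonic of degree `l` on `𝕊ⁿ`: the restriction of a homogeneous harmonic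
polynomial of degree `l`. -/
def IsSphericalHarmonic (n l : ℕ) (Y : Sph n → ℝ) : Prop :=
  ∃ P : MvPolynomial (Fin (n + 1)) ℝ, P.IsHomogeneous l ∧
    ∑ i, MvPolynomial.pderiv i (MvPolynomial.pderiv i P) = 0 ∧
    ∀ ξ : Sph n, Y ξ = MvPolynomial.eval (fun i => (ξ : Euc (n + 1)) i) P

/-- `f = ∑ Y_l` is the expansion of `f` in spherical harmonics, convergent in `L²(𝕊ⁿ)`
for the surface measure. -/
def IsHarmonicExpansion (n : ℕ) (f : Sph n → ℝ) (Y : ℕ → Sph n → ℝ) : Prop :=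
  (∀ l, IsSphericalHarmonic n l (Y l)) ∧
  Tendsto (fun N : ℕ => eLpNorm (fun ξ => f ξ - ∑ l ∈ Finset.range N, Y l ξ) 2
    (volume : Measure (Euc (n + 1))).toSphere) atTop (𝓝 0)

/-- The rising factorial `(a)_k`. -/
def rising (a : ℝ) (k : ℕ) : ℝ := (ascPochhammer ℝ k).eval a

/-- The series `∑_{l ≥ 0} a_l` converges to `A`, in the sense of partial sums. -/
def SeriesConvergesTo (a : ℕ → ℝ) (A : ℝ) : Prop :=
  Tendsto (fun N : ℕ => ∑ l ∈ Finset.range N, a l) atTop (𝓝 A)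

/-- The `l`-th hypergeometric factor of the `ρ^{n-s}` part. -/
def lowerFactor (n : ℕ) (γ : ℝ) (l : ℕ) (r : ℝ) : ℝ :=
  ₂F₁ ((l : ℝ) + n / 2 - γ) (1 / 2 - γ) (1 - 2 * γ) (2 * rho r)

/-- The `l`-th hypergeometric factor of the `ρ^s` part, with its quotient of Gamma values. -/
def upperFactor (n : ℕ) (γ : ℝ) (l : ℕ) (r : ℝ) : ℝ :=
  Real.Gamma ((l : ℝ) + n / 2 + γ) / Real.Gamma ((l : ℝ) + n / 2 - γ) *
    ₂F₁ (1 / 2 + γ) ((l : ℝ) + n / 2 + γ) (1 + 2 * γ) (2 * rho r)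

/-- The constant `Γ(-γ) / (2^{2γ} Γ(γ))`. -/
def scatConst (γ : ℝ) : ℝ := Real.Gamma (-γ) / ((2 : ℝ) ^ (2 * γ) * Real.Gamma γ)

/-- The polynomial `∑_{k ≤ m} (l + (n-1)/2 - m)_k (-m)_k / (-2m)_k · (2ρ)^k / k!`. -/
def halfIntFactor (n m l : ℕ) (r : ℝ) : ℝ :=
  ∑ k ∈ Finset.range (m + 1),
    rising ((l : ℝ) + ((n : ℝ) - 1) / 2 - m) k * rising (-(m : ℝ)) k / rising (-2 * (m : ℝ)) k *
      ((2 * rho r) ^ k / (k.factorial : ℝ))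

end HypPoisson

end

/-! Separation of variables. Fix a harmonic polynomial `Z`, homogeneous of degree `l`, and pair `u`
with it on the sphere of radius `r` (`sphCoef`). Since the spherical Laplacian is symmetric and `Z`
is an eigenfunction of it on the sphere, the resulting function of `r` solves a radial ODE
(`sphCoef_radial`, `IsPoissonSolution.isRadialSol`). The solution is smooth at the origin, and a
Wronskian argument shows that solutions regular there are all multiples of a single one,
`regularSol`. Dividing by `ρ^{n-s}` and letting `r → 1` leaves the pairing of `f` with `Z`, which
fixes the multiple. So the component of `u` is `Φ_l(r) ∫ f Z = Φ_l(r) ∫ Y_l Z`, where `Φ_l` is the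
regular solution normalized at the boundary (`IsPoissonSolution.sphCoef_eq`).

It remains to compute `Φ_l`. Under `z = r²` the radial equation becomes hypergeometric, and its
solutions with boundary exponents `n/2 ∓ γ` are power series in `1 - r² = 2ρ`. For generic `γ` the
regular solution combines both. The ratio of the two coefficients comes from their singular
behaviour at the origin: the quotient of the two power series tends to the limiting quotient of
their coefficients, a quotient of Gamma values, which Legendre duplication turns into `scatConst`
(`isNormalizedSol_generic`). For `γ = m + 1/2` the first series terminates, is already regular at
the origin, and is the whole answer (`isNormalizedSol_halfInt`).

For convergence, three estimates combine into a geometric bound: `Φ_l` decays like `(r/r')^l`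
relative to a larger radius `r'`; the supremum of a degree `l` harmonic exceeds its `L²` norm by at
most `C (1+δ)^l`; and Bessel's inequality bounds `Φ_l(r') Y_l` in `L²`
(`IsPoissonSolution.exists_geometric_bound`). The sum is then continuous on each sphere and has the
same harmonic components as `u`. Completeness of spherical harmonics (`eq_zero_of_orthogonal`) makes
the two equal. -/

noncomputable section

namespace HypPoisson

/-! ### Power series on the unit interval and the hypergeometric equation -/

/-- The power series with coefficients `t` converges absolutely on `(-1, 1)`. -/
def UnitSummable (t : ℕ → ℝ) : Prop := ∀ x : ℝ, |x| < 1 → Summable fun k => |t k * x ^ k|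

/-- The sum of the power series with coefficients `t`. -/
def powSum (t : ℕ → ℝ) (x : ℝ) : ℝ := ∑' k, t k * x ^ k

/-- The coefficients of the derived power series. -/
def derivCoeff (t : ℕ → ℝ) (k : ℕ) : ℝ := (k + 1) * t (k + 1)

/-- The recurrence satisfied by the coefficients of a solution of the hypergeometric equation. -/
def HypRec (a b c : ℝ) (t : ℕ → ℝ) : Prop :=
  ∀ k : ℕ, (k + 1) * (c + k) * t (k + 1) = (a + k) * (b + k) * t k

theorem UnitSummable.hasSum {t : ℕ → ℝ} (ht : UnitSummable t) {x : ℝ} (hx : |x| < 1) :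
    HasSum (fun k => t k * x ^ k) (powSum t x) :=
  (ht x hx).of_abs.hasSum

theorem UnitSummable.exists_bound {t : ℕ → ℝ} (ht : UnitSummable t) {y : ℝ} (hy0 : 0 < y)
    (hy1 : y < 1) : ∃ M, ∀ k, |t k| * y ^ k ≤ M := by
  have h := (ht y (by rwa [abs_of_pos hy0])).tendsto_atTop_zero.bddAbove_range
  obtain ⟨M, hM⟩ := h
  refine ⟨M, fun k => ?_⟩
  have := hM ⟨k, rfl⟩
  simpa [abs_mul, abs_pow, abs_of_pos hy0] using this

/-- At an intermediate radius `z` the terms `|t k| z^k` are bounded, and the factor `(y/z)^k` that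
is left over absorbs `k + 1`. -/
theorem derivCoeff_bound {t : ℕ → ℝ} (ht : UnitSummable t) {y : ℝ} (hy0 : 0 ≤ y) (hy1 : y < 1) :
    Summable fun k => |derivCoeff t k| * y ^ k := by
  obtain ⟨z, hyz, hz1⟩ := exists_between hy1
  have hz0 : 0 < z := hy0.trans_lt hyz
  obtain ⟨M, hM⟩ := ht.exists_bound hz0 hz1
  have hq : ‖y / z‖ < 1 := by
    rw [Real.norm_eq_abs, abs_of_nonneg (by positivity), div_lt_one hz0]; exact hyz
  have h1 := (summable_pow_mul_geometric_of_norm_lt_one 1 hq).add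
    (summable_pow_mul_geometric_of_norm_lt_one 0 hq)
  refine Summable.of_nonneg_of_le (fun k => by positivity) (fun k => ?_) (h1.mul_left (M / z))
  have h2 := hM (k + 1)
  have h3 : (0 : ℝ) ≤ (k + 1) * (y / z) ^ k := by positivity
  have h4 : |derivCoeff t k| * y ^ k = (|t (k + 1)| * z ^ (k + 1)) / z * ((k + 1) * (y / z) ^ k) := by
    have : |((k : ℝ) + 1)| = k + 1 := abs_of_nonneg (by positivity)
    rw [derivCoeff, abs_mul, this, div_pow, pow_succ]
    field_simp
  rw [h4]
  calc _ ≤ M / z * ((k + 1) * (y / z) ^ k) := by gcongr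
    _ = _ := by rw [pow_one, pow_zero]; ring

theorem UnitSummable.derivCoeff {t : ℕ → ℝ} (ht : UnitSummable t) :
    UnitSummable (derivCoeff t) := by
  intro x hx
  simpa [abs_mul, abs_pow] using derivCoeff_bound ht (abs_nonneg x) hx

theorem hasDerivAt_powSum {t : ℕ → ℝ} (ht : UnitSummable t) {x : ℝ} (hx : |x| < 1) :
    HasDerivAt (powSum t) (powSum (derivCoeff t) x) x := by
  obtain ⟨y, hxy, hy1⟩ := exists_between hx
  have hy0 : 0 < y := (abs_nonneg x).trans_lt hxy
  have hb := derivCoeff_bound ht hy0.le hy1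
  have hu : Summable fun k : ℕ => k * |t k| * y ^ (k - 1) := by
    rw [← summable_nat_add_iff 1]
    refine hb.congr fun k => ?_
    have : |((k : ℝ) + 1)| = k + 1 := abs_of_nonneg (by positivity)
    simp [HypPoisson.derivCoeff, abs_mul, this]
  have key := hasDerivAt_tsum_of_isPreconnected (g := fun k (z : ℝ) => t k * z ^ k)
    (g' := fun k z => t k * (k * z ^ (k - 1))) (t := Set.Ioo (-y) y) (y₀ := 0) (y := x) hu isOpen_Ioo
    isPreconnected_Ioo (fun k z _ => (hasDerivAt_pow k z).const_mul _) (fun k z hz => ?_)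
    (by simp [hy0]) ?_ (abs_lt.1 hxy)
  · convert! key using 1
    have hs : Summable fun k : ℕ => t k * (k * x ^ (k - 1)) := by
      rw [← summable_nat_add_iff 1]
      refine (ht.derivCoeff.hasSum hx).summable.congr fun k => ?_
      simp [HypPoisson.derivCoeff]; ring
    rw [hs.tsum_eq_zero_add, powSum]
    simp only [CharP.cast_eq_zero, zero_mul, mul_zero, zero_add]
    refine tsum_congr fun k => ?_
    simp [HypPoisson.derivCoeff]; ring
  · have hz' : |z| ≤ y := (abs_lt.2 hz).le
    rw [Real.norm_eq_abs, abs_mul, abs_mul, abs_pow, Nat.abs_cast]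
    calc |t k| * (k * |z| ^ (k - 1)) ≤ |t k| * (k * y ^ (k - 1)) := by gcongr
      _ = _ := by ring
  · exact (ht 0 (by simp)).of_abs

theorem continuousAt_powSum {t : ℕ → ℝ} (ht : UnitSummable t) {x : ℝ} (hx : |x| < 1) :
    ContinuousAt (powSum t) x := (hasDerivAt_powSum ht hx).continuousAt

theorem powSum_zero (t : ℕ → ℝ) : powSum t 0 = t 0 := by
  rw [powSum, tsum_eq_single 0 (by intro k hk; simp [hk])]; simp

/-- Comparison of coefficients. Working from the recurrence rather than from the explicit
coefficients also admits `c = -2m`, which occurs for half-integral `γ` and where the Gauss series is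
not available. -/
theorem HypRec.equation {a b c : ℝ} {t : ℕ → ℝ} (hr : HypRec a b c t) (ht : UnitSummable t)
    {x : ℝ} (hx : |x| < 1) :
    x * (1 - x) * powSum (derivCoeff (derivCoeff t)) x
      + (c - (a + b + 1) * x) * powSum (derivCoeff t) x - a * b * powSum t x = 0 := by
  have h0 := ht.hasSum hx
  have h1 := ht.derivCoeff.hasSum hx
  have h2 := ht.derivCoeff.derivCoeff.hasSum hx
  have e1 : HasSum (fun k : ℕ => k * t k * x ^ k) (x * powSum (derivCoeff t) x) := by
    rw [← hasSum_nat_add_iff' 1]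
    convert! h1.mul_left x using 1
    · ext k; simp [HypPoisson.derivCoeff]; ring
    · simp
  have e2 : HasSum (fun k : ℕ => (k + 1) * k * t (k + 1) * x ^ k)
      (x * powSum (derivCoeff (derivCoeff t)) x) := by
    rw [← hasSum_nat_add_iff' 1]
    convert! h2.mul_left x using 1
    · ext k; simp [HypPoisson.derivCoeff]; ring
    · simp
  have e3 : HasSum (fun k : ℕ => k * (k - 1) * t k * x ^ k)
      (x * (x * powSum (derivCoeff (derivCoeff t)) x)) := by
    rw [← hasSum_nat_add_iff' 1]
    convert! e2.mul_left x using 1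
    · ext k; simp; ring
    · simp
  have h := (((e2.sub e3).add (h1.mul_left c)).sub (e1.mul_left (a + b + 1))).sub
    (h0.mul_left (a * b))
  have hz : (fun k : ℕ => (((k + 1) * k * t (k + 1) * x ^ k - k * (k - 1) * t k * x ^ k)
      + c * (derivCoeff t k * x ^ k)) - (a + b + 1) * (k * t k * x ^ k)
      - a * b * (t k * x ^ k)) = fun _ => 0 := by
    ext k
    have := hr k
    simp only [HypPoisson.derivCoeff]
    linear_combination x ^ k * this
  rw [hz] at h
  have := h.unique hasSum_zero
  linear_combination this

theorem HypRec.unitSummable {a b c : ℝ} {t : ℕ → ℝ} (hr : HypRec a b c t)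
    (hc : ∀ k : ℕ, c + k ≠ 0) : UnitSummable t := by
  intro x hx
  obtain ⟨y, hxy, hy1⟩ := exists_between hx
  have hlim : Tendsto (fun k : ℕ => |(a + k) * (b + k) / ((k + 1) * (c + k)) * x|) atTop
      (𝓝 |1 * x|) := by
    refine Tendsto.abs (Tendsto.mul_const _ ?_)
    have h1 : ∀ d : ℝ, Tendsto (fun k : ℕ => (d + k) / (k : ℝ)) atTop (𝓝 1) := by
      intro d
      have := (tendsto_const_nhds (x := d)).div_atTop (tendsto_natCast_atTop_atTop (R := ℝ))
      have h2 := this.add_const 1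
      rw [zero_add] at h2
      refine h2.congr' ?_
      filter_upwards [eventually_gt_atTop 0] with k hk
      have : (k : ℝ) ≠ 0 := by positivity
      field_simp
    have h3 := ((h1 a).mul (h1 b)).div ((h1 1).mul (h1 c)) (by simp)
    simp only [mul_one, div_one] at h3
    refine h3.congr' ?_
    filter_upwards [eventually_gt_atTop 0] with k hk
    have : (k : ℝ) ≠ 0 := by positivity
    have hck := hc k
    simp only [Pi.div_apply]
    rw [add_comm (1 : ℝ)]
    field_simp
  rw [one_mul] at hlim
  have hev := hlim.eventually_le_const hxy
  have := summable_of_ratio_norm_eventually_le (f := fun k => t k * x ^ k) hy1 (by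
    filter_upwards [hev] with k hk
    have h := hr k
    have hck := hc k
    have ht : t (k + 1) = (a + k) * (b + k) / ((k + 1) * (c + k)) * t k := by
      field_simp
      linear_combination h
    rw [ht, pow_succ]
    calc _ = |(a + k) * (b + k) / ((k + 1) * (c + k)) * x| * ‖t k * x ^ k‖ := by
          rw [Real.norm_eq_abs, Real.norm_eq_abs, ← abs_mul]; congr 1; ring
      _ ≤ _ := by gcongr)
  exact this.abs

/-- The coefficients of the Gauss hypergeometric series. -/
abbrev hypCoeff (a b c : ℝ) (k : ℕ) : ℝ := ordinaryHypergeometricCoefficient a b c k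

theorem hypCoeff_zero (a b c : ℝ) : hypCoeff a b c 0 = 1 := by
  simp [hypCoeff, ordinaryHypergeometricCoefficient]

theorem hypRec_hypCoeff {a b c : ℝ} (hc : ∀ k : ℕ, c + k ≠ 0) : HypRec a b c (hypCoeff a b c) := by
  intro k
  have hck := hc k
  simp only [hypCoeff, ordinaryHypergeometricCoefficient, ascPochhammer_succ_eval,
    Nat.factorial_succ, mul_inv]
  push_cast
  field_simp

theorem ordinaryHypergeometric_eq_powSum (a b c x : ℝ) :
    (₂F₁ a b c x : ℝ) = powSum (hypCoeff a b c) x := by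
  rw [ordinaryHypergeometric_eq_tsum]; rfl

theorem hypCoeff_pos {a b c : ℝ} (ha : 0 < a) (hb : 0 < b) (hc : 0 < c) (k : ℕ) :
    0 < hypCoeff a b c k := by
  have h1 := ascPochhammer_pos k a ha
  have h2 := ascPochhammer_pos k b hb
  have h3 := ascPochhammer_pos k c hc
  simp only [hypCoeff, ordinaryHypergeometricCoefficient]
  positivity

theorem powSum_pos {t : ℕ → ℝ} (ht : UnitSummable t) (hp : ∀ k, 0 < t k) {x : ℝ} (hx0 : 0 ≤ x)
    (hx : x < 1) : 0 < powSum t x := by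
  have hs := (ht.hasSum (by rwa [abs_of_nonneg hx0] : |x| < 1)).summable
  exact hs.tsum_pos (fun k => mul_nonneg (hp k).le (by positivity)) 0 (by simpa using hp 0)

theorem powSum_mono {t : ℕ → ℝ} (ht : UnitSummable t) (hp : ∀ k, 0 < t k) {x y : ℝ} (hx0 : 0 ≤ x)
    (hxy : x ≤ y) (hy : y < 1) : powSum t x ≤ powSum t y := by
  have hs := (ht.hasSum (by rw [abs_of_nonneg hx0]; linarith : |x| < 1)).summable
  have hs' := (ht.hasSum (by rwa [abs_of_nonneg (hx0.trans hxy)] : |y| < 1)).summable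
  refine hs.tsum_le_tsum (fun k => ?_) hs'
  have := (hp k).le
  gcongr

/-! ### Behaviour of power series at the end point -/

theorem tendsto_powSum_atTop {b : ℕ → ℝ} (hb : UnitSummable b) (hp : ∀ k, 0 < b k)
    (hd : ¬ Summable b) : Tendsto (powSum b) (𝓝[<] 1) atTop := by
  rw [tendsto_atTop]
  intro M
  have h1 := (not_summable_iff_tendsto_nat_atTop_of_nonneg fun k => (hp k).le).1 hd
  obtain ⟨N, hN⟩ := (h1.eventually_gt_atTop M).exists
  have hc : ContinuousAt (fun x : ℝ => ∑ k ∈ Finset.range N, b k * x ^ k) 1 := by fun_prop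
  have h2 : ∀ᶠ x in 𝓝 (1 : ℝ), M < ∑ k ∈ Finset.range N, b k * x ^ k :=
    hc.eventually (lt_mem_nhds (by simpa using hN))
  filter_upwards [nhdsWithin_le_nhds h2, Ioo_mem_nhdsLT (show (0 : ℝ) < 1 by norm_num)] with x hx hx'
  refine hx.le.trans ((hb.hasSum (by rw [abs_of_pos hx'.1]; exact hx'.2)).summable.sum_le_tsum _ ?_)
  intro k _
  have := (hp k).le
  have := hx'.1.le
  positivity

/-- Abelian argument: the finitely many early terms contribute at most a constant `C`, the later
ones at most `ε/2` times the denominator, and the denominator diverges. -/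
theorem tendsto_powSum_div {a b : ℕ → ℝ} {L : ℝ} (ha : UnitSummable a) (hb : UnitSummable b)
    (hp : ∀ k, 0 < b k) (hd : ¬ Summable b) (hL : Tendsto (fun k => a k / b k) atTop (𝓝 L)) :
    Tendsto (fun x => powSum a x / powSum b x) (𝓝[<] 1) (𝓝 L) := by
  have htop := tendsto_powSum_atTop hb hp hd
  rw [Metric.tendsto_nhds]
  intro ε hε
  have h1 := (Metric.tendsto_atTop.1 hL) (ε / 2) (by positivity)
  obtain ⟨N, hN⟩ := h1
  set C := ∑ k ∈ Finset.range N, |a k - L * b k| with hC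
  -- Past this threshold `C` is less than `ε/2` times the denominator.
  have h2 := htop.eventually_gt_atTop (2 * C / ε)
  filter_upwards [h2, htop.eventually_gt_atTop 0, Ioo_mem_nhdsLT (show (0 : ℝ) < 1 by norm_num)]
    with x hx hpos hx'
  have hx1 : |x| < 1 := by rw [abs_of_pos hx'.1]; exact hx'.2
  have hsa := ha.hasSum hx1
  have hsb := hb.hasSum hx1
  have hdiff := hsa.sub (hsb.mul_left L)
  have hbd : |powSum a x - L * powSum b x| ≤ C + ε / 2 * powSum b x := by
    have hfin : HasSum (fun k => if k < N then |a k - L * b k| else 0) C := by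
      rw [hC, Finset.sum_congr rfl (g := fun k => if k < N then |a k - L * b k| else 0)
        (fun k hk => by simp [Finset.mem_range.1 hk])]
      exact hasSum_sum_of_ne_finset_zero (fun k hk => by simp at hk; simp [hk])
    have hmaj := hfin.add (hsb.mul_left (ε / 2))
    rw [← Real.norm_eq_abs]
    refine hdiff.norm_le_of_bounded hmaj fun k => ?_
    have hxk : 0 ≤ x ^ k := pow_nonneg hx'.1.le k
    have hxk1 : x ^ k ≤ 1 := pow_le_one₀ hx'.1.le hx'.2.le
    have hbk := hp k
    have e : a k * x ^ k - L * (b k * x ^ k) = (a k - L * b k) * x ^ k := by ring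
    rw [e, Real.norm_eq_abs, abs_mul, abs_of_nonneg hxk]
    split_ifs with hk
    · have : |a k - L * b k| * x ^ k ≤ |a k - L * b k| * 1 := by gcongr
      have : 0 ≤ ε / 2 * (b k * x ^ k) := by positivity
      linarith
    · have h3 := hN k (not_lt.1 hk)
      rw [Real.dist_eq] at h3
      have h4 : |a k - L * b k| = |a k / b k - L| * b k := by
        rw [← abs_of_pos hbk, ← abs_mul, abs_of_pos hbk]
        congr 1
        field_simp
      rw [h4, zero_add]
      calc _ ≤ ε / 2 * b k * x ^ k := by gcongr
        _ = _ := by ring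
  rw [Real.dist_eq]
  have h5 : powSum a x / powSum b x - L = (powSum a x - L * powSum b x) / powSum b x := by
    field_simp
  rw [h5, abs_div, abs_of_pos hpos, div_lt_iff₀ hpos]
  have h6 : 2 * C < powSum b x * ε := by rwa [div_lt_iff₀ hε] at hx
  linarith

/-- When `c ≤ a + b`, the recurrence makes `k t_k` nondecreasing for `k ≥ 1`, so the coefficients
dominate a multiple of the harmonic series. -/
theorem not_summable_hypCoeff {a b c : ℝ} (ha : 0 < a) (hb : 0 < b) (hc : 0 < c)
    (hab : c ≤ a + b) : ¬ Summable (hypCoeff a b c) := by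
  have hr := hypRec_hypCoeff (a := a) (b := b) (c := c) (fun k => by positivity)
  have hp := hypCoeff_pos ha hb hc
  have hlow : ∀ k : ℕ, hypCoeff a b c 1 ≤ (k + 1) * hypCoeff a b c (k + 1) := by
    intro k
    induction k with
    | zero => simp
    | succ k ih =>
      refine ih.trans ?_
      have h := hr (k + 1)
      have hpk := hp (k + 1)
      push_cast at h ⊢
      have hck : 0 < c + ((k : ℝ) + 1) := by positivity
      rw [← mul_le_mul_iff_left₀ hck]
      have : (k + 1) * hypCoeff a b c (k + 1) * (c + (k + 1))
          ≤ (a + (k + 1)) * (b + (k + 1)) * hypCoeff a b c (k + 1) := by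
        have h0 : (k + 1) * (c + (k + 1)) ≤ (a + ((k : ℝ) + 1)) * (b + (k + 1)) := by
          have hk : (0 : ℝ) ≤ (k : ℝ) + 1 := by positivity
          nlinarith [mul_pos ha hb, mul_le_mul_of_nonneg_left hab hk]
        nlinarith
      linarith
  intro hs
  have hs1 := (summable_nat_add_iff 1).2 hs
  have h0 := hp 1
  have : Summable fun k : ℕ => hypCoeff a b c 1 * (1 / ((k : ℝ) + 1)) := by
    refine Summable.of_nonneg_of_le (fun k => by positivity) (fun k => ?_) hs1
    have := hlow k
    rw [mul_one_div, div_le_iff₀ (by positivity)]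
    linarith
  have h1 := (summable_mul_left_iff h0.ne').1 this
  have h2 := (summable_nat_add_iff (f := fun k : ℕ => 1 / (k : ℝ)) 1).1 (by simpa using h1)
  exact Real.not_summable_one_div_natCast h2

theorem ascPochhammer_eval_eq_prod (s : ℝ) (k : ℕ) :
    (ascPochhammer ℝ k).eval s = ∏ j ∈ Finset.range k, (s + j) := by
  induction k with
  | zero => simp
  | succ k ih => rw [ascPochhammer_succ_eval, Finset.prod_range_succ, ih]

theorem ascPochhammer_eq_gammaSeq {s : ℝ} (hs : ∀ k : ℕ, s + k ≠ 0) {k : ℕ} (hk : 0 < k) :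
    (ascPochhammer ℝ (k + 1)).eval s = (k : ℝ) ^ s * k.factorial * (Real.GammaSeq s k)⁻¹ := by
  have hprod : ∏ j ∈ Finset.range (k + 1), (s + j) ≠ 0 := Finset.prod_ne_zero_iff.2 fun j _ => hs j
  have hk' : (0 : ℝ) < k := by exact_mod_cast hk
  have := (Real.rpow_pos_of_pos hk' s).ne'
  have : (k.factorial : ℝ) ≠ 0 := by positivity
  rw [ascPochhammer_eval_eq_prod, Real.GammaSeq]
  field_simp

/-- Euler's limit gives `(s)_{k+1} ~ k^s k! / Γ(s)`. The hypothesis `h` is exactly what cancels the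
powers of `k`. -/
theorem tendsto_hypCoeff_div {a b c a' b' c' : ℝ} (ha : ∀ k : ℕ, a + k ≠ 0)
    (hb : ∀ k : ℕ, b + k ≠ 0) (hc : ∀ k : ℕ, c + k ≠ 0) (ha' : ∀ k : ℕ, a' + k ≠ 0)
    (hb' : ∀ k : ℕ, b' + k ≠ 0) (hc' : ∀ k : ℕ, c' + k ≠ 0) (h : a + b - c = a' + b' - c') :
    Tendsto (fun k => hypCoeff a b c k / hypCoeff a' b' c' k) atTop
      (𝓝 (Real.Gamma c * Real.Gamma a' * Real.Gamma b' /
        (Real.Gamma c' * Real.Gamma a * Real.Gamma b))) := by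
  have hΓ : ∀ s : ℝ, (∀ k : ℕ, s + k ≠ 0) → Real.Gamma s ≠ 0 := fun s hs =>
    Real.Gamma_ne_zero fun m hm => hs m (by rw [hm]; ring)
  -- `Real.GammaSeq s k` has `k + 1` factors in its denominator, hence the shift by one.
  rw [← tendsto_add_atTop_iff_nat 1]
  have G := Real.GammaSeq_tendsto_Gamma
  have hlim := (((G c).mul (G a')).mul (G b')).div (((G c').mul (G a)).mul (G b))
    (mul_ne_zero (mul_ne_zero (hΓ _ hc') (hΓ _ ha)) (hΓ _ hb))
  refine hlim.congr' ?_
  filter_upwards [eventually_gt_atTop 0] with k hk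
  have hk' : (0 : ℝ) < k := by exact_mod_cast hk
  have hG : ∀ s : ℝ, (∀ k : ℕ, s + k ≠ 0) → Real.GammaSeq s k ≠ 0 := by
    intro s hs
    have hprod : ∏ j ∈ Finset.range (k + 1), (s + j) ≠ 0 :=
      Finset.prod_ne_zero_iff.2 fun j _ => hs j
    have := (Real.rpow_pos_of_pos hk' s).ne'
    have : (k.factorial : ℝ) ≠ 0 := by positivity
    rw [Real.GammaSeq]
    positivity
  have hpow : (k : ℝ) ^ a * (k : ℝ) ^ b * (k : ℝ) ^ c' = (k : ℝ) ^ a' * (k : ℝ) ^ b' * (k : ℝ) ^ c := by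
    rw [← Real.rpow_add hk', ← Real.rpow_add hk', ← Real.rpow_add hk', ← Real.rpow_add hk']
    congr 1; linarith
  have hp : ∀ s : ℝ, (k : ℝ) ^ s ≠ 0 := fun s => (Real.rpow_pos_of_pos hk' s).ne'
  simp only [hypCoeff, ordinaryHypergeometricCoefficient, ascPochhammer_eq_gammaSeq ha hk,
    ascPochhammer_eq_gammaSeq hb hk, ascPochhammer_eq_gammaSeq hc hk,
    ascPochhammer_eq_gammaSeq ha' hk, ascPochhammer_eq_gammaSeq hb' hk,
    ascPochhammer_eq_gammaSeq hc' hk, Pi.div_apply]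
  have := hG a ha
  have := hG b hb
  have := hG c hc
  have := hG a' ha'
  have := hG b' hb'
  have := hG c' hc'
  have := hp a
  have := hp b
  have := hp c
  have := hp a'
  have := hp b'
  have := hp c'
  have : (k.factorial : ℝ) ≠ 0 := by positivity
  have : ((k + 1).factorial : ℝ) ≠ 0 := by positivity
  field_simp
  linear_combination (-1 : ℝ) * hpow

/-! ### The radial equation -/

/-- `φ`, with derivative `φ'`, solves on `(0, 1)` the equation satisfied by the degree `l` component
of a solution of `Δ u + κ u = 0` in the hyperbolic ball `𝔹^{n+1}`. -/
def IsRadialSol (n l : ℕ) (κ : ℝ) (φ φ' : ℝ → ℝ) : Prop :=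
  ∀ r, 0 < r → r < 1 → HasDerivAt φ (φ' r) r ∧ ∃ φ'', HasDerivAt φ' φ'' r ∧
    rho r ^ 2 * (φ'' + n / r * φ' r - l * (l + n - 1) / r ^ 2 * φ r)
      + (n - 1) * rho r * r * φ' r + κ * φ r = 0

/-- The behaviour at the origin that singles out the regular solutions of the radial equation. -/
def RegularAtZero (n : ℕ) (φ φ' : ℝ → ℝ) : Prop :=
  Tendsto (fun r => r ^ n * φ' r) (𝓝[>] 0) (𝓝 0) ∧ ∃ A, Tendsto φ (𝓝[>] 0) (𝓝 A)

theorem rho_pos {r : ℝ} (h0 : 0 ≤ r) (h1 : r < 1) : 0 < rho r := by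
  unfold rho; nlinarith

theorem two_mul_rho (r : ℝ) : 2 * rho r = 1 - r ^ 2 := by unfold rho; ring

theorem hasDerivAt_rho (r : ℝ) : HasDerivAt rho (-r) r := by
  unfold rho
  convert! (((hasDerivAt_pow 2 r).const_sub 1).div_const 2) using 1
  simp
  ring

theorem continuous_rho : Continuous rho := by unfold rho; fun_prop

/-- The radial profile `r^l ρ^σ w(r²)`. -/
def profile (l : ℕ) (σ : ℝ) (w : ℝ → ℝ) (r : ℝ) : ℝ := r ^ l * rho r ^ σ * w (r ^ 2)

/-- The derivative of `profile l σ w` on `(0, 1)`, where `w'` is the derivative of `w`. -/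
def profileDeriv (l : ℕ) (σ : ℝ) (w w' : ℝ → ℝ) (r : ℝ) : ℝ :=
  r ^ l * rho r ^ σ * ((l / r - σ * r / rho r) * w (r ^ 2) + 2 * r * w' (r ^ 2))

/-- `hκ` is the indicial equation at the boundary. Splitting off `r^l ρ^σ` and setting `z = r²`
leaves the hypergeometric equation with parameters `l + σ`, `σ - (n-1)/2` and `l + (n+1)/2`. -/
theorem isRadialSol_profile {n l : ℕ} {σ κ : ℝ} (hκ : κ = σ * (n - σ)) {w w' w'' : ℝ → ℝ}
    (hw : ∀ z, 0 < z → z < 1 → HasDerivAt w (w' z) z)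
    (hw' : ∀ z, 0 < z → z < 1 → HasDerivAt w' (w'' z) z)
    (heq : ∀ z, 0 < z → z < 1 → z * (1 - z) * w'' z
      + ((l + (n + 1) / 2) - (l + σ + (σ - (n - 1) / 2) + 1) * z) * w' z
      - (l + σ) * (σ - (n - 1) / 2) * w z = 0) :
    IsRadialSol n l κ (profile l σ w) (profileDeriv l σ w w') := by
  intro r h0 h1
  have hz0 : 0 < r ^ 2 := by positivity
  have hz1 : r ^ 2 < 1 := by nlinarith
  have hρ := rho_pos h0.le h1
  have hr0 := h0.ne'
  have hρ0 := hρ.ne'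
  have hE : HasDerivAt (fun r => r ^ l * rho r ^ σ)
      (r ^ l * rho r ^ σ * (l / r - σ * r / rho r)) r := by
    have h := (hasDerivAt_pow l r).mul ((hasDerivAt_rho r).rpow_const (p := σ) (Or.inl hρ0))
    convert! h using 1
    rw [Real.rpow_sub_one hρ0]
    rcases l with _ | l
    · simp; field_simp
    · simp only [Nat.cast_add, Nat.cast_one, add_tsub_cancel_right, pow_succ]
      field_simp
      ring
  have hsq : HasDerivAt (fun r : ℝ => r ^ 2) (2 * r) r := by simpa using hasDerivAt_pow 2 r
  have hW : HasDerivAt (fun r => w (r ^ 2)) (w' (r ^ 2) * (2 * r)) r :=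
    HasDerivAt.comp (h := fun r : ℝ => r ^ 2) r (hw _ hz0 hz1) hsq
  have hW' : HasDerivAt (fun r => w' (r ^ 2)) (w'' (r ^ 2) * (2 * r)) r :=
    HasDerivAt.comp (h := fun r : ℝ => r ^ 2) r (hw' _ hz0 hz1) hsq
  have hg : HasDerivAt (fun r => l / r - σ * r / rho r)
      (-l / r ^ 2 - σ * (rho r + r ^ 2) / rho r ^ 2) r := by
    have a1 := ((hasDerivAt_inv hr0).const_mul (l : ℝ))
    have a2 := (((hasDerivAt_id r).const_mul σ).div (hasDerivAt_rho r) hρ0)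
    convert! a1.sub a2 using 1
    simp; field_simp
  refine ⟨?_, _, hE.mul ((hg.mul hW).add ((((hasDerivAt_id r).const_mul 2)).mul hW')), ?_⟩
  · convert! hE.mul hW using 1
    simp only [profileDeriv]; ring
  · have h := heq _ hz0 hz1
    have hd : 1 - r ^ 2 ≠ 0 := by linarith
    have hre : rho r = (1 - r ^ 2) / 2 := rfl
    simp only [profile, profileDeriv, hκ, id, mul_one]
    set E := r ^ l * rho r ^ σ
    set w0 := w (r ^ 2)
    set w1 := w' (r ^ 2)
    set w2 := w'' (r ^ 2)
    rw [hre]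
    -- The radial operator applied to the profile is `2ρ · r^l ρ^σ` times the hypergeometric
    -- operator applied to `w`.
    have : ∀ X, X = 2 * ((1 - r ^ 2) / 2) * E * (r ^ 2 * (1 - r ^ 2) * w2
      + ((l + (n + 1) / 2) - (l + σ + (σ - (n - 1) / 2) + 1) * r ^ 2) * w1
      - (l + σ) * (σ - (n - 1) / 2) * w0) → X = 0 := fun X hX => by rw [hX, h, mul_zero]
    apply this
    field_simp
    ring

theorem regularAtZero_profile {n l : ℕ} (hn : 1 ≤ n) {σ A B : ℝ} {w w' : ℝ → ℝ}
    (hw : Tendsto (fun r : ℝ => w (r ^ 2)) (𝓝[>] 0) (𝓝 A))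
    (hw' : Tendsto (fun r : ℝ => w' (r ^ 2)) (𝓝[>] 0) (𝓝 B)) :
    RegularAtZero n (profile l σ w) (profileDeriv l σ w w') := by
  have hρ : ∀ τ : ℝ, Tendsto (fun r => rho r ^ τ) (𝓝[>] 0) (𝓝 (rho 0 ^ τ)) := fun τ =>
    ((continuous_rho.continuousAt).rpow_const (Or.inl (by simp [rho]))).tendsto.mono_left
      nhdsWithin_le_nhds
  have hpow : ∀ k : ℕ, Tendsto (fun r : ℝ => r ^ k) (𝓝[>] 0) (𝓝 (0 ^ k)) := fun k =>
    ((continuous_pow k).tendsto 0).mono_left nhdsWithin_le_nhds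
  have hρ1 : Tendsto (fun r => (rho r)⁻¹) (𝓝[>] 0) (𝓝 (rho 0)⁻¹) :=
    ((continuous_rho.tendsto 0).mono_left nhdsWithin_le_nhds).inv₀ (by simp [rho])
  refine ⟨?_, _, ((hpow l).mul (hρ σ)).mul hw⟩
  obtain ⟨N, rfl⟩ : ∃ N, n = N + 1 := ⟨n - 1, by omega⟩
  have hlim := ((((hpow N).mul (((hpow l).const_mul (l : ℝ)).mul (hρ σ))).mul hw).add
    (((hpow (N + 1 + 1)).mul ((hpow l).mul (hρ σ))).mul
      (((hρ1.const_mul (-σ)).mul hw).add (hw'.const_mul 2))))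
  -- For `l = 0` the power is `0 ^ 0 = 1`, and it is the factor `l` that vanishes.
  have hz : (l : ℝ) * 0 ^ l = 0 := by
    rcases l with _ | l <;> simp
  rw [hz] at hlim
  simp only [zero_mul, mul_zero, ne_eq, Nat.add_eq_zero_iff, one_ne_zero, and_false,
    not_false_eq_true, zero_pow, add_zero] at hlim
  refine hlim.congr' ?_
  filter_upwards [Ioo_mem_nhdsGT (show (0 : ℝ) < 1 by norm_num)] with r hr
  have h0 := hr.1.ne'
  have := (rho_pos hr.1.le hr.2).ne'
  simp only [profileDeriv]
  field_simp
  ring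

/-! ### Wronskians -/

/-- Abel's identity: the first-order coefficient is `n/r + (n-1) r/ρ`, with integrating factor `r^n
ρ^{1-n}`. Writing `n = N + 1` keeps the exponents natural. -/
theorem IsRadialSol.exists_wronskian {N l : ℕ} {κ : ℝ} {φ φ' ψ ψ' : ℝ → ℝ}
    (hφ : IsRadialSol (N + 1) l κ φ φ') (hψ : IsRadialSol (N + 1) l κ ψ ψ') :
    ∃ C, ∀ r ∈ Set.Ioo (0 : ℝ) 1,
      r ^ (N + 1) * (φ r * ψ' r - φ' r * ψ r) = C * rho r ^ N := by
  have hder : ∀ r ∈ Set.Ioo (0 : ℝ) 1, HasDerivAt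
      (fun r => r ^ (N + 1) / rho r ^ N * (φ r * ψ' r - φ' r * ψ r)) 0 r := by
    rintro r ⟨h0, h1⟩
    obtain ⟨a1, φ2, a2, a3⟩ := hφ r h0 h1
    obtain ⟨b1, ψ2, b2, b3⟩ := hψ r h0 h1
    have hρ := (rho_pos h0.le h1).ne'
    have hr := h0.ne'
    have hp : HasDerivAt (fun r => r ^ (N + 1) / rho r ^ N)
        (r ^ (N + 1) / rho r ^ N * ((N + 1) / r + N * r / rho r)) r := by
      convert! (hasDerivAt_pow (N + 1) r).div ((hasDerivAt_rho r).pow N) (pow_ne_zero _ hρ) using 1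
      rcases N with _ | N
      · simp; field_simp
      · simp only [Nat.cast_add, Nat.cast_one, add_tsub_cancel_right, Pi.pow_apply]
        field_simp
        ring
    convert! hp.mul ((a1.mul b2).sub (a2.mul b1)) using 1
    simp only [Pi.sub_apply, Pi.mul_apply]
    push_cast at a3 b3
    have key : (φ r * ψ2 - φ2 * ψ r) + ((N + 1) / r + N * r / rho r) * (φ r * ψ' r - φ' r * ψ r) = 0 := by
      have hX : rho r ^ 2 * ((φ r * ψ2 - φ2 * ψ r)
          + ((N + 1) / r + N * r / rho r) * (φ r * ψ' r - φ' r * ψ r)) = 0 := by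
        have e : rho r ^ 2 * (N * r / rho r) = N * r * rho r := by field_simp
        linear_combination φ r * b3 - ψ r * a3 + e * (φ r * ψ' r - φ' r * ψ r)
      exact (mul_eq_zero.1 hX).resolve_left (pow_ne_zero _ hρ)
    linear_combination -(r ^ (N + 1) / rho r ^ N) * key
  obtain ⟨C, hC⟩ := isOpen_Ioo.exists_is_const_of_deriv_eq_zero isPreconnected_Ioo
    (fun r hr => (hder r hr).differentiableAt.differentiableWithinAt)
    (fun r hr => (hder r hr).deriv)
  refine ⟨C, fun r hr => ?_⟩
  have hρ := (rho_pos hr.1.le hr.2).ne'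
  rw [← hC r hr]
  field_simp

theorem eq_const_mul_of_wronskian_eq_zero {φ φ' ψ ψ' : ℝ → ℝ} {a b : ℝ}
    (hφ : ∀ r ∈ Set.Ioo a b, HasDerivAt φ (φ' r) r)
    (hψ : ∀ r ∈ Set.Ioo a b, HasDerivAt ψ (ψ' r) r) (h0 : ∀ r ∈ Set.Ioo a b, ψ r ≠ 0)
    (hW : ∀ r ∈ Set.Ioo a b, φ r * ψ' r - φ' r * ψ r = 0) :
    ∃ C, ∀ r ∈ Set.Ioo a b, φ r = C * ψ r := by
  have hder : ∀ r ∈ Set.Ioo a b, HasDerivAt (fun r => φ r / ψ r) 0 r := by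
    intro r hr
    convert! (hφ r hr).div (hψ r hr) (h0 r hr) using 1
    have : φ' r * ψ r - φ r * ψ' r = 0 := by linarith [hW r hr]
    rw [this, zero_div]
  obtain ⟨C, hC⟩ := isOpen_Ioo.exists_is_const_of_deriv_eq_zero isPreconnected_Ioo
    (fun r hr => (hder r hr).differentiableAt.differentiableWithinAt)
    (fun r hr => (hder r hr).deriv)
  exact ⟨C, fun r hr => by rw [← hC r hr, div_mul_cancel₀ _ (h0 r hr)]⟩

/-- Regularity forces `r^n` times the Wronskian to `0` at the origin, whereas `ρ(0)^N ≠ 0`. So the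
constant in `exists_wronskian` is zero and `φ / ψ` is constant. -/
theorem IsRadialSol.eq_const_mul_of_regular {n l : ℕ} (hn : 1 ≤ n) {κ : ℝ} {φ φ' ψ ψ' : ℝ → ℝ}
    (hφ : IsRadialSol n l κ φ φ') (hψ : IsRadialSol n l κ ψ ψ') (rφ : RegularAtZero n φ φ')
    (rψ : RegularAtZero n ψ ψ') (hpos : ∀ r, 0 < r → r < 1 → 0 < ψ r) :
    ∃ C, ∀ r ∈ Set.Ioo (0 : ℝ) 1, φ r = C * ψ r := by
  obtain ⟨N, rfl⟩ : ∃ N, n = N + 1 := ⟨n - 1, by omega⟩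
  obtain ⟨C, hC⟩ := hφ.exists_wronskian hψ
  obtain ⟨r1, A, rA⟩ := rφ
  obtain ⟨s1, B, sB⟩ := rψ
  have hlim : Tendsto (fun r => r ^ (N + 1) * (φ r * ψ' r - φ' r * ψ r)) (𝓝[>] 0) (𝓝 0) := by
    have := (rA.mul s1).sub (r1.mul sB)
    simp only [mul_zero, zero_mul, sub_zero] at this
    refine this.congr fun r => by ring
  have hlim' : Tendsto (fun r => C * rho r ^ N) (𝓝[>] 0) (𝓝 (C * rho 0 ^ N)) :=
    ((continuous_const.mul (continuous_rho.pow N)).tendsto 0).mono_left nhdsWithin_le_nhds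
  have hC0 : C = 0 := by
    have := tendsto_nhds_unique (hlim.congr' (by
      filter_upwards [Ioo_mem_nhdsGT (show (0 : ℝ) < 1 by norm_num)] with r hr using hC r hr)) hlim'
    have h2 : rho 0 ^ N ≠ 0 := pow_ne_zero _ (by simp [rho])
    exact ((mul_eq_zero.1 this.symm).resolve_right h2)
  refine eq_const_mul_of_wronskian_eq_zero (fun r hr => (hφ r hr.1 hr.2).1)
    (fun r hr => (hψ r hr.1 hr.2).1) (fun r hr => (hpos r hr.1 hr.2).ne') fun r hr => ?_
  have := hC r hr
  rw [hC0, zero_mul] at this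
  exact (mul_eq_zero.1 this).resolve_left (pow_ne_zero _ hr.1.ne')

/-- A solution of the radial equation is a combination of two solutions that have different
behaviour at the boundary. -/
theorem IsRadialSol.exists_combination {n l : ℕ} (hn : 1 ≤ n) {κ : ℝ} {φ φ' ψ ψ' χ χ' : ℝ → ℝ}
    (hφ : IsRadialSol n l κ φ φ') (hψ : IsRadialSol n l κ ψ ψ') (hχ : IsRadialSol n l κ χ χ')
    (hχpos : ∀ r, 0 < r → r < 1 → 0 < χ r)
    (hlim : Tendsto (fun r => ψ r / χ r) (𝓝[<] 1) atTop) :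
    ∃ α β, ∀ r ∈ Set.Ioo (0 : ℝ) 1, φ r = α * ψ r + β * χ r := by
  obtain ⟨N, rfl⟩ : ∃ N, n = N + 1 := ⟨n - 1, by omega⟩
  obtain ⟨C, hC⟩ := hψ.exists_wronskian hχ
  obtain ⟨C₁, hC₁⟩ := hφ.exists_wronskian hχ
  obtain ⟨C₂, hC₂⟩ := hφ.exists_wronskian hψ
  -- A vanishing Wronskian would make `ψ / χ` constant, contradicting its divergence at the
  -- boundary.
  have hC0 : C ≠ 0 := by
    rintro rfl
    obtain ⟨K, hK⟩ := eq_const_mul_of_wronskian_eq_zero (fun r hr => (hψ r hr.1 hr.2).1)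
      (fun r hr => (hχ r hr.1 hr.2).1) (fun r hr => (hχpos r hr.1 hr.2).ne') fun r hr => by
        have := hC r hr
        rw [zero_mul] at this
        exact (mul_eq_zero.1 this).resolve_left (pow_ne_zero _ hr.1.ne')
    obtain ⟨r, h1, h2⟩ := ((hlim.eventually_gt_atTop K).and
      (Ioo_mem_nhdsLT (show (0 : ℝ) < 1 by norm_num))).exists
    rw [hK r h2, mul_div_assoc, div_self (hχpos r h2.1 h2.2).ne', mul_one] at h1
    exact lt_irrefl _ h1
  refine ⟨C₁ / C, -C₂ / C, fun r hr => ?_⟩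
  have h := hC r hr
  have h1 := hC₁ r hr
  have h2 := hC₂ r hr
  have hρ : rho r ^ N ≠ 0 := pow_ne_zero _ (rho_pos hr.1.le hr.2).ne'
  -- The three Wronskians, multiplied by `φ`, `ψ` and `χ` with alternating signs, add up to zero
  -- identically.
  have key : (rho r ^ N) * (C * φ r - (C₁ * ψ r - C₂ * χ r)) = 0 := by
    linear_combination -φ r * h + ψ r * h1 - χ r * h2
  have := (mul_eq_zero.1 key).resolve_left hρ
  field_simp
  linarith

/-! ### Solutions given by power series in `r²` and in `1 - r²` -/

theorem isRadialSol_at_zero {n l : ℕ} {σ κ : ℝ} (hκ : κ = σ * (n - σ)) {t : ℕ → ℝ}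
    (ht : UnitSummable t) (hr : HypRec (l + σ) (σ - (n - 1) / 2) (l + (n + 1) / 2) t) :
    IsRadialSol n l κ (profile l σ (powSum t)) (profileDeriv l σ (powSum t) (powSum (derivCoeff t))) := by
  have habs : ∀ z : ℝ, 0 < z → z < 1 → |z| < 1 := fun z h0 h1 => by rwa [abs_of_pos h0]
  exact isRadialSol_profile hκ (fun z h0 h1 => hasDerivAt_powSum ht (habs z h0 h1))
    (fun z h0 h1 => hasDerivAt_powSum ht.derivCoeff (habs z h0 h1))
    (fun z h0 h1 => hr.equation ht (habs z h0 h1))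

/-- The substitution `z ↦ 1 - z` preserves the hypergeometric equation and replaces `c` by `a + b +
1 - c`, here `2σ - n + 1`. -/
theorem isRadialSol_at_one {n l : ℕ} {σ κ : ℝ} (hκ : κ = σ * (n - σ)) {t : ℕ → ℝ}
    (ht : UnitSummable t) (hr : HypRec (l + σ) (σ - (n - 1) / 2) (2 * σ - n + 1) t) :
    IsRadialSol n l κ (profile l σ fun z => powSum t (1 - z))
      (profileDeriv l σ (fun z => powSum t (1 - z)) fun z => -powSum (derivCoeff t) (1 - z)) := by
  have habs : ∀ z : ℝ, 0 < z → z < 1 → |1 - z| < 1 := fun z h0 h1 => by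
    rw [abs_of_pos (by linarith)]; linarith
  have hsub : ∀ z : ℝ, HasDerivAt (fun z : ℝ => 1 - z) (-1) z := fun z => by
    simpa using (hasDerivAt_id z).const_sub 1
  refine isRadialSol_profile (w'' := fun z => powSum (derivCoeff (derivCoeff t)) (1 - z)) hκ
    (fun z h0 h1 => ?_) (fun z h0 h1 => ?_) (fun z h0 h1 => ?_)
  · convert! (hasDerivAt_powSum ht (habs z h0 h1)).comp z (hsub z) using 1
    simp
  · convert! ((hasDerivAt_powSum ht.derivCoeff (habs z h0 h1)).comp z (hsub z)).neg using 1
    simp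
  · have := hr.equation ht (habs z h0 h1)
    linear_combination this

theorem tendsto_one_sub_sq : Tendsto (fun r : ℝ => 1 - r ^ 2) (𝓝[>] 0) (𝓝[<] 1) := by
  refine tendsto_nhdsWithin_iff.2 ⟨?_, ?_⟩
  · have : Tendsto (fun r : ℝ => 1 - r ^ 2) (𝓝 0) (𝓝 (1 - 0 ^ 2)) :=
      (by fun_prop : Continuous fun r : ℝ => 1 - r ^ 2).tendsto 0
    simpa using this.mono_left nhdsWithin_le_nhds
  · filter_upwards [self_mem_nhdsWithin] with r hr
    have : (0 : ℝ) < r := hr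
    simp only [Set.mem_Iio]
    nlinarith [pow_pos this 2]

theorem tendsto_profile_at_one {l : ℕ} {σ : ℝ} {t : ℕ → ℝ} (ht : UnitSummable t) :
    Tendsto (fun r => profile l σ (fun z => powSum t (1 - z)) r / rho r ^ σ) (𝓝[<] 1) (𝓝 (t 0)) := by
  have h1 : ContinuousAt (fun r : ℝ => r ^ l * powSum t (1 - r ^ 2)) 1 := by
    refine (continuousAt_pow 1 l).mul ?_
    refine ContinuousAt.comp (f := fun r : ℝ => 1 - r ^ 2) (g := powSum t) ?_ (by fun_prop)
    exact continuousAt_powSum ht (by simp)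
  have h2 := h1.tendsto.mono_left (nhdsWithin_le_nhds (s := Set.Iio 1))
  simp only [one_pow, sub_self, powSum_zero, one_mul] at h2
  refine h2.congr' ?_
  filter_upwards [Ioo_mem_nhdsLT (show (0 : ℝ) < 1 by norm_num)] with r hr
  have := (Real.rpow_pos_of_pos (rho_pos hr.1.le hr.2) σ).ne'
  simp only [profile]
  field_simp

/-- The solution of the radial equation of degree `l` that is regular at the origin. -/
def regularSol (n l : ℕ) (γ : ℝ) : ℝ → ℝ :=
  profile l (n / 2 + γ) (powSum (hypCoeff (l + (n / 2 + γ)) (n / 2 + γ - (n - 1) / 2) (l + (n + 1) / 2)))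

/-- The derivative of `regularSol`. -/
def regularSolDeriv (n l : ℕ) (γ : ℝ) : ℝ → ℝ :=
  profileDeriv l (n / 2 + γ)
    (powSum (hypCoeff (l + (n / 2 + γ)) (n / 2 + γ - (n - 1) / 2) (l + (n + 1) / 2)))
    (powSum (derivCoeff (hypCoeff (l + (n / 2 + γ)) (n / 2 + γ - (n - 1) / 2) (l + (n + 1) / 2))))

section
variable {n l : ℕ} {γ : ℝ}

theorem unitSummable_hypCoeff {a b c : ℝ} (hc : ∀ k : ℕ, c + k ≠ 0) :
    UnitSummable (hypCoeff a b c) := (hypRec_hypCoeff hc).unitSummable hc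

theorem unitSummable_regular : UnitSummable
    (hypCoeff (l + ((n : ℝ) / 2 + γ)) (n / 2 + γ - (n - 1) / 2) (l + (n + 1) / 2)) :=
  unitSummable_hypCoeff fun k => by positivity

theorem isRadialSol_regularSol :
    IsRadialSol n l ((n / 2 + γ) * (n - (n / 2 + γ))) (regularSol n l γ) (regularSolDeriv n l γ) :=
  isRadialSol_at_zero rfl unitSummable_regular (hypRec_hypCoeff fun k => by positivity)

theorem regularAtZero_regularSol (hn : 1 ≤ n) :
    RegularAtZero n (regularSol n l γ) (regularSolDeriv n l γ) := by
  have h : ∀ t, UnitSummable t →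
      Tendsto (fun r : ℝ => powSum t (r ^ 2)) (𝓝[>] 0) (𝓝 (powSum t (0 ^ 2))) := fun t ht =>
    (ContinuousAt.comp (f := fun r : ℝ => r ^ 2) (continuousAt_powSum ht (by simp))
      (continuousAt_pow 0 2)).tendsto.mono_left nhdsWithin_le_nhds
  exact regularAtZero_profile hn (h _ unitSummable_regular) (h _ unitSummable_regular.derivCoeff)

/-- The second parameter equals `γ + 1/2`. Choosing the exponent `n/2 + γ` instead of `n/2 - γ`
makes all coefficients positive, which yields both positivity and monotonicity of the series. -/
theorem regular_coeff_pos (hγ : 0 < γ) (k : ℕ) :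
    0 < hypCoeff (l + ((n : ℝ) / 2 + γ)) (n / 2 + γ - (n - 1) / 2) (l + (n + 1) / 2) k :=
  hypCoeff_pos (by positivity) (by linarith) (by positivity) k

theorem regularSol_pos (hγ : 0 < γ) {r : ℝ} (h0 : 0 < r) (h1 : r < 1) : 0 < regularSol n l γ r := by
  have := rho_pos h0.le h1
  have := powSum_pos (x := r ^ 2) (unitSummable_regular (n := n) (l := l) (γ := γ)) (regular_coeff_pos hγ)
    (by positivity) (by nlinarith)
  unfold regularSol profile
  positivity

/-- Geometric decay in `l` of the regular solution away from the boundary. -/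
theorem regularSol_le (hγ : 0 < γ) {r r' : ℝ} (h0 : 0 < r) (h : r ≤ r') (h1 : r' < 1) :
    regularSol n l γ r ≤ (r / r') ^ l * (rho r / rho r') ^ (n / 2 + γ) * regularSol n l γ r' := by
  have h0' := h0.trans_le h
  have hρ := rho_pos h0.le (h.trans_lt h1)
  have hρ' := rho_pos h0'.le h1
  have hm := powSum_mono (x := r ^ 2) (y := r' ^ 2) (unitSummable_regular (n := n) (l := l) (γ := γ))
    (regular_coeff_pos hγ) (by positivity) (by gcongr) (by nlinarith)
  have e : (r / r') ^ l * (rho r / rho r') ^ ((n : ℝ) / 2 + γ) * regularSol n l γ r'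
      = r ^ l * rho r ^ ((n : ℝ) / 2 + γ) * powSum (hypCoeff (l + ((n : ℝ) / 2 + γ))
        (n / 2 + γ - (n - 1) / 2) (l + (n + 1) / 2)) (r' ^ 2) := by
    have := (Real.rpow_pos_of_pos hρ' ((n : ℝ) / 2 + γ)).ne'
    unfold regularSol profile
    rw [div_pow, Real.div_rpow hρ.le hρ'.le]
    field_simp
  rw [e]
  unfold regularSol profile
  gcongr

end

/-! ### The regular solution normalized at the boundary -/

/-- `Φ` is the regular solution of the radial equation of degree `l`, normalized at the boundary. -/
structure IsNormalizedSol (n l : ℕ) (γ : ℝ) (Φ : ℝ → ℝ) : Prop where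
  exists_eq : ∃ C, ∀ r ∈ Set.Ioo (0 : ℝ) 1, Φ r = C * regularSol n l γ r
  tendsto : Tendsto (fun r => Φ r / rho r ^ ((n : ℝ) / 2 - γ)) (𝓝[<] 1) (𝓝 1)

theorem tendsto_rho_rpow_zero {τ : ℝ} (hτ : 0 < τ) :
    Tendsto (fun r => rho r ^ τ) (𝓝[<] 1) (𝓝 0) := by
  have h : Tendsto rho (𝓝[<] 1) (𝓝 0) := by
    have := (continuous_rho.tendsto 1).mono_left (nhdsWithin_le_nhds (s := Set.Iio 1))
    simpa [rho] using this
  have := h.rpow_const (p := τ) (Or.inr hτ.le)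
  rwa [Real.zero_rpow hτ.ne'] at this

/-- Legendre's duplication formula at `γ` and at `-γ`. The left side is the part of the connection
coefficient that does not depend on `l`. -/
theorem gamma_ratio {γ : ℝ} (hγ : 0 < γ) (hnot : ∀ k : ℕ, γ ≠ (k : ℝ) / 2) :
    -(2 : ℝ) ^ (2 * γ) * (Real.Gamma (1 - 2 * γ) * Real.Gamma (1 / 2 + γ) /
      (Real.Gamma (1 + 2 * γ) * Real.Gamma (1 / 2 - γ))) = scatConst γ := by
  have d1 := Real.Gamma_mul_Gamma_add_half γ
  have d2 := Real.Gamma_mul_Gamma_add_half (-γ)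
  have g1 : Real.Gamma (1 - 2 * γ) = -(2 * γ) * Real.Gamma (2 * -γ) := by
    rw [show 2 * -γ = -(2 * γ) by ring, ← Real.Gamma_add_one (by linarith : -(2 * γ) ≠ 0)]
    ring_nf
  have g2 : Real.Gamma (1 + 2 * γ) = 2 * γ * Real.Gamma (2 * γ) := by
    rw [add_comm, Real.Gamma_add_one (by linarith)]
  have h1 : Real.Gamma γ ≠ 0 := (Real.Gamma_pos_of_pos hγ).ne'
  have h2 : Real.Gamma (2 * γ) ≠ 0 := (Real.Gamma_pos_of_pos (by linarith)).ne'
  have h3 : Real.Gamma (1 / 2 - γ) ≠ 0 := Real.Gamma_ne_zero fun m hm =>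
    hnot (2 * m + 1) (by push_cast; linarith)
  have h4 : Real.Gamma (1 / 2 + γ) ≠ 0 := (Real.Gamma_pos_of_pos (by linarith)).ne'
  have hpi : (√Real.pi) ≠ 0 := (Real.sqrt_pos.2 Real.pi_pos).ne'
  have p1 : (2 : ℝ) ^ (1 - 2 * γ) = 2 / 2 ^ (2 * γ) := by
    rw [Real.rpow_sub two_pos, Real.rpow_one]
  have p2 : (2 : ℝ) ^ (1 - 2 * -γ) = 2 * 2 ^ (2 * γ) := by
    rw [show 1 - 2 * -γ = 1 + 2 * γ by ring, Real.rpow_add two_pos, Real.rpow_one]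
  have hp : (0 : ℝ) < 2 ^ (2 * γ) := Real.rpow_pos_of_pos two_pos _
  rw [p1, show γ + 1 / 2 = 1 / 2 + γ by ring] at d1
  rw [p2, show -γ + 1 / 2 = 1 / 2 - γ by ring] at d2
  rw [scatConst, g1, g2]
  generalize Real.Gamma (2 * -γ) = X at *
  generalize (2 : ℝ) ^ (2 * γ) = P at *
  generalize Real.Gamma (1 / 2 + γ) = G₁ at *
  generalize Real.Gamma (1 / 2 - γ) = G₂ at *
  field_simp at d1 ⊢
  have key : (√Real.pi * 2) * (P ^ 2 * X * G₁ * Real.Gamma γ -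
      Real.Gamma (-γ) * (Real.Gamma (2 * γ) * G₂)) = 0 := by
    linear_combination (√Real.pi * 2 * P * X) * d1 - (Real.Gamma (2 * γ) * √Real.pi * 2) * d2
  have := (mul_eq_zero.1 key).resolve_left (by positivity)
  linear_combination this

/-- The `l`-th factor of the expansion for generic `γ`. -/
def genericFactor (n : ℕ) (γ : ℝ) (l : ℕ) (r : ℝ) : ℝ :=
  rho r ^ ((n : ℝ) / 2 - γ) * lowerFactor n γ l r
    + rho r ^ ((n : ℝ) / 2 + γ) * scatConst γ * upperFactor n γ l r

/-- Write the regular solution as `α ψ + β χ`, with `ψ`, `χ` of boundary exponents `n/2 - γ`, `n/2 +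
γ`. Divide by `χ` and let `r → 0`: the regular series stays bounded, the series of `χ` diverges, and
the quotient of the series of `ψ` and `χ` tends to a Gamma quotient `L`. This determines `β / α`;
the normalization at the boundary then selects the multiple `1 / α`. -/
theorem isNormalizedSol_generic {n : ℕ} (l : ℕ) {γ : ℝ} (hn : 1 ≤ n) (hγ : 0 < γ)
    (hγn : γ < (n : ℝ) / 2) (hnot : ∀ k : ℕ, γ ≠ (k : ℝ) / 2) :
    IsNormalizedSol n l γ fun r => r ^ l * genericFactor n γ l r := by
  set a : ℝ := l + n / 2 - γ with ha
  set b : ℝ := 1 / 2 - γ with hb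
  set c : ℝ := 1 - 2 * γ with hc
  set a' : ℝ := l + n / 2 + γ with ha'
  set b' : ℝ := 1 / 2 + γ with hb'
  set c' : ℝ := 1 + 2 * γ with hc'
  have hl : (0 : ℝ) ≤ l := Nat.cast_nonneg l
  -- The bound `γ < n/2` keeps `a` off the poles of Gamma for every `l`, including `l = 0`.
  have hapos : 0 < a := by rw [ha]; linarith
  have ha'pos : 0 < a' := by rw [ha']; linarith
  have hb'pos : 0 < b' := by rw [hb']; linarith
  have hc'pos : 0 < c' := by rw [hc']; linarith
  have hck : ∀ k : ℕ, c + k ≠ 0 := fun k h => hnot (k + 1) (by push_cast; linarith)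
  have hbk : ∀ k : ℕ, b + k ≠ 0 := fun k h => hnot (2 * k + 1) (by push_cast; linarith)
  have hc'k : ∀ k : ℕ, c' + k ≠ 0 := fun k => by positivity
  set t₁ := hypCoeff a b c
  set t₂ := hypCoeff b' a' c'
  have hs₁ : UnitSummable t₁ := unitSummable_hypCoeff hck
  have hs₂ : UnitSummable t₂ := unitSummable_hypCoeff hc'k
  have hn1 : (1 : ℝ) ≤ n := by exact_mod_cast hn
  -- Here `a' + b' - c' = l + (n-1)/2 ≥ 0`; the borderline `n = 1`, `l = 0` is still divergent.
  have hdiv : ¬ Summable t₂ := not_summable_hypCoeff hb'pos ha'pos hc'pos (by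
    rw [ha', hb', hc']; linarith)
  have hpos₂ : ∀ k, 0 < t₂ k := hypCoeff_pos hb'pos ha'pos hc'pos
  set ψ := profile l ((n : ℝ) / 2 - γ) fun z => powSum t₁ (1 - z) with hψ
  set χ := profile l ((n : ℝ) / 2 + γ) fun z => powSum t₂ (1 - z) with hχ
  have sψ : IsRadialSol n l ((n / 2 + γ) * (n - (n / 2 + γ))) ψ _ :=
    isRadialSol_at_one (by ring) hs₁ (by
      have := hypRec_hypCoeff (a := a) (b := b) hck
      convert! this using 1 <;> simp only [ha, hb, hc] <;> ring)
  have sχ : IsRadialSol n l ((n / 2 + γ) * (n - (n / 2 + γ))) χ _ :=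
    isRadialSol_at_one (by ring) hs₂ (by
      have : HypRec a' b' c' t₂ := fun k => by
        rw [hypRec_hypCoeff (a := b') (b := a') hc'k k]; ring
      convert! this using 1 <;> simp only [ha', hb', hc'] <;> ring)
  have hone : ∀ r : ℝ, 0 < r → r < 1 → 0 < 1 - r ^ 2 ∧ 1 - r ^ 2 < 1 := fun r h0 h1 =>
    ⟨by nlinarith, by nlinarith⟩
  have hχpos : ∀ r, 0 < r → r < 1 → 0 < χ r := by
    intro r h0 h1
    have := rho_pos h0.le h1
    have := powSum_pos hs₂ hpos₂ (hone r h0 h1).1.le (hone r h0 h1).2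
    simp only [hχ, profile]
    positivity
  have lψ : Tendsto (fun r => ψ r / rho r ^ ((n : ℝ) / 2 - γ)) (𝓝[<] 1) (𝓝 1) := by
    simpa [t₁, hypCoeff_zero] using tendsto_profile_at_one (l := l) (σ := (n : ℝ) / 2 - γ) hs₁
  have lχ : Tendsto (fun r => χ r / rho r ^ ((n : ℝ) / 2 + γ)) (𝓝[<] 1) (𝓝 1) := by
    simpa [t₂, hypCoeff_zero] using tendsto_profile_at_one (l := l) (σ := (n : ℝ) / 2 + γ) hs₂
  have hI1 : Set.Ioo (0 : ℝ) 1 ∈ 𝓝[<] (1 : ℝ) := Ioo_mem_nhdsLT (by norm_num)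
  have hI0 : Set.Ioo (0 : ℝ) 1 ∈ 𝓝[>] (0 : ℝ) := Ioo_mem_nhdsGT (by norm_num)
  have hρ2 := tendsto_rho_rpow_zero (τ := 2 * γ) (by linarith)
  have hsplit : ∀ r ∈ Set.Ioo (0 : ℝ) 1,
      rho r ^ ((n : ℝ) / 2 + γ) = rho r ^ ((n : ℝ) / 2 - γ) * rho r ^ (2 * γ) := fun r hr => by
    rw [← Real.rpow_add (rho_pos hr.1.le hr.2)]; congr 1; ring
  have hlim : Tendsto (fun r => ψ r / χ r) (𝓝[<] 1) atTop := by
    have h1 : Tendsto (fun r => rho r ^ (2 * γ)) (𝓝[<] 1) (𝓝[>] 0) :=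
      tendsto_nhdsWithin_iff.2 ⟨hρ2, by
        filter_upwards [hI1] with r hr using Real.rpow_pos_of_pos (rho_pos hr.1.le hr.2) _⟩
    have h2 := (lψ.div lχ one_ne_zero).pos_mul_atTop (by norm_num) h1.inv_tendsto_nhdsGT_zero
    refine h2.congr' ?_
    filter_upwards [hI1] with r hr
    have hρ := rho_pos hr.1.le hr.2
    have := (hχpos r hr.1 hr.2).ne'
    have := (Real.rpow_pos_of_pos hρ ((n : ℝ) / 2 - γ)).ne'
    have := (Real.rpow_pos_of_pos hρ (2 * γ)).ne'
    simp only [Pi.div_apply, Pi.inv_apply, hsplit r hr]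
    field_simp
  obtain ⟨α, β, hαβ⟩ := (isRadialSol_regularSol (n := n) (l := l) (γ := γ)).exists_combination hn
    sψ sχ hχpos hlim
  set L := Real.Gamma c * Real.Gamma b' * Real.Gamma a' / (Real.Gamma c' * Real.Gamma a * Real.Gamma b)
    with hL
  have hcoef : Tendsto (fun x => powSum t₁ x / powSum t₂ x) (𝓝[<] 1) (𝓝 L) :=
    tendsto_powSum_div hs₁ hs₂ hpos₂ hdiv (tendsto_hypCoeff_div (fun k => by positivity) hbk hck
      (fun k => by positivity) (fun k => by positivity) hc'k (by
        rw [ha, hb, hc, ha', hb', hc']; ring))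
  -- The factor `2^{2γ}` is `ρ(0)^{-2γ}`, because `ρ(0) = 1/2`.
  have hrel : α * (2 ^ (2 * γ) * L) + β = 0 := by
    have h1 : Tendsto (fun r => (rho r ^ (2 * γ))⁻¹) (𝓝[>] 0) (𝓝 (2 ^ (2 * γ))) := by
      have : ContinuousAt (fun r => (rho r ^ (2 * γ))⁻¹) 0 :=
        ((continuous_rho.continuousAt).rpow_const (Or.inr (by linarith))).inv₀
          (Real.rpow_pos_of_pos (by simp [rho]) _).ne'
      have h := this.tendsto.mono_left (nhdsWithin_le_nhds (s := Set.Ioi 0))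
      have e : (rho 0 ^ (2 * γ))⁻¹ = 2 ^ (2 * γ) := by
        rw [← Real.inv_rpow (by simp [rho])]; norm_num [rho]
      rwa [e] at h
    have h2 := hcoef.comp tendsto_one_sub_sq
    have h3 := ((h1.mul h2).const_mul α).add_const β
    have h4 : Tendsto (fun r : ℝ => powSum (hypCoeff (l + ((n : ℝ) / 2 + γ)) (n / 2 + γ - (n - 1) / 2)
        (l + (n + 1) / 2)) (r ^ 2) / powSum t₂ (1 - r ^ 2)) (𝓝[>] 0) (𝓝 0) := by
      refine Tendsto.div_atTop (a := powSum (hypCoeff (l + ((n : ℝ) / 2 + γ)) (n / 2 + γ - (n - 1) / 2)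
        (l + (n + 1) / 2)) (0 ^ 2)) ?_ ((tendsto_powSum_atTop hs₂ hpos₂ hdiv).comp tendsto_one_sub_sq)
      exact (ContinuousAt.comp (f := fun r : ℝ => r ^ 2)
        (continuousAt_powSum unitSummable_regular (by simp))
        (continuousAt_pow 0 2)).tendsto.mono_left nhdsWithin_le_nhds
    refine tendsto_nhds_unique (h3.congr' ?_) h4
    filter_upwards [hI0] with r hr
    have h := hαβ r hr
    have hρ := rho_pos hr.1.le hr.2
    have := (Real.rpow_pos_of_pos hρ ((n : ℝ) / 2 - γ)).ne'
    have := (Real.rpow_pos_of_pos hρ (2 * γ)).ne'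
    have := (powSum_pos hs₂ hpos₂ (hone r hr.1 hr.2).1.le (hone r hr.1 hr.2).2).ne'
    have := pow_ne_zero l hr.1.ne'
    simp only [regularSol, hψ, hχ, profile, hsplit r hr] at h
    simp only [Function.comp_apply]
    field_simp at h ⊢
    linarith
  -- If `α = 0` then `β = 0` as well, and the regular solution, which is positive, would vanish.
  have hα : α ≠ 0 := by
    rintro rfl
    have hβ : β = 0 := by simpa using hrel
    have h := hαβ (1 / 2) (by norm_num)
    rw [hβ] at h
    have := regularSol_pos (n := n) (l := l) hγ (r := 1 / 2) (by norm_num) (by norm_num)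
    linarith
  have hK : -(2 ^ (2 * γ) * L) = scatConst γ * (Real.Gamma a' / Real.Gamma a) := by
    rw [← gamma_ratio hγ hnot, hL]
    ring
  have hΦ : ∀ r : ℝ, r ^ l * genericFactor n γ l r
      = ψ r + scatConst γ * (Real.Gamma a' / Real.Gamma a) * χ r := by
    intro r
    simp only [genericFactor, lowerFactor, upperFactor, ordinaryHypergeometric_eq_powSum,
      two_mul_rho, hψ, hχ, profile]
    ring
  refine ⟨⟨1 / α, fun r hr => ?_⟩, ?_⟩
  · simp only [hΦ]
    rw [← hK, hαβ r hr]
    field_simp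
    linear_combination (-χ r) * hrel
  · have h := lψ.add ((hρ2.mul lχ).const_mul (scatConst γ * (Real.Gamma a' / Real.Gamma a)))
    simp only [mul_one, mul_zero, add_zero] at h
    refine h.congr' ?_
    filter_upwards [hI1] with r hr
    have hρ := rho_pos hr.1.le hr.2
    have := (Real.rpow_pos_of_pos hρ ((n : ℝ) / 2 - γ)).ne'
    have := (Real.rpow_pos_of_pos hρ (2 * γ)).ne'
    simp only [hΦ, hsplit r hr]
    field_simp

/-! ### Half-integral `γ` -/

theorem powSum_eq_sum {t : ℕ → ℝ} {N : ℕ} (h : ∀ k, N ≤ k → t k = 0) :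
    powSum t = fun x => ∑ k ∈ Finset.range N, t k * x ^ k := by
  ext x
  exact tsum_eq_sum fun k hk => by rw [h k (by simpa using hk), zero_mul]

theorem continuous_powSum_of_finite {t : ℕ → ℝ} {N : ℕ} (h : ∀ k, N ≤ k → t k = 0) :
    Continuous (powSum t) := by
  rw [powSum_eq_sum h]; fun_prop

theorem unitSummable_of_finite {t : ℕ → ℝ} {N : ℕ} (h : ∀ k, N ≤ k → t k = 0) : UnitSummable t :=
  fun x _ => summable_of_ne_finset_zero (s := Finset.range N) fun k hk => by
    rw [h k (by simpa using hk)]; simp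

/-- The coefficients of the terminating series for `γ = m + 1/2`. -/
def halfIntCoeff (n m l k : ℕ) : ℝ :=
  if k ≤ m then rising ((l : ℝ) + ((n : ℝ) - 1) / 2 - m) k * rising (-(m : ℝ)) k
    / rising (-2 * (m : ℝ)) k / (k.factorial : ℝ) else 0

theorem halfIntFactor_eq_powSum (n m l : ℕ) (r : ℝ) :
    halfIntFactor n m l r = powSum (halfIntCoeff n m l) (1 - r ^ 2) := by
  rw [powSum_eq_sum (t := halfIntCoeff n m l) (N := m + 1) fun k hk => if_neg (by omega), ← two_mul_rho]
  refine Finset.sum_congr rfl fun k hk => ?_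
  rw [halfIntCoeff, if_pos (by simpa [Nat.lt_succ_iff] using hk)]
  ring

theorem rising_succ (a : ℝ) (k : ℕ) : rising a (k + 1) = rising a k * (a + k) :=
  ascPochhammer_succ_eval k a

/-- The recurrence survives the cut-off at `k = m` because its factor `-m + k` vanishes there. Below
it, `-2m + k < 0`, so no division by zero occurs. -/
theorem hypRec_halfIntCoeff (n m l : ℕ) :
    HypRec ((l : ℝ) + ((n : ℝ) - 1) / 2 - m) (-m) (-2 * m) (halfIntCoeff n m l) := by
  intro k
  rcases lt_trichotomy k m with hk | hk | hk
  · have hk' : (k : ℝ) < m := by exact_mod_cast hk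
    have h1 : -2 * (m : ℝ) + k ≠ 0 := by have := Nat.cast_nonneg (α := ℝ) m; linarith
    rw [halfIntCoeff, halfIntCoeff, if_pos (by omega), if_pos hk.le]
    simp only [rising_succ, Nat.factorial_succ]
    push_cast
    generalize (l : ℝ) + ((n : ℝ) - 1) / 2 - m = a
    generalize -2 * (m : ℝ) = c at *
    have : (k.factorial : ℝ) ≠ 0 := by positivity
    field_simp
  · subst hk
    rw [halfIntCoeff, if_neg (by omega)]
    ring
  · rw [halfIntCoeff, halfIntCoeff, if_neg (by omega), if_neg (by omega)]
    ring

/-- With `1/2 - γ = -m` the series in `1 - r²` is a polynomial, hence regular at the origin, and so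
a multiple of `regularSol` with no admixture of the exponent `n/2 + γ`. -/
theorem isNormalizedSol_halfInt {n m : ℕ} (l : ℕ) {γ : ℝ} (hn : 1 ≤ n) (hγ : γ = (m : ℝ) + 1 / 2) :
    IsNormalizedSol n l γ fun r => r ^ l * (rho r ^ ((n : ℝ) / 2 - γ) * halfIntFactor n m l r) := by
  have hfin : ∀ k, m + 1 ≤ k → halfIntCoeff n m l k = 0 := fun k hk => if_neg (by omega)
  have hfin' : ∀ k, m + 1 ≤ k → derivCoeff (halfIntCoeff n m l) k = 0 := fun k hk => by
    rw [derivCoeff, hfin _ (by omega), mul_zero]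
  have hs := unitSummable_of_finite hfin
  have hsol : IsRadialSol n l ((n / 2 + γ) * (n - (n / 2 + γ)))
      (profile l ((n : ℝ) / 2 - γ) fun z => powSum (halfIntCoeff n m l) (1 - z)) _ :=
    isRadialSol_at_one (by ring) hs (by
      convert! hypRec_halfIntCoeff n m l using 1 <;> rw [hγ] <;> ring)
  have hcont : ∀ t, Continuous (powSum t) →
      Tendsto (fun r : ℝ => powSum t (1 - r ^ 2)) (𝓝[>] 0) (𝓝 (powSum t (1 - 0 ^ 2))) := fun t ht =>
    ((ht.comp (by fun_prop : Continuous fun r : ℝ => 1 - r ^ 2)).tendsto 0).mono_left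
      nhdsWithin_le_nhds
  have hreg := regularAtZero_profile (l := l) (σ := (n : ℝ) / 2 - γ) hn
    (w := fun z => powSum (halfIntCoeff n m l) (1 - z))
    (w' := fun z => -powSum (derivCoeff (halfIntCoeff n m l)) (1 - z))
    (hcont _ (continuous_powSum_of_finite hfin)) (hcont _ (continuous_powSum_of_finite hfin')).neg
  have hγ0 : 0 < γ := by rw [hγ]; positivity
  have hΦ : (fun r => r ^ l * (rho r ^ ((n : ℝ) / 2 - γ) * halfIntFactor n m l r))
      = profile l ((n : ℝ) / 2 - γ) fun z => powSum (halfIntCoeff n m l) (1 - z) := by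
    ext r
    rw [halfIntFactor_eq_powSum, profile]
    ring
  rw [hΦ]
  refine ⟨hsol.eq_const_mul_of_regular hn isRadialSol_regularSol hreg (regularAtZero_regularSol hn)
    fun r h0 h1 => regularSol_pos hγ0 h0 h1, ?_⟩
  have := tendsto_profile_at_one (l := l) (σ := (n : ℝ) / 2 - γ) hs
  simpa [halfIntCoeff, rising] using this

/-! ### Differentiation of integrals over a compact space -/

section Param
variable {X : Type*} [TopologicalSpace X] [CompactSpace X] [MeasurableSpace X] [BorelSpace X]
  {μ : Measure X} [IsFiniteMeasure μ]

theorem _root_.Continuous.integrable_of_compactSpace {g : X → ℝ} (hg : Continuous g) :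
    Integrable g μ := by
  obtain ⟨M, hM⟩ := isCompact_univ.exists_bound_of_continuousOn hg.continuousOn
  exact Integrable.of_bound hg.aestronglyMeasurable M (Eventually.of_forall fun x => hM x trivial)

/-- Compactness of a closed ball times `X` bounds the derivative uniformly, so a constant serves as
dominating function. -/
theorem hasDerivAt_integral_of_compactSpace {F F' : ℝ → X → ℝ} {I : Set ℝ} (hI : IsOpen I)
    (hF : ∀ θ ∈ I, Continuous (F θ))
    (hF' : ContinuousOn (fun p : ℝ × X => F' p.1 p.2) (I ×ˢ Set.univ))
    (hd : ∀ θ ∈ I, ∀ ξ, HasDerivAt (F · ξ) (F' θ ξ) θ) {θ : ℝ} (hθ : θ ∈ I) :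
    HasDerivAt (fun θ => ∫ ξ, F θ ξ ∂μ) (∫ ξ, F' θ ξ ∂μ) θ := by
  obtain ⟨ε, hε, hsub⟩ := Metric.nhds_basis_closedBall.mem_iff.1 (hI.mem_nhds hθ)
  obtain ⟨M, hM⟩ := ((isCompact_closedBall θ ε).prod isCompact_univ).exists_bound_of_continuousOn
    (hF'.mono (Set.prod_mono hsub (Set.subset_univ _)))
  have hcont : Continuous (F' θ) := hF'.comp_continuous (f := fun ξ => (θ, ξ)) (by fun_prop)
    fun ξ => ⟨hθ, trivial⟩
  refine (hasDerivAt_integral_of_dominated_loc_of_deriv_le (bound := fun _ => M)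
    (Metric.closedBall_mem_nhds θ hε) ?_ (hF θ hθ).integrable_of_compactSpace
    hcont.aestronglyMeasurable ?_ (integrable_const M) ?_).2
  · filter_upwards [hI.mem_nhds hθ] with τ hτ using (hF τ hτ).aestronglyMeasurable
  · exact Eventually.of_forall fun ξ τ hτ => hM (τ, ξ) ⟨hτ, trivial⟩
  · exact Eventually.of_forall fun ξ τ hτ => hd τ (hsub hτ) ξ

/-- First and second derivative of `∫ f (c θ ξ) Z ξ dμ` for a family of curves `c`. -/
theorem hasDerivAt_integral_comp_curve {E : Type*} [NormedAddCommGroup E] [NormedSpace ℝ E]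
    {f : E → ℝ} {Ω : Set E} (hΩ : IsOpen Ω) (hf : ContDiffOn ℝ 2 f Ω) {I : Set ℝ} (hI : IsOpen I)
    {c c' c'' : ℝ → X → E} (hc : Continuous fun p : ℝ × X => c p.1 p.2)
    (hc' : Continuous fun p : ℝ × X => c' p.1 p.2) (hc'' : Continuous fun p : ℝ × X => c'' p.1 p.2)
    (hd : ∀ θ ξ, HasDerivAt (c · ξ) (c' θ ξ) θ) (hd' : ∀ θ ξ, HasDerivAt (c' · ξ) (c'' θ ξ) θ)
    (hmem : ∀ θ ∈ I, ∀ ξ, c θ ξ ∈ Ω) {Z : X → ℝ} (hZ : Continuous Z) {θ : ℝ} (hθ : θ ∈ I) :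
    HasDerivAt (fun θ => ∫ ξ, f (c θ ξ) * Z ξ ∂μ) (∫ ξ, fderiv ℝ f (c θ ξ) (c' θ ξ) * Z ξ ∂μ) θ ∧
    HasDerivAt (fun θ => ∫ ξ, fderiv ℝ f (c θ ξ) (c' θ ξ) * Z ξ ∂μ)
      (∫ ξ, (fderiv ℝ (fderiv ℝ f) (c θ ξ) (c' θ ξ) (c' θ ξ) + fderiv ℝ f (c θ ξ) (c'' θ ξ)) * Z ξ ∂μ)
      θ := by
  have hf1 : ContDiffOn ℝ 1 (fderiv ℝ f) Ω := hf.fderiv_of_isOpen hΩ (by norm_num)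
  have hf0 : ContinuousOn f Ω := hf.continuousOn
  have hf1c : ContinuousOn (fderiv ℝ f) Ω := hf1.continuousOn
  have hf2c : ContinuousOn (fderiv ℝ (fderiv ℝ f)) Ω := hf1.continuousOn_fderiv_of_isOpen hΩ le_rfl
  have hmaps : Set.MapsTo (fun p : ℝ × X => c p.1 p.2) (I ×ˢ Set.univ) Ω := fun p hp => hmem _ hp.1 _
  have k0 : ContinuousOn (fun p : ℝ × X => f (c p.1 p.2)) (I ×ˢ Set.univ) :=
    hf0.comp hc.continuousOn hmaps
  have k1 : ContinuousOn (fun p : ℝ × X => fderiv ℝ f (c p.1 p.2)) (I ×ˢ Set.univ) :=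
    hf1c.comp hc.continuousOn hmaps
  have k2 : ContinuousOn (fun p : ℝ × X => fderiv ℝ (fderiv ℝ f) (c p.1 p.2)) (I ×ˢ Set.univ) :=
    hf2c.comp hc.continuousOn hmaps
  have hZ' : ContinuousOn (fun p : ℝ × X => Z p.2) (I ×ˢ Set.univ) :=
    (hZ.comp continuous_snd).continuousOn
  have hf' : ∀ x ∈ Ω, HasFDerivAt f (fderiv ℝ f x) x := fun x hx =>
    ((hf.differentiableOn (by norm_num)).differentiableAt (hΩ.mem_nhds hx)).hasFDerivAt
  have hf'' : ∀ x ∈ Ω, HasFDerivAt (fderiv ℝ f) (fderiv ℝ (fderiv ℝ f) x) x := fun x hx =>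
    ((hf1.differentiableOn (by norm_num)).differentiableAt (hΩ.mem_nhds hx)).hasFDerivAt
  have slice : ∀ {g : ℝ × X → ℝ}, ContinuousOn g (I ×ˢ Set.univ) → ∀ τ ∈ I,
      Continuous fun ξ => g (τ, ξ) := fun hg τ hτ =>
    hg.comp_continuous (f := fun ξ => (τ, ξ)) (by fun_prop) fun ξ => ⟨hτ, trivial⟩
  have m1 : ContinuousOn (fun p : ℝ × X => fderiv ℝ f (c p.1 p.2) (c' p.1 p.2) * Z p.2)
      (I ×ˢ Set.univ) := (k1.clm_apply hc'.continuousOn).mul hZ'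
  have m2 : ContinuousOn (fun p : ℝ × X => (fderiv ℝ (fderiv ℝ f) (c p.1 p.2) (c' p.1 p.2) (c' p.1 p.2)
      + fderiv ℝ f (c p.1 p.2) (c'' p.1 p.2)) * Z p.2) (I ×ˢ Set.univ) :=
    (((k2.clm_apply hc'.continuousOn).clm_apply hc'.continuousOn).add
      (k1.clm_apply hc''.continuousOn)).mul hZ'
  constructor
  · refine hasDerivAt_integral_of_compactSpace
      (F := fun θ ξ => f (c θ ξ) * Z ξ)
      (F' := fun θ ξ => fderiv ℝ f (c θ ξ) (c' θ ξ) * Z ξ) hI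
      (fun τ hτ => slice (k0.mul hZ') τ hτ) m1 (fun τ hτ ξ => ?_) hθ
    exact ((hf' _ (hmem τ hτ ξ)).comp_hasDerivAt τ (hd τ ξ)).mul_const _
  · refine hasDerivAt_integral_of_compactSpace
      (F := fun θ ξ => fderiv ℝ f (c θ ξ) (c' θ ξ) * Z ξ)
      (F' := fun θ ξ => (fderiv ℝ (fderiv ℝ f) (c θ ξ) (c' θ ξ) (c' θ ξ)
        + fderiv ℝ f (c θ ξ) (c'' θ ξ)) * Z ξ) hI
      (fun τ hτ => slice m1 τ hτ) m2 (fun τ hτ ξ => ?_) hθ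
    have h1 : HasDerivAt (fun τ => fderiv ℝ f (c τ ξ))
        (fderiv ℝ (fderiv ℝ f) (c τ ξ) (c' τ ξ)) τ :=
      (hf'' _ (hmem τ hτ ξ)).comp_hasDerivAt τ (hd τ ξ)
    exact (h1.clm_apply (hd' τ ξ)).mul_const _

end Param

/-! ### Rotations of the sphere -/

/-- The surface measure of `𝕊ⁿ`. -/
abbrev surf (n : ℕ) : Measure (Sph n) := (volume : Measure (Euc (n + 1))).toSphere

section Rotation
variable {n : ℕ}

/-- The action of a linear isometry on the sphere. -/
def sphereMap (T : Euc (n + 1) ≃ₗᵢ[ℝ] Euc (n + 1)) (ξ : Sph n) : Sph n :=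
  ⟨T ξ, by simp⟩

theorem continuous_sphereMap (T : Euc (n + 1) ≃ₗᵢ[ℝ] Euc (n + 1)) : Continuous (sphereMap T) :=
  (T.continuous.comp continuous_subtype_val).subtype_mk _

open scoped Pointwise in
-- The surface measure of `s` is a fixed multiple of the volume of the cone `(0,1) • s`, and `T`
-- preserves volume.
theorem measurePreserving_sphereMap (T : Euc (n + 1) ≃ₗᵢ[ℝ] Euc (n + 1)) :
    MeasurePreserving (sphereMap T) (surf n) (surf n) := by
  refine ⟨(continuous_sphereMap T).measurable, ?_⟩
  ext s hs
  have hm := (continuous_sphereMap T).measurable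
  rw [Measure.map_apply hm hs, Measure.toSphere_apply' _ (hm hs), Measure.toSphere_apply' _ hs]
  congr 1
  rw [← T.measurePreserving.measure_preimage_emb T.toHomeomorph.measurableEmbedding
    (Set.Ioo (0 : ℝ) 1 • (Subtype.val '' s))]
  congr 1
  ext x
  simp only [Set.mem_smul, Set.mem_image, Set.mem_preimage]
  constructor
  · rintro ⟨t, ht, _, ⟨ξ, hξ, rfl⟩, rfl⟩
    exact ⟨t, ht, _, ⟨sphereMap T ξ, hξ, rfl⟩, by simp [sphereMap]⟩
  · rintro ⟨t, ht, _, ⟨ξ, hξ, rfl⟩, h⟩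
    refine ⟨t, ht, _, ⟨sphereMap T.symm ξ, ?_, rfl⟩, ?_⟩
    · simpa [sphereMap] using hξ
    · apply T.injective
      simp [sphereMap, ← h]

theorem integral_comp_sphereMap (T : Euc (n + 1) ≃ₗᵢ[ℝ] Euc (n + 1)) {g : Sph n → ℝ}
    (hg : Continuous g) : ∫ ξ, g (sphereMap T ξ) ∂surf n = ∫ ξ, g ξ ∂surf n := by
  have h := measurePreserving_sphereMap T
  rw [← integral_map h.aemeasurable (by rw [h.map_eq]; exact hg.aestronglyMeasurable), h.map_eq]

/-- The infinitesimal rotation `x ↦ xᵢ eⱼ - xⱼ eᵢ`. -/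
def skew (i j : Fin (n + 1)) : Euc (n + 1) →L[ℝ] Euc (n + 1) :=
  (EuclideanSpace.proj (𝕜 := ℝ) i).smulRight (EuclideanSpace.single j (1 : ℝ))
    - (EuclideanSpace.proj (𝕜 := ℝ) j).smulRight (EuclideanSpace.single i (1 : ℝ))

theorem skew_apply (i j : Fin (n + 1)) (x : Euc (n + 1)) : skew i j x =
    x i • EuclideanSpace.single j (1 : ℝ) - x j • EuclideanSpace.single i (1 : ℝ) := rfl

theorem inner_skew (i j : Fin (n + 1)) (x y : Euc (n + 1)) :
    inner ℝ (skew i j x) y = -inner ℝ x (skew i j y) := by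
  simp only [skew_apply, inner_sub_left, inner_sub_right, inner_smul_left, inner_smul_right,
    EuclideanSpace.inner_single_left, EuclideanSpace.inner_single_right]
  simp
  ring

/-- This identity sums the exponential of `θ S` to `1 + (1 - cos θ) S² + sin θ S`, the closed form
in `rotLin`. It includes `i = j`, where `S = 0`. -/
theorem skew_skew_skew (i j : Fin (n + 1)) (x : Euc (n + 1)) :
    skew i j (skew i j (skew i j x)) = -skew i j x := by
  rcases eq_or_ne i j with rfl | h
  · simp [skew_apply]
  · have h' := h.symm
    simp [skew_apply, h, h']
    abel

/-- The rotation by the angle `θ` generated by `skew i j`. -/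
def rotLin (i j : Fin (n + 1)) (θ : ℝ) : Euc (n + 1) →ₗ[ℝ] Euc (n + 1) :=
  LinearMap.id + (1 - Real.cos θ) • ((skew i j).comp (skew i j) : Euc (n + 1) →ₗ[ℝ] Euc (n + 1))
    + Real.sin θ • (skew i j : Euc (n + 1) →ₗ[ℝ] Euc (n + 1))

theorem rotLin_apply (i j : Fin (n + 1)) (θ : ℝ) (x : Euc (n + 1)) : rotLin i j θ x =
    x + (1 - Real.cos θ) • skew i j (skew i j x) + Real.sin θ • skew i j x := rfl

theorem norm_rotLin (i j : Fin (n + 1)) (θ : ℝ) (x : Euc (n + 1)) : ‖rotLin i j θ x‖ = ‖x‖ := by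
  rw [← sq_eq_sq₀ (norm_nonneg _) (norm_nonneg _), ← real_inner_self_eq_norm_sq,
    ← real_inner_self_eq_norm_sq, rotLin_apply]
  have h1 : inner ℝ x (skew i j x) = 0 := by
    have := inner_skew i j x x
    rw [real_inner_comm] at this; linarith
  have h2 : inner ℝ (skew i j x) (skew i j (skew i j x)) = 0 := by
    have := inner_skew i j (skew i j x) (skew i j x)
    rw [real_inner_comm] at this; linarith
  have h3 : inner ℝ x (skew i j (skew i j x)) = -inner ℝ (skew i j x) (skew i j x) := by
    have := inner_skew i j x (skew i j x)
    linarith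
  have h4 : inner ℝ (skew i j (skew i j x)) (skew i j (skew i j x))
      = inner ℝ (skew i j x) (skew i j x) := by
    rw [inner_skew, skew_skew_skew, inner_neg_right, neg_neg]
  simp only [inner_add_left, inner_add_right, inner_smul_left, inner_smul_right, h1, h3, h4,
    real_inner_comm x, real_inner_comm (skew i j x) (skew i j (skew i j x)), h2]
  simp only [conj_trivial]
  have := Real.sin_sq_add_cos_sq θ
  linear_combination inner ℝ (skew i j x) (skew i j x) * this

/-- `rotLin` as a linear isometry. -/
def rot (i j : Fin (n + 1)) (θ : ℝ) : Euc (n + 1) ≃ₗᵢ[ℝ] Euc (n + 1) :=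
  LinearIsometry.toLinearIsometryEquiv ⟨rotLin i j θ, norm_rotLin i j θ⟩ rfl

theorem rot_apply (i j : Fin (n + 1)) (θ : ℝ) (x : Euc (n + 1)) : rot i j θ x =
    x + (1 - Real.cos θ) • skew i j (skew i j x) + Real.sin θ • skew i j x := rfl

theorem rot_rot_neg (i j : Fin (n + 1)) (θ : ℝ) (x : Euc (n + 1)) :
    rot i j θ (rot i j (-θ) x) = x := by
  simp only [rot_apply, map_add, map_smul, skew_skew_skew, Real.cos_neg, Real.sin_neg, map_neg]
  have h : (1 - Real.cos θ) * (1 - Real.cos θ) + Real.sin θ * Real.sin θ = 2 * (1 - Real.cos θ) := by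
    linear_combination Real.sin_sq_add_cos_sq θ
  have h2 : (Real.sin θ * Real.sin θ) = 2 * (1 - Real.cos θ) - (1 - Real.cos θ) * (1 - Real.cos θ) := by
    linarith
  simp only [smul_add, smul_smul, smul_neg, neg_mul, neg_smul, h2]
  module

end Rotation

/-! ### The spherical Laplacian is symmetric -/

section Casimir
variable {n : ℕ}

/-- The Euclidean Laplacian. -/
def lap {d : ℕ} (f : Euc d → ℝ) (x : Euc d) : ℝ :=
  ∑ i, fderiv ℝ (fderiv ℝ f) x (EuclideanSpace.single i 1) (EuclideanSpace.single i 1)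

theorem hasDerivAt_rot (i j : Fin (n + 1)) (x : Euc (n + 1)) (θ : ℝ) :
    HasDerivAt (fun θ => rot i j θ x)
      (Real.sin θ • skew i j (skew i j x) + Real.cos θ • skew i j x) θ := by
  have h := ((((Real.hasDerivAt_cos θ).const_sub 1).smul_const (skew i j (skew i j x))).const_add x).add
    ((Real.hasDerivAt_sin θ).smul_const (skew i j x))
  convert! h using 1
  simp

theorem hasDerivAt_rot' (i j : Fin (n + 1)) (x : Euc (n + 1)) (θ : ℝ) :
    HasDerivAt (fun θ => Real.sin θ • skew i j (skew i j x) + Real.cos θ • skew i j x)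
      (Real.cos θ • skew i j (skew i j x) - Real.sin θ • skew i j x) θ := by
  have h := ((Real.hasDerivAt_sin θ).smul_const (skew i j (skew i j x))).add
    ((Real.hasDerivAt_cos θ).smul_const (skew i j x))
  convert! h using 1
  simp [sub_eq_add_neg]

/-- Symmetry of the squared infinitesimal rotation. By rotation invariance, rotating the argument of
`f` by `θ` equals rotating that of `Z` by `-θ`; the identity is the second derivative of this at `θ
= 0`. -/
theorem integral_skew_sq {f Z : Euc (n + 1) → ℝ} {R r : ℝ}
    (hf : ContDiffOn ℝ 2 f (Metric.ball 0 R)) (hr : |r| < R) (hZ : ContDiff ℝ 2 Z)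
    (i j : Fin (n + 1)) :
    ∫ ξ : Sph n, (fderiv ℝ (fderiv ℝ f) (r • (ξ : Euc (n + 1))) (r • skew i j ξ) (r • skew i j ξ)
        + fderiv ℝ f (r • (ξ : Euc (n + 1))) (r • skew i j (skew i j ξ))) * Z ξ ∂surf n
      = ∫ ξ : Sph n, (fderiv ℝ (fderiv ℝ Z) ξ (skew i j ξ) (skew i j ξ)
        + fderiv ℝ Z ξ (skew i j (skew i j ξ))) * f (r • (ξ : Euc (n + 1))) ∂surf n := by
  have hmem : ∀ ξ : Sph n, r • (ξ : Euc (n + 1)) ∈ Metric.ball (0 : Euc (n + 1)) R := fun ξ => by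
    simpa [norm_smul] using hr
  have hmem' : ∀ θ : ℝ, ∀ ξ : Sph n, r • rot i j θ (ξ : Euc (n + 1)) ∈
      Metric.ball (0 : Euc (n + 1)) R := fun θ ξ => by
    simpa [norm_smul] using hr
  have hfc : Continuous fun ξ : Sph n => f (r • (ξ : Euc (n + 1))) :=
    hf.continuousOn.comp_continuous (by fun_prop) hmem
  have hZc : Continuous fun ξ : Sph n => Z ξ := hZ.continuous.comp continuous_subtype_val
  have J := fun θ : ℝ => hasDerivAt_integral_comp_curve (μ := surf n) (θ := θ) Metric.isOpen_ball hf
    isOpen_univ (c := fun θ (ξ : Sph n) => r • rot i j θ (ξ : Euc (n + 1)))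
    (c' := fun θ (ξ : Sph n) => r • (Real.sin θ • skew i j (skew i j ξ) + Real.cos θ • skew i j ξ))
    (c'' := fun θ (ξ : Sph n) => r • (Real.cos θ • skew i j (skew i j ξ) - Real.sin θ • skew i j ξ))
    (by simp only [rot_apply]; fun_prop) (by fun_prop) (by fun_prop)
    (fun θ ξ => (hasDerivAt_rot i j _ θ).const_smul r)
    (fun θ ξ => (hasDerivAt_rot' i j _ θ).const_smul r)
    (fun θ _ ξ => hmem' θ ξ) hZc trivial
  have hneg : ∀ θ : ℝ, HasDerivAt (fun θ : ℝ => -θ) (-1) θ := fun θ => hasDerivAt_neg θ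
  have K := fun θ : ℝ => hasDerivAt_integral_comp_curve (μ := surf n) (θ := θ) isOpen_univ
    hZ.contDiffOn isOpen_univ (c := fun θ (ξ : Sph n) => rot i j (-θ) (ξ : Euc (n + 1)))
    (c' := fun θ (ξ : Sph n) => -(Real.sin (-θ) • skew i j (skew i j ξ) + Real.cos (-θ) • skew i j ξ))
    (c'' := fun θ (ξ : Sph n) => Real.cos (-θ) • skew i j (skew i j ξ) - Real.sin (-θ) • skew i j ξ)
    (by simp only [rot_apply]; fun_prop) (by fun_prop) (by fun_prop)
    (fun θ ξ => by
      convert! HasDerivAt.scomp (h := fun θ : ℝ => -θ) θ (hasDerivAt_rot i j ξ (-θ)) (hneg θ) using 1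
      simp [add_comm])
    (fun θ ξ => by
      convert! (HasDerivAt.scomp (h := fun θ : ℝ => -θ) θ (hasDerivAt_rot' i j ξ (-θ)) (hneg θ)).neg
        using 1
      simp [add_comm])
    (fun θ _ ξ => trivial) hfc trivial
  have hJK : (fun θ => ∫ ξ : Sph n, f (r • rot i j θ (ξ : Euc (n + 1))) * Z ξ ∂surf n)
      = fun θ => ∫ ξ : Sph n, Z (rot i j (-θ) (ξ : Euc (n + 1))) * f (r • (ξ : Euc (n + 1))) ∂surf n := by
    ext θ
    have hc : Continuous fun ξ : Sph n => f (r • rot i j θ (ξ : Euc (n + 1))) * Z ξ :=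
      (hf.continuousOn.comp_continuous (f := fun ξ : Sph n => r • rot i j θ (ξ : Euc (n + 1)))
        (((rot i j θ).continuous.comp continuous_subtype_val).const_smul r) (hmem' θ)).mul hZc
    rw [← integral_comp_sphereMap (rot i j (-θ)) hc]
    refine integral_congr_ae (Eventually.of_forall fun ξ => ?_)
    simp only [sphereMap, rot_rot_neg]
    ring
  -- The first derivatives are needed for all `θ`, so that they can be differentiated once more at
  -- `0`.
  have h1 : (fun θ => ∫ ξ : Sph n, fderiv ℝ f (r • rot i j θ (ξ : Euc (n + 1)))
      (r • (Real.sin θ • skew i j (skew i j ξ) + Real.cos θ • skew i j ξ)) * Z ξ ∂surf n)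
      = fun θ => ∫ ξ : Sph n, fderiv ℝ Z (rot i j (-θ) (ξ : Euc (n + 1)))
        (-(Real.sin (-θ) • skew i j (skew i j ξ) + Real.cos (-θ) • skew i j ξ))
          * f (r • (ξ : Euc (n + 1))) ∂surf n := by
    ext θ
    exact (J θ).1.unique (hJK ▸ (K θ).1)
  have h2 := (J 0).2.unique (h1 ▸ (K 0).2)
  simpa [rot_apply] using h2

theorem sum_smul_single {d : ℕ} (x : Euc d) : ∑ i, x i • EuclideanSpace.single i (1 : ℝ) = x := by
  ext k
  simp [Finset.sum_apply, Pi.single_apply]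

theorem sum_skew_skew (x : Euc (n + 1)) : ∑ i, ∑ j, skew i j (skew i j x) = (-(2 * n : ℝ)) • x := by
  have h : ∀ i j : Fin (n + 1), skew i j (skew i j x) = (if i = j then 2 • x i • EuclideanSpace.single i (1 : ℝ) else 0)
      - x i • EuclideanSpace.single i (1 : ℝ) - x j • EuclideanSpace.single j (1 : ℝ) := by
    intro i j
    rcases eq_or_ne i j with rfl | h
    · simp [skew_apply]; module
    · have h' := h.symm
      simp [skew_apply, h, h']
      module
  simp only [h, Finset.sum_sub_distrib, Finset.sum_ite_eq, Finset.mem_univ, if_true, sum_smul_single,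
    Finset.sum_const, Finset.card_univ, Fintype.card_fin, ← Finset.smul_sum]
  module

/-- With `B` a Hessian this is the second-order part of the sum of squared rotations, and
`sum_skew_skew` gives the first-order part. Ordered pairs count each rotation twice, whence the
factors `2`. -/
theorem sum_bilin_skew (B : Euc (n + 1) →L[ℝ] Euc (n + 1) →L[ℝ] ℝ) (x : Euc (n + 1)) :
    ∑ i, ∑ j, B (skew i j x) (skew i j x)
      = 2 * (‖x‖ ^ 2 * ∑ i, B (EuclideanSpace.single i 1) (EuclideanSpace.single i 1)) - 2 * B x x := by
  have hB : B x x = ∑ i, ∑ j, x i * x j * B (EuclideanSpace.single i 1) (EuclideanSpace.single j 1) := by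
    conv_lhs => rw [← sum_smul_single x]
    simp only [map_sum, map_smul, _root_.sum_apply, _root_.smul_apply,
      smul_eq_mul, Finset.mul_sum]
    rw [Finset.sum_comm]
    refine Finset.sum_congr rfl fun i _ => Finset.sum_congr rfl fun j _ => by ring
  have hx : ‖x‖ ^ 2 = ∑ i, x i ^ 2 := EuclideanSpace.real_norm_sq_eq x
  have h : ∀ i j : Fin (n + 1), B (skew i j x) (skew i j x) =
      x i ^ 2 * B (EuclideanSpace.single j 1) (EuclideanSpace.single j 1)
      + x j ^ 2 * B (EuclideanSpace.single i 1) (EuclideanSpace.single i 1)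
      - x i * x j * B (EuclideanSpace.single i 1) (EuclideanSpace.single j 1)
      - x j * x i * B (EuclideanSpace.single j 1) (EuclideanSpace.single i 1) := by
    intro i j
    simp only [skew_apply, map_sub, map_smul, _root_.sub_apply,
      _root_.smul_apply, smul_eq_mul]
    ring
  simp only [h, Finset.sum_sub_distrib, Finset.sum_add_distrib]
  rw [Finset.sum_comm (f := fun i j => x j ^ 2 * _), Finset.sum_comm (f := fun i j => x j * x i * _),
    ← hB]
  simp only [← Finset.mul_sum, ← Finset.sum_mul, ← hx]
  ring

end Casimir

/-! ### Solid harmonics and the radial components of a function -/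

/-- A smooth harmonic function on `ℝ^{n+1}` that is homogeneous of degree `l`. -/
structure IsSolidHarmonic (n l : ℕ) (Z : Euc (n + 1) → ℝ) : Prop where
  contDiff : ContDiff ℝ 2 Z
  homogeneous : ∀ (t : ℝ) (x : Euc (n + 1)), Z (t • x) = t ^ l * Z x
  harmonic : ∀ x, lap Z x = 0

theorem hasDerivAt_smul_const {E : Type*} [NormedAddCommGroup E] [NormedSpace ℝ E] (x : E) (t : ℝ) :
    HasDerivAt (fun t : ℝ => t • x) x t := by
  simpa using (hasDerivAt_id t).smul_const x

section
variable {n l : ℕ} {Z : Euc (n + 1) → ℝ}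

theorem IsSolidHarmonic.fderiv_smul (hZ : IsSolidHarmonic n l Z) (t : ℝ) (x : Euc (n + 1)) :
    fderiv ℝ Z (t • x) x = l * t ^ (l - 1) * Z x := by
  have h1 : HasDerivAt (fun t : ℝ => Z (t • x)) (fderiv ℝ Z (t • x) x) t :=
    ((hZ.contDiff.differentiable (by norm_num)) (t • x)).hasFDerivAt.comp_hasDerivAt t
      (hasDerivAt_smul_const x t)
  have h2 : HasDerivAt (fun t : ℝ => Z (t • x)) (l * t ^ (l - 1) * Z x) t := by
    simp only [hZ.homogeneous]
    exact (hasDerivAt_pow l t).mul_const _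
  exact h1.unique h2

theorem IsSolidHarmonic.fderiv_self (hZ : IsSolidHarmonic n l Z) (x : Euc (n + 1)) :
    fderiv ℝ Z x x = l * Z x := by
  simpa using hZ.fderiv_smul 1 x

theorem IsSolidHarmonic.fderiv_fderiv_self (hZ : IsSolidHarmonic n l Z) (x : Euc (n + 1)) :
    fderiv ℝ (fderiv ℝ Z) x x x = l * (l - 1) * Z x := by
  have hd : Differentiable ℝ (fderiv ℝ Z) :=
    (hZ.contDiff.fderiv_right (m := 1) (by norm_num)).differentiable (by norm_num)
  have h1 : HasDerivAt (fun t : ℝ => fderiv ℝ Z (t • x)) (fderiv ℝ (fderiv ℝ Z) ((1 : ℝ) • x) x) 1 :=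
    (hd ((1 : ℝ) • x)).hasFDerivAt.comp_hasDerivAt (1 : ℝ) (hasDerivAt_smul_const x 1)
  have h2 := h1.clm_apply (hasDerivAt_const (1 : ℝ) x)
  have h3 : HasDerivAt (fun t : ℝ => fderiv ℝ Z (t • x) x) (l * (l - 1) * Z x) 1 := by
    simp only [hZ.fderiv_smul]
    have := (((hasDerivAt_pow (l - 1) (1 : ℝ)).const_mul (l : ℝ)).mul_const (Z x))
    convert! this using 1
    rcases l with _ | l <;> simp
  have := h2.unique h3
  simpa using this

theorem IsSolidHarmonic.continuous_sphere (hZ : IsSolidHarmonic n l Z) :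
    Continuous fun ξ : Sph n => Z ξ := hZ.contDiff.continuous.comp continuous_subtype_val

/-- The component of `f` along `Z` on the sphere of radius `r`. -/
def sphCoef (f Z : Euc (n + 1) → ℝ) (r : ℝ) : ℝ :=
  ∫ ξ : Sph n, f (r • (ξ : Euc (n + 1))) * Z ξ ∂surf n

/-- The derivative of `sphCoef`. -/
def sphCoefDeriv (f Z : Euc (n + 1) → ℝ) (r : ℝ) : ℝ :=
  ∫ ξ : Sph n, fderiv ℝ f (r • (ξ : Euc (n + 1))) ξ * Z ξ ∂surf n

/-- Sum `integral_skew_sq` over all `i`, `j`. On `f` the sum is `2r²` times the Laplacian minus its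
radial part; on `Z`, by harmonicity and Euler's relations, it is multiplication by `-2l(l+n-1)`.
Nothing is divided by `r`, so `r = 0` is covered, which later gives regularity at the origin. -/
theorem sphCoef_radial (hZ : IsSolidHarmonic n l Z) {f : Euc (n + 1) → ℝ} {R r : ℝ}
    (hf : ContDiffOn ℝ 2 f (Metric.ball 0 R)) (hr : |r| < R) :
    HasDerivAt (sphCoef f Z) (sphCoefDeriv f Z r) r ∧ ∃ U'', HasDerivAt (sphCoefDeriv f Z) U'' r ∧
      r ^ 2 * U'' + n * r * sphCoefDeriv f Z r - l * (l + n - 1) * sphCoef f Z r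
        = r ^ 2 * ∫ ξ : Sph n, lap f (r • (ξ : Euc (n + 1))) * Z ξ ∂surf n := by
  have hmem : ∀ ξ : Sph n, r • (ξ : Euc (n + 1)) ∈ Metric.ball (0 : Euc (n + 1)) R := fun ξ => by
    simpa [norm_smul] using hr
  have hd := hasDerivAt_integral_comp_curve (μ := surf n) (θ := r) (I := Set.Ioo (-R) R)
    Metric.isOpen_ball hf isOpen_Ioo (c := fun r (ξ : Sph n) => r • (ξ : Euc (n + 1)))
    (c' := fun _ (ξ : Sph n) => (ξ : Euc (n + 1))) (c'' := fun _ _ => 0) (by fun_prop) (by fun_prop)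
    (by fun_prop) (fun θ ξ => hasDerivAt_smul_const _ θ) (fun θ ξ => hasDerivAt_const _ _)
    (fun θ hθ ξ => by simpa [norm_smul] using abs_lt.2 hθ) hZ.continuous_sphere (abs_lt.1 hr)
  refine ⟨hd.1, _, hd.2, ?_⟩
  have hf1 : ContDiffOn ℝ 1 (fderiv ℝ f) (Metric.ball 0 R) :=
    hf.fderiv_of_isOpen Metric.isOpen_ball (by norm_num)
  have k0 : Continuous fun ξ : Sph n => f (r • (ξ : Euc (n + 1))) :=
    hf.continuousOn.comp_continuous (by fun_prop) hmem
  have k1 : Continuous fun ξ : Sph n => fderiv ℝ f (r • (ξ : Euc (n + 1))) :=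
    hf1.continuousOn.comp_continuous (by fun_prop) hmem
  have k2 : Continuous fun ξ : Sph n => fderiv ℝ (fderiv ℝ f) (r • (ξ : Euc (n + 1))) :=
    (hf1.continuousOn_fderiv_of_isOpen Metric.isOpen_ball le_rfl).comp_continuous (by fun_prop) hmem
  have z0 := hZ.continuous_sphere
  have z1 : Continuous fun ξ : Sph n => fderiv ℝ Z (ξ : Euc (n + 1)) :=
    (hZ.contDiff.continuous_fderiv (by norm_num)).comp continuous_subtype_val
  have z2 : Continuous fun ξ : Sph n => fderiv ℝ (fderiv ℝ Z) (ξ : Euc (n + 1)) :=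
    ((hZ.contDiff.fderiv_right (m := 1) (by norm_num)).continuous_fderiv
      (by norm_num)).comp continuous_subtype_val
  have s1 : ∀ i j : Fin (n + 1), Continuous fun ξ : Sph n => skew i j (ξ : Euc (n + 1)) :=
    fun i j => (skew i j).continuous.comp continuous_subtype_val
  have s2 : ∀ i j : Fin (n + 1), Continuous fun ξ : Sph n => skew i j (skew i j (ξ : Euc (n + 1))) :=
    fun i j => (skew i j).continuous.comp (s1 i j)
  have v0 : Continuous fun ξ : Sph n => (ξ : Euc (n + 1)) := continuous_subtype_val
  have m2 : Continuous fun ξ : Sph n => 2 * r ^ 2 * (lap f (r • (ξ : Euc (n + 1))) * Z ξ) :=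
    continuous_const.mul ((continuous_finsetSum _ fun i _ =>
      (k2.clm_apply continuous_const).clm_apply continuous_const).mul z0)
  -- The summand `fderiv ℝ f _ 0` comes from the zero second derivative of the curve `r ↦ r • ξ`.
  have m1 : Continuous fun ξ : Sph n => 2 * r ^ 2 *
      ((fderiv ℝ (fderiv ℝ f) (r • (ξ : Euc (n + 1))) ξ ξ
        + fderiv ℝ f (r • (ξ : Euc (n + 1))) 0) * Z ξ) :=
    continuous_const.mul ((((k2.clm_apply v0).clm_apply v0).add (k1.clm_apply continuous_const)).mul z0)
  have m0 : Continuous fun ξ : Sph n => 2 * n * r * (fderiv ℝ f (r • (ξ : Euc (n + 1))) ξ * Z ξ) :=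
    continuous_const.mul ((k1.clm_apply v0).mul z0)
  have hInt : ∀ i j : Fin (n + 1), Integrable (fun ξ : Sph n =>
      (fderiv ℝ (fderiv ℝ f) (r • (ξ : Euc (n + 1))) (r • skew i j ξ) (r • skew i j ξ)
        + fderiv ℝ f (r • (ξ : Euc (n + 1))) (r • skew i j (skew i j ξ))) * Z ξ) (surf n) :=
    fun i j => Continuous.integrable_of_compactSpace
      ((((k2.clm_apply ((s1 i j).const_smul r)).clm_apply ((s1 i j).const_smul r)).add
        (k1.clm_apply ((s2 i j).const_smul r))).mul z0)
  have hInt' : ∀ i j : Fin (n + 1), Integrable (fun ξ : Sph n =>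
      (fderiv ℝ (fderiv ℝ Z) ξ (skew i j ξ) (skew i j ξ)
        + fderiv ℝ Z ξ (skew i j (skew i j ξ))) * f (r • (ξ : Euc (n + 1)))) (surf n) :=
    fun i j => Continuous.integrable_of_compactSpace
      ((((z2.clm_apply (s1 i j)).clm_apply (s1 i j)).add (z1.clm_apply (s2 i j))).mul k0)
  have hsum : ∑ i, ∑ j, ∫ ξ : Sph n,
      (fderiv ℝ (fderiv ℝ f) (r • (ξ : Euc (n + 1))) (r • skew i j ξ) (r • skew i j ξ)
        + fderiv ℝ f (r • (ξ : Euc (n + 1))) (r • skew i j (skew i j ξ))) * Z ξ ∂surf n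
      = ∑ i, ∑ j, ∫ ξ : Sph n, (fderiv ℝ (fderiv ℝ Z) ξ (skew i j ξ) (skew i j ξ)
        + fderiv ℝ Z ξ (skew i j (skew i j ξ))) * f (r • (ξ : Euc (n + 1))) ∂surf n :=
    Finset.sum_congr rfl fun i _ => Finset.sum_congr rfl fun j _ =>
      integral_skew_sq hf hr hZ.contDiff i j
  have hL : ∑ i, ∑ j, ∫ ξ : Sph n,
      (fderiv ℝ (fderiv ℝ f) (r • (ξ : Euc (n + 1))) (r • skew i j ξ) (r • skew i j ξ)
        + fderiv ℝ f (r • (ξ : Euc (n + 1))) (r • skew i j (skew i j ξ))) * Z ξ ∂surf n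
      = ∫ ξ : Sph n, (2 * r ^ 2 * (lap f (r • (ξ : Euc (n + 1))) * Z ξ)
        - 2 * r ^ 2 * ((fderiv ℝ (fderiv ℝ f) (r • (ξ : Euc (n + 1))) ξ ξ
            + fderiv ℝ f (r • (ξ : Euc (n + 1))) 0) * Z ξ)
        - 2 * n * r * (fderiv ℝ f (r • (ξ : Euc (n + 1))) ξ * Z ξ)) ∂surf n := by
    rw [Finset.sum_congr rfl fun i _ => (integral_finsetSum _ fun j _ => hInt i j).symm,
      ← integral_finsetSum _ fun i _ => integrable_finsetSum _ fun j _ => hInt i j]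
    refine integral_congr_ae (Eventually.of_forall fun ξ => ?_)
    have e1 := sum_bilin_skew (fderiv ℝ (fderiv ℝ f) (r • (ξ : Euc (n + 1)))) ξ
    have e2 := congrArg (fderiv ℝ f (r • (ξ : Euc (n + 1)))) (sum_skew_skew (ξ : Euc (n + 1)))
    simp only [map_sum, map_smul, smul_eq_mul] at e2
    rw [show ‖(ξ : Euc (n + 1))‖ = 1 by simp] at e1
    simp only [← Finset.sum_mul, Finset.sum_add_distrib, map_smul, _root_.smul_apply, smul_eq_mul,
      ← Finset.mul_sum, e1, e2, map_zero, lap]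
    ring
  have hR : ∑ i, ∑ j, ∫ ξ : Sph n, (fderiv ℝ (fderiv ℝ Z) ξ (skew i j ξ) (skew i j ξ)
        + fderiv ℝ Z ξ (skew i j (skew i j ξ))) * f (r • (ξ : Euc (n + 1))) ∂surf n
      = ∫ ξ : Sph n, (-(2 * l * (l + n - 1)) * (f (r • (ξ : Euc (n + 1))) * Z ξ)) ∂surf n := by
    rw [Finset.sum_congr rfl fun i _ => (integral_finsetSum _ fun j _ => hInt' i j).symm,
      ← integral_finsetSum _ fun i _ => integrable_finsetSum _ fun j _ => hInt' i j]
    refine integral_congr_ae (Eventually.of_forall fun ξ => ?_)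
    have e1 := sum_bilin_skew (fderiv ℝ (fderiv ℝ Z) ξ) ξ
    have e2 := congrArg (fderiv ℝ Z ξ) (sum_skew_skew (ξ : Euc (n + 1)))
    have e3 : ∑ i, fderiv ℝ (fderiv ℝ Z) (ξ : Euc (n + 1)) (EuclideanSpace.single i 1)
      (EuclideanSpace.single i 1) = 0 := hZ.harmonic ξ
    simp only [map_sum, map_smul, smul_eq_mul] at e2
    rw [e3, hZ.fderiv_fderiv_self] at e1
    rw [hZ.fderiv_self] at e2
    simp only [← Finset.sum_mul, Finset.sum_add_distrib, e1, e2]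
    ring
  rw [hL, hR, integral_sub, integral_sub, integral_const_mul, integral_const_mul, integral_const_mul,
    integral_const_mul] at hsum
  · have h1 : sphCoefDeriv f Z r = ∫ ξ : Sph n, fderiv ℝ f (r • (ξ : Euc (n + 1))) ξ * Z ξ ∂surf n := rfl
    have h0 : sphCoef f Z r = ∫ ξ : Sph n, f (r • (ξ : Euc (n + 1))) * Z ξ ∂surf n := rfl
    rw [← h1, ← h0] at hsum
    linear_combination (-1 / 2 : ℝ) * hsum
  exacts [m2.integrable_of_compactSpace, m1.integrable_of_compactSpace,
    (m2.sub m1).integrable_of_compactSpace, m0.integrable_of_compactSpace]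

end

/-! ### The hyperbolic Laplacian on the ball -/

section
variable {n : ℕ}

theorem fderiv_fderiv_apply {E : Type*} [NormedAddCommGroup E] [NormedSpace ℝ E] {f : E → ℝ} {x : E}
    (h : DifferentiableAt ℝ (fderiv ℝ f) x) (v w : E) :
    fderiv ℝ (fun y => fderiv ℝ f y w) x v = fderiv ℝ (fderiv ℝ f) x v w := by
  rw [fderiv_clm_apply h (differentiableAt_const w)]
  simp

theorem sqrt_det_ballMetric {y : Euc (n + 1)} (hy : ‖y‖ < 1) :
    Real.sqrt (ballMetric (n + 1) y).det = (rho ‖y‖ ^ (n + 1))⁻¹ := by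
  have hρ := rho_pos (norm_nonneg y) hy
  have h : 1 - ‖y‖ ^ 2 = 2 * rho ‖y‖ := (two_mul_rho _).symm
  rw [ballMetric, Matrix.det_smul, Matrix.det_one, Fintype.card_fin, mul_one, h]
  have : (4 / (2 * rho ‖y‖) ^ 2) ^ (n + 1) = ((rho ‖y‖ ^ (n + 1))⁻¹) ^ 2 := by
    rw [← inv_pow, ← pow_mul, mul_comm (n + 1) 2, pow_mul]
    congr 1
    field_simp
    norm_num
  rw [this, Real.sqrt_sq (by positivity)]

theorem ballMetric_inv {y : Euc (n + 1)} (hy : ‖y‖ < 1) :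
    (ballMetric (n + 1) y)⁻¹ = (rho ‖y‖ ^ 2) • (1 : Matrix (Fin (n + 1)) (Fin (n + 1)) ℝ) := by
  have hρ := (rho_pos (norm_nonneg y) hy).ne'
  have h : 1 - ‖y‖ ^ 2 = 2 * rho ‖y‖ := (two_mul_rho _).symm
  refine Matrix.inv_eq_right_inv ?_
  rw [ballMetric, h, smul_mul_smul_comm, mul_one]
  have : 4 / (2 * rho ‖y‖) ^ 2 * rho ‖y‖ ^ 2 = 1 := by
    field_simp
    norm_num
  rw [this, one_smul]

theorem hasFDerivAt_rho_norm (x : Euc (n + 1)) :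
    HasFDerivAt (fun y : Euc (n + 1) => rho ‖y‖) (-innerSL ℝ x) x := by
  have h := ((hasStrictFDerivAt_norm_sq x).hasFDerivAt.const_sub 1).mul_const (1 / 2 : ℝ)
  have e : (fun y : Euc (n + 1) => rho ‖y‖) = fun y => (1 - ‖y‖ ^ 2) * (1 / 2 : ℝ) := by
    ext y; simp [rho]; ring
  rw [e]
  convert! h using 1
  ext v
  simp

/-- The metric is `ρ^{-2} |dx|²` in dimension `n + 1`, so `|g|^{1/2} g^{ij} = ρ^{1-n} δ_{ij}`. The
first-order term arises from differentiating `ρ^{1-n}`, the gradient of `ρ` being `-x`. -/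
theorem laplaceBeltrami_ballMetric (hn : 1 ≤ n) {u : Euc (n + 1) → ℝ}
    (hu : ContDiffOn ℝ 2 u (Metric.ball 0 1)) {x : Euc (n + 1)} (hx : ‖x‖ < 1) :
    laplaceBeltrami (ballMetric (n + 1)) u x
      = rho ‖x‖ ^ 2 * lap u x + (n - 1) * rho ‖x‖ * fderiv ℝ u x x := by
  obtain ⟨N, rfl⟩ : ∃ N, n = N + 1 := ⟨n - 1, by omega⟩
  have hρ := (rho_pos (norm_nonneg x) hx).ne'
  have hxm : x ∈ Metric.ball (0 : Euc (N + 1 + 1)) 1 := by simpa using hx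
  have hu1 : ContDiffOn ℝ 1 (fderiv ℝ u) (Metric.ball 0 1) :=
    hu.fderiv_of_isOpen Metric.isOpen_ball (by norm_num)
  have hd : DifferentiableAt ℝ (fderiv ℝ u) x :=
    (hu1.differentiableOn (by norm_num)).differentiableAt (Metric.isOpen_ball.mem_nhds hxm)
  have hpart : ∀ i, partialDeriv i (fun y => Real.sqrt (ballMetric (N + 1 + 1) y).det *
      ∑ j, (ballMetric (N + 1 + 1) y)⁻¹ i j * partialDeriv j u y) x
      = (rho ‖x‖ ^ N)⁻¹ * fderiv ℝ (fderiv ℝ u) x (EuclideanSpace.single i 1) (EuclideanSpace.single i 1)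
        + N * (rho ‖x‖ ^ (N + 1))⁻¹ * (x i * fderiv ℝ u x (EuclideanSpace.single i 1)) := by
    intro i
    have heq : (fun y => Real.sqrt (ballMetric (N + 1 + 1) y).det *
        ∑ j, (ballMetric (N + 1 + 1) y)⁻¹ i j * partialDeriv j u y) =ᶠ[𝓝 x]
        fun y => (rho ‖y‖ ^ N)⁻¹ * fderiv ℝ u y (EuclideanSpace.single i 1) := by
      filter_upwards [Metric.isOpen_ball.mem_nhds hxm] with y hy
      have hy' : ‖y‖ < 1 := by simpa using hy
      have hρy := (rho_pos (norm_nonneg y) hy').ne'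
      rw [sqrt_det_ballMetric hy', ballMetric_inv hy']
      simp only [Matrix.smul_apply, Matrix.one_apply, smul_eq_mul, mul_ite, mul_one, mul_zero, ite_mul,
        zero_mul, Finset.sum_ite_eq, Finset.mem_univ, if_true, partialDeriv]
      field_simp
      ring
    have hq : HasFDerivAt (fun y : Euc (N + 1 + 1) => (rho ‖y‖ ^ N)⁻¹)
        ((N * (rho ‖x‖ ^ (N + 1))⁻¹) • innerSL ℝ x) x := by
      have h1 : HasDerivAt (fun t : ℝ => (t ^ N)⁻¹) (-(N * (rho ‖x‖ ^ (N + 1))⁻¹)) (rho ‖x‖) := by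
        convert! (hasDerivAt_pow N (rho ‖x‖)).inv (pow_ne_zero _ hρ) using 1
        rcases N with _ | N
        · simp
        · simp only [add_tsub_cancel_right]
          field_simp
          ring
      have h2 := h1.comp_hasFDerivAt x (hasFDerivAt_rho_norm x)
      convert! h2 using 1
      simp
    have hpd : HasFDerivAt (fun y => fderiv ℝ u y (EuclideanSpace.single i 1))
        (fderiv ℝ (fun y => fderiv ℝ u y (EuclideanSpace.single i 1)) x) x :=
      (hd.clm_apply (differentiableAt_const _)).hasFDerivAt
    have hmul : HasFDerivAt (fun y => (rho ‖y‖ ^ N)⁻¹ * fderiv ℝ u y (EuclideanSpace.single i 1)) _ x :=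
      hq.mul hpd
    rw [partialDeriv, heq.fderiv_eq, hmul.fderiv]
    simp only [_root_.add_apply, _root_.smul_apply, smul_eq_mul, fderiv_fderiv_apply hd,
      innerSL_apply_apply, EuclideanSpace.inner_single_right]
    simp
    ring
  have hsum : ∑ i, x i * fderiv ℝ u x (EuclideanSpace.single i 1) = fderiv ℝ u x x := by
    conv_rhs => rw [← sum_smul_single x, map_sum]
    simp [sum_smul_single]
  rw [laplaceBeltrami, sqrt_det_ballMetric hx, Finset.sum_congr rfl fun i _ => hpart i,
    Finset.sum_add_distrib, ← Finset.mul_sum, ← Finset.mul_sum, hsum, lap]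
  push_cast
  field_simp
  ring

end

/-! ### Polynomials as functions -/

section Poly
variable {d : ℕ}

/-- The function on `ℝ^d` defined by a polynomial. -/
def polyFun (P : MvPolynomial (Fin d) ℝ) (x : Euc d) : ℝ := MvPolynomial.eval (fun i => x i) P

theorem hasFDerivAt_polyFun (P : MvPolynomial (Fin d) ℝ) (x : Euc d) :
    HasFDerivAt (polyFun P)
      (∑ i, polyFun (MvPolynomial.pderiv i P) x • EuclideanSpace.proj (𝕜 := ℝ) i) x := by
  induction P using MvPolynomial.induction_on with
  | C a =>
    have : polyFun (MvPolynomial.C a : MvPolynomial (Fin d) ℝ) = fun _ => a := by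
      ext x; simp [polyFun]
    rw [this]
    simpa [polyFun] using hasFDerivAt_const a x
  | add p q hp hq =>
    have : polyFun (p + q) = polyFun p + polyFun q := by ext x; simp [polyFun]
    rw [this]
    convert! hp.add hq using 1
    simp [polyFun, add_smul, Finset.sum_add_distrib]
  | mul_X p j hp =>
    have : polyFun (p * MvPolynomial.X j) = fun x => polyFun p x * x j := by
      ext x; simp [polyFun]
    rw [this]
    have hj : HasFDerivAt (fun x : Euc d => x j) (EuclideanSpace.proj (𝕜 := ℝ) j) x :=
      (EuclideanSpace.proj (𝕜 := ℝ) j).hasFDerivAt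
    convert! hp.mul hj using 1
    simp only [polyFun, MvPolynomial.pderiv_mul, MvPolynomial.pderiv_X, map_add, map_mul,
      MvPolynomial.eval_X, add_smul, Finset.sum_add_distrib, Finset.smul_sum, smul_smul]
    rw [add_comm]
    congr 1
    · rw [Finset.sum_eq_single j]
      · simp
      · intro i _ hij; simp [hij]
      · simp
    · exact Finset.sum_congr rfl fun i _ => by rw [mul_comm]

theorem fderiv_polyFun_single (P : MvPolynomial (Fin d) ℝ) (x : Euc d) (i : Fin d) :
    fderiv ℝ (polyFun P) x (EuclideanSpace.single i 1) = polyFun (MvPolynomial.pderiv i P) x := by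
  rw [(hasFDerivAt_polyFun P x).fderiv]
  simp [_root_.sum_apply]

theorem contDiff_polyFun (P : MvPolynomial (Fin d) ℝ) {k : WithTop ℕ∞} : ContDiff ℝ k (polyFun P) := by
  induction P using MvPolynomial.induction_on with
  | C a =>
    have : polyFun (MvPolynomial.C a : MvPolynomial (Fin d) ℝ) = fun _ => a := by
      ext x; simp [polyFun]
    rw [this]; exact contDiff_const
  | add p q hp hq =>
    have : polyFun (p + q) = polyFun p + polyFun q := by ext x; simp [polyFun]
    rw [this]; exact hp.add hq
  | mul_X p j hp =>
    have : polyFun (p * MvPolynomial.X j) = fun x => polyFun p x * x j := by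
      ext x; simp [polyFun]
    rw [this]
    exact hp.mul (EuclideanSpace.proj (𝕜 := ℝ) j).contDiff

/-- The Laplacian of a polynomial. -/
def polyLap (P : MvPolynomial (Fin d) ℝ) : MvPolynomial (Fin d) ℝ :=
  ∑ i, MvPolynomial.pderiv i (MvPolynomial.pderiv i P)

theorem lap_polyFun (P : MvPolynomial (Fin d) ℝ) (x : Euc d) :
    lap (polyFun P) x = polyFun (polyLap P) x := by
  have hd : DifferentiableAt ℝ (fderiv ℝ (polyFun P)) x :=
    ((contDiff_polyFun P (k := 2)).fderiv_right (m := 1) (by norm_num)).differentiable (by norm_num) x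
  simp only [lap, ← fderiv_fderiv_apply hd, fderiv_polyFun_single]
  simp [polyFun, polyLap, map_sum]

theorem polyFun_smul {P : MvPolynomial (Fin d) ℝ} {l : ℕ} (hP : P.IsHomogeneous l) (t : ℝ) (x : Euc d) :
    polyFun P (t • x) = t ^ l * polyFun P x := by
  simp only [polyFun, MvPolynomial.eval_eq', Finset.mul_sum]
  refine Finset.sum_congr rfl fun m hm => ?_
  have h := hP.degree_eq_sum_deg_support hm
  have : ∏ i, ((t • x) i) ^ m i = t ^ l * ∏ i, x i ^ m i := by
    simp only [PiLp.smul_apply, smul_eq_mul, mul_pow, Finset.prod_mul_distrib, Finset.prod_pow_eq_pow_sum]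
    rw [h, Finset.sum_subset (Finset.subset_univ m.support) fun i _ hi => by simpa using hi]
  rw [this]
  ring

theorem isSolidHarmonic_polyFun {n l : ℕ} {P : MvPolynomial (Fin (n + 1)) ℝ} (hP : P.IsHomogeneous l)
    (hL : polyLap P = 0) : IsSolidHarmonic n l (polyFun P) :=
  ⟨contDiff_polyFun P, polyFun_smul hP, fun x => by rw [lap_polyFun, hL]; simp [polyFun]⟩

theorem isSolidHarmonic_one (n : ℕ) : IsSolidHarmonic n 0 fun _ => 1 :=
  ⟨contDiff_const, fun _ _ => by simp, fun x => by simp [lap]⟩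

/-! ### Decomposition of polynomials into harmonic ones -/

theorem polyLap_add (P Q : MvPolynomial (Fin d) ℝ) : polyLap (P + Q) = polyLap P + polyLap Q := by
  simp [polyLap, Finset.sum_add_distrib]

theorem polyLap_sub (P Q : MvPolynomial (Fin d) ℝ) : polyLap (P - Q) = polyLap P - polyLap Q := by
  simp [polyLap, Finset.sum_sub_distrib]

theorem polyLap_smul (c : ℝ) (P : MvPolynomial (Fin d) ℝ) : polyLap (c • P) = c • polyLap P := by
  simp [polyLap, Finset.smul_sum]

/-- The polynomial `|x|²`. -/
def normSqPoly (d : ℕ) : MvPolynomial (Fin d) ℝ := ∑ i, MvPolynomial.X i ^ 2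

theorem isHomogeneous_normSqPoly : (normSqPoly d).IsHomogeneous 2 :=
  MvPolynomial.IsHomogeneous.sum _ _ _ fun i _ => MvPolynomial.isHomogeneous_X_pow i 2

theorem pderiv_normSqPoly (i : Fin d) :
    MvPolynomial.pderiv i (normSqPoly d) = 2 * MvPolynomial.X i := by
  simp only [normSqPoly, map_sum, MvPolynomial.pderiv_pow, MvPolynomial.pderiv_X]
  rw [Finset.sum_eq_single i]
  · simp
  · intro j _ hj; simp [hj.symm]
  · simp

theorem polyLap_normSqPoly_mul {P : MvPolynomial (Fin d) ℝ} {k : ℕ} (hP : P.IsHomogeneous k) :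
    polyLap (normSqPoly d * P) = (2 * d + 4 * k : ℝ) • P + normSqPoly d * polyLap P := by
  have h := hP.sum_X_mul_pderiv
  have e : ∀ i : Fin d, MvPolynomial.pderiv i (MvPolynomial.pderiv i (normSqPoly d * P))
      = 2 * P + 4 * (MvPolynomial.X i * MvPolynomial.pderiv i P)
        + normSqPoly d * MvPolynomial.pderiv i (MvPolynomial.pderiv i P) := by
    intro i
    have h2 : MvPolynomial.pderiv i (2 : MvPolynomial (Fin d) ℝ) = 0 := by
      exact (MvPolynomial.pderiv i).map_natCast 2
    simp only [MvPolynomial.pderiv_mul, pderiv_normSqPoly, map_add, MvPolynomial.pderiv_X_self, h2]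
    ring
  simp only [polyLap, e, Finset.sum_add_distrib, ← Finset.mul_sum, h, Finset.sum_const,
    Finset.card_univ, Fintype.card_fin, nsmul_eq_mul, MvPolynomial.smul_eq_C_mul]
  simp only [map_add, map_mul, map_natCast, map_ofNat]
  ring

theorem polyLap_normSqPoly_pow_mul {H : MvPolynomial (Fin d) ℝ} {m : ℕ} (hH : H.IsHomogeneous m)
    (hL : polyLap H = 0) (j : ℕ) : polyLap (normSqPoly d ^ (j + 1) * H)
      = (2 * (j + 1) * (2 * j + d + 2 * m) : ℝ) • (normSqPoly d ^ j * H) := by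
  have hhom : ∀ j : ℕ, (normSqPoly d ^ j * H).IsHomogeneous (2 * j + m) := fun j =>
    (isHomogeneous_normSqPoly.pow j).mul hH
  induction j with
  | zero =>
    have := polyLap_normSqPoly_mul hH
    rw [hL, mul_zero, add_zero] at this
    simp only [zero_add, pow_one, pow_zero, one_mul, this]
    congr 1
    push_cast
    ring
  | succ j ih =>
    rw [pow_succ', mul_assoc, polyLap_normSqPoly_mul (hhom (j + 1)), ih, mul_smul_comm, ← mul_assoc,
      ← pow_succ', ← add_smul]
    congr 1
    push_cast
    ring

/-- The span of the products `|x|^{2j} H` of total degree `k` with `H` harmonic. -/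
def harmonicSpan (d k : ℕ) : Submodule ℝ (MvPolynomial (Fin d) ℝ) :=
  Submodule.span ℝ {P | ∃ (j m : ℕ) (H : MvPolynomial (Fin d) ℝ), 2 * j + m = k ∧ H.IsHomogeneous m ∧
    polyLap H = 0 ∧ P = normSqPoly d ^ j * H}

theorem isHomogeneous_of_mem_harmonicSpan {k : ℕ} {P : MvPolynomial (Fin d) ℝ}
    (hP : P ∈ harmonicSpan d k) : P.IsHomogeneous k := by
  rw [← MvPolynomial.mem_homogeneousSubmodule]
  refine (Submodule.span_le (p := MvPolynomial.homogeneousSubmodule (Fin d) ℝ k)).2 ?_ hP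
  rintro _ ⟨j, m, H, rfl, hH, -, rfl⟩
  exact (isHomogeneous_normSqPoly.pow j).mul hH

/-- The Laplacian maps `|x|^{2j+2} H` to a nonzero multiple of `|x|^{2j} H`, so each generator has
an explicit preimage. -/
theorem exists_polyLap_eq {k : ℕ} (hd : 0 < d) {Q : MvPolynomial (Fin d) ℝ}
    (hQ : Q ∈ harmonicSpan d k) : ∃ S ∈ harmonicSpan d (k + 2), polyLap S = Q := by
  induction hQ using Submodule.span_induction with
  | mem P hP =>
    obtain ⟨j, m, H, hk, hH, hL, rfl⟩ := hP
    have hc : (2 * (j + 1) * (2 * j + d + 2 * m) : ℝ) ≠ 0 := by positivity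
    refine ⟨(2 * (j + 1) * (2 * j + d + 2 * m) : ℝ)⁻¹ • (normSqPoly d ^ (j + 1) * H),
      Submodule.smul_mem _ _ (Submodule.subset_span ⟨j + 1, m, H, by omega, hH, hL, rfl⟩), ?_⟩
    rw [polyLap_smul, polyLap_normSqPoly_pow_mul hH hL, smul_smul, inv_mul_cancel₀ hc, one_smul]
  | zero => exact ⟨0, Submodule.zero_mem _, by simp [polyLap]⟩
  | add P Q _ _ hP hQ =>
    obtain ⟨S, hS, rfl⟩ := hP
    obtain ⟨T, hT, rfl⟩ := hQ
    exact ⟨S + T, Submodule.add_mem _ hS hT, polyLap_add S T⟩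
  | smul c P _ hP =>
    obtain ⟨S, hS, rfl⟩ := hP
    exact ⟨c • S, Submodule.smul_mem _ c hS, polyLap_smul c S⟩

theorem pderiv_of_isHomogeneous_zero {P : MvPolynomial (Fin d) ℝ} (hP : P.IsHomogeneous 0) (i : Fin d) :
    MvPolynomial.pderiv i P = 0 := by
  rw [← MvPolynomial.totalDegree_zero_iff_isHomogeneous, MvPolynomial.totalDegree_eq_zero_iff_eq_C] at hP
  rw [hP, MvPolynomial.pderiv_C]

/-- Induction on the degree: `polyLap P` lies in the span two degrees lower, so it equals `polyLap
S` for some `S` in the span, and `P - S` is harmonic. -/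
theorem mem_harmonicSpan (hd : 0 < d) (k : ℕ) {P : MvPolynomial (Fin d) ℝ} (hP : P.IsHomogeneous k) :
    P ∈ harmonicSpan d k := by
  induction k using Nat.strong_induction_on generalizing P with
  | _ k ih =>
    have hharm : ∀ Q : MvPolynomial (Fin d) ℝ, Q.IsHomogeneous k → polyLap Q = 0 →
        Q ∈ harmonicSpan d k := fun Q hQ hL =>
      Submodule.subset_span ⟨0, k, Q, by omega, hQ, hL, by simp⟩
    rcases Nat.lt_or_ge k 2 with hk | hk
    · refine hharm P hP (Finset.sum_eq_zero fun i _ => pderiv_of_isHomogeneous_zero ?_ i)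
      have := hP.pderiv (i := i)
      rwa [show k - 1 = 0 by omega] at this
    · obtain ⟨j, rfl⟩ : ∃ j, k = j + 2 := ⟨k - 2, by omega⟩
      have hL : (polyLap P).IsHomogeneous j := MvPolynomial.IsHomogeneous.sum _ _ _ fun i _ =>
        (hP.pderiv (i := i)).pderiv (i := i)
      obtain ⟨S, hS, hSL⟩ := exists_polyLap_eq hd (ih j (by omega) hL)
      have h1 := hharm (P - S) (hP.sub (isHomogeneous_of_mem_harmonicSpan hS))
        (by rw [polyLap_sub, hSL, sub_self])
      simpa using Submodule.add_mem _ h1 hS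

end Poly

/-! ### Completeness of spherical harmonics -/

section Complete
variable {n : ℕ}

theorem polyFun_normSqPoly_sphere (ξ : Sph n) : polyFun (normSqPoly (n + 1)) ξ = 1 := by
  have h : ‖(ξ : Euc (n + 1))‖ ^ 2 = 1 := by simp
  rw [EuclideanSpace.real_norm_sq_eq] at h
  simpa [polyFun, normSqPoly] using h

theorem continuous_polyFun_sphere (P : MvPolynomial (Fin (n + 1)) ℝ) :
    Continuous fun ξ : Sph n => polyFun P ξ :=
  (contDiff_polyFun P (k := 0)).continuous.comp continuous_subtype_val

theorem integral_mul_polyFun_eq_zero {g : Sph n → ℝ} (hg : Continuous g)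
    (h : ∀ (l : ℕ) (H : MvPolynomial (Fin (n + 1)) ℝ), H.IsHomogeneous l → polyLap H = 0 →
      ∫ ξ : Sph n, g ξ * polyFun H ξ ∂surf n = 0) (P : MvPolynomial (Fin (n + 1)) ℝ) :
    ∫ ξ : Sph n, g ξ * polyFun P ξ ∂surf n = 0 := by
  have hInt : ∀ P : MvPolynomial (Fin (n + 1)) ℝ,
      Integrable (fun ξ : Sph n => g ξ * polyFun P ξ) (surf n) := fun P =>
    (hg.mul (continuous_polyFun_sphere P)).integrable_of_compactSpace
  have hadd : ∀ P Q : MvPolynomial (Fin (n + 1)) ℝ, ∫ ξ : Sph n, g ξ * polyFun (P + Q) ξ ∂surf n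
      = (∫ ξ : Sph n, g ξ * polyFun P ξ ∂surf n) + ∫ ξ : Sph n, g ξ * polyFun Q ξ ∂surf n := by
    intro P Q
    rw [← integral_add (hInt P) (hInt Q)]
    simp [polyFun, mul_add]
  have hhom : ∀ k : ℕ, ∀ P ∈ harmonicSpan (n + 1) k, ∫ ξ : Sph n, g ξ * polyFun P ξ ∂surf n = 0 := by
    intro k P hP
    induction hP using Submodule.span_induction with
    | mem P hP =>
      obtain ⟨j, m, H, hk, hH, hL, rfl⟩ := hP
      rw [← h m H hH hL]
      refine integral_congr_ae (Eventually.of_forall fun ξ => ?_)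
      have h1 := polyFun_normSqPoly_sphere ξ
      simp only [polyFun] at h1 ⊢
      rw [map_mul, map_pow, h1, one_pow, one_mul]
    | zero => simp [polyFun]
    | add P Q _ _ hP hQ => rw [hadd, hP, hQ, add_zero]
    | smul c P _ hP =>
      have : ∀ ξ : Sph n, g ξ * polyFun (c • P) ξ = c * (g ξ * polyFun P ξ) := fun ξ => by
        simp [polyFun]; ring
      simp only [this, integral_const_mul, hP, mul_zero]
  induction P using MvPolynomial.induction_on' with
  | monomial m a =>
    exact hhom _ _ (mem_harmonicSpan (by omega) _ (MvPolynomial.isHomogeneous_monomial a rfl))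
  | add P Q hP hQ => rw [hadd, hP, hQ, add_zero]

/-- The coordinate functions on the sphere. -/
def sphCoord (i : Fin (n + 1)) : C(Sph n, ℝ) := ⟨fun ξ => (ξ : Euc (n + 1)) i, by fun_prop⟩

theorem aeval_sphCoord (P : MvPolynomial (Fin (n + 1)) ℝ) (ξ : Sph n) :
    (MvPolynomial.aeval (sphCoord (n := n)) P) ξ = polyFun P ξ := by
  induction P using MvPolynomial.induction_on with
  | C a => simp [polyFun]
  | add p q hp hq => simp only [map_add, ContinuousMap.add_apply, hp, hq, polyFun]
  | mul_X p j hp =>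
    simp only [map_mul, ContinuousMap.mul_apply, hp, polyFun, MvPolynomial.aeval_X, MvPolynomial.eval_X]
    rfl

/-- A continuous function on the sphere that is orthogonal to all spherical harmonics vanishes. -/
theorem eq_zero_of_orthogonal {g : Sph n → ℝ} (hg : Continuous g)
    (h : ∀ (l : ℕ) (H : MvPolynomial (Fin (n + 1)) ℝ), H.IsHomogeneous l → polyLap H = 0 →
      ∫ ξ : Sph n, g ξ * polyFun H ξ ∂surf n = 0) : g = 0 := by
  set A : Subalgebra ℝ C(Sph n, ℝ) := (MvPolynomial.aeval (sphCoord (n := n))).range with hA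
  have hsep : A.SeparatesPoints := by
    intro ξ η hne
    obtain ⟨i, hi⟩ : ∃ i, (ξ : Euc (n + 1)) i ≠ (η : Euc (n + 1)) i := by
      by_contra! hall
      exact hne (Subtype.ext (PiLp.ext hall))
    exact ⟨_, ⟨sphCoord i, ⟨MvPolynomial.X i, by simp⟩, rfl⟩, hi⟩
  have hsq : ∫ ξ, g ξ ^ 2 ∂surf n = 0 := by
    -- Stone–Weierstrass gives a polynomial `P` within `ε` of `g`. Since `g` is orthogonal to `P`,
    -- the integral of `g²` is that of `g (g - P)`.
    have hM : ∀ ε > 0, ∫ ξ, g ξ ^ 2 ∂surf n ≤ ε * ∫ ξ, |g ξ| ∂surf n := by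
      intro ε hε
      obtain ⟨⟨_, P, rfl⟩, ha⟩ :=
        ContinuousMap.exists_mem_subalgebra_near_continuous_of_separatesPoints A hsep g hg ε hε
      have hP : Continuous fun ξ : Sph n => polyFun P ξ := continuous_polyFun_sphere P
      have e : ∫ ξ, g ξ ^ 2 ∂surf n = ∫ ξ, g ξ * (g ξ - polyFun P ξ) ∂surf n := by
        have h0 := integral_mul_polyFun_eq_zero hg h P
        have : ∀ ξ : Sph n, g ξ * (g ξ - polyFun P ξ) = g ξ ^ 2 - g ξ * polyFun P ξ := fun ξ => by ring
        simp only [this]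
        have i1 : Integrable (fun ξ => g ξ ^ 2) (surf n) := (hg.pow 2).integrable_of_compactSpace
        have i2 : Integrable (fun ξ : Sph n => g ξ * polyFun P ξ) (surf n) :=
          (hg.mul hP).integrable_of_compactSpace
        rw [integral_sub i1 i2, h0, sub_zero]
      rw [e, ← integral_const_mul]
      refine integral_mono (hg.mul (hg.sub hP)).integrable_of_compactSpace
        (continuous_const.mul hg.abs).integrable_of_compactSpace fun ξ => ?_
      have h1 := ha ξ
      simp only [RingHom.coe_coe, AlgHom.toRingHom_eq_coe] at h1
      rw [aeval_sphCoord, Real.norm_eq_abs, abs_sub_comm] at h1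
      calc g ξ * (g ξ - polyFun P ξ) ≤ |g ξ| * |g ξ - polyFun P ξ| := by
            rw [← abs_mul]; exact le_abs_self _
        _ ≤ |g ξ| * ε := by gcongr
        _ = _ := mul_comm _ _
    have hnn : 0 ≤ ∫ ξ, g ξ ^ 2 ∂surf n := integral_nonneg fun ξ => sq_nonneg _
    have hlim : Tendsto (fun ε : ℝ => ε * ∫ ξ, |g ξ| ∂surf n) (𝓝[>] 0) (𝓝 0) := by
      have : Continuous fun ε : ℝ => ε * ∫ ξ, |g ξ| ∂surf n := by fun_prop
      simpa using (this.tendsto 0).mono_left nhdsWithin_le_nhds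
    exact le_antisymm (ge_of_tendsto hlim (by
      filter_upwards [self_mem_nhdsWithin] with ε hε using hM ε hε)) hnn
  have hae := (integral_eq_zero_iff_of_nonneg (fun ξ => sq_nonneg (g ξ))
    (hg.pow 2).integrable_of_compactSpace).1 hsq
  have hz := (Continuous.ae_eq_iff_eq (surf n) (hg.pow 2) continuous_zero).1 hae
  ext ξ
  simpa using congrFun hz ξ

end Complete

section
variable {n k l : ℕ} {Z W : Euc (n + 1) → ℝ}

/-! ### Orthogonality of solid harmonics of different degrees -/

/-- Apply `sphCoef_radial` with `f = W` at `r = 1`, where the component is `r^k c`: it reads `(k -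
l)(k + l + n - 1) c = 0`. -/
theorem IsSolidHarmonic.integral_mul_eq_zero (hn : 1 ≤ n) (hZ : IsSolidHarmonic n l Z)
    (hW : IsSolidHarmonic n k W) (hkl : k ≠ l) : ∫ ξ : Sph n, W ξ * Z ξ ∂surf n = 0 := by
  set c := ∫ ξ : Sph n, W ξ * Z ξ ∂surf n with hc
  have h0 : sphCoef W Z = fun r => r ^ k * c := by
    ext r
    simp only [sphCoef, hW.homogeneous, hc, ← integral_const_mul, mul_assoc]
  have h1 : sphCoefDeriv W Z = fun r => k * r ^ (k - 1) * c := by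
    ext r
    simp only [sphCoefDeriv, hW.fderiv_smul, hc, ← integral_const_mul, mul_assoc]
  obtain ⟨-, U'', h2, h3⟩ := sphCoef_radial hZ (f := W) (R := 2) (r := 1) hW.contDiff.contDiffOn
    (by norm_num)
  have h4 : U'' = k * (k - 1) * c := by
    have h5 : HasDerivAt (sphCoefDeriv W Z) (k * (k - 1) * c) 1 := by
      rw [h1]
      convert! ((hasDerivAt_pow (k - 1) (1 : ℝ)).const_mul (k : ℝ)).mul_const c using 1
      rcases k with _ | k <;> simp
    exact h2.unique h5
  simp only [hW.harmonic, h0, h1, h4, zero_mul, integral_zero] at h3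
  have h6 : ((k : ℝ) - l) * ((k + l + n - 1) * c) = 0 := by
    simp only [one_pow] at h3
    linear_combination h3
  have hn' : (1 : ℝ) ≤ n := by exact_mod_cast hn
  have hne : (k : ℝ) - l ≠ 0 := sub_ne_zero.2 (by exact_mod_cast hkl)
  have hpos : (k : ℝ) + l + n - 1 ≠ 0 := by
    have : 1 ≤ k + l := by omega
    have : (1 : ℝ) ≤ k + l := by exact_mod_cast this
    linarith
  exact ((mul_eq_zero.1 ((mul_eq_zero.1 h6).resolve_left hne)).resolve_left hpos)

/-! ### The mean value property -/

/-- The case `Z = 1` of the radial identity says that `r^n U'` is constant. It vanishes at the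
origin, so `U` is constant. -/
theorem integral_sphere_eq_of_lap_eq_zero (hn : 1 ≤ n) {f : Euc (n + 1) → ℝ} (hf : ContDiff ℝ 2 f)
    (hL : ∀ x, lap f x = 0) {r : ℝ} (hr : 0 < r) :
    ∫ ξ : Sph n, f (r • (ξ : Euc (n + 1))) ∂surf n = f 0 * (surf n).real Set.univ := by
  obtain ⟨N, rfl⟩ : ∃ N, n = N + 1 := ⟨n - 1, by omega⟩
  set Z : Euc (N + 1 + 1) → ℝ := fun _ => 1 with hZ
  have hrad := fun t : ℝ => sphCoef_radial (isSolidHarmonic_one (N + 1)) (f := f) (R := |t| + 1) (r := t)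
    hf.contDiffOn (by linarith)
  have hconst : ∃ C, ∀ t ∈ Set.Ioi (0 : ℝ), t ^ (N + 1) * sphCoefDeriv f Z t = C := by
    have hder : ∀ t ∈ Set.Ioi (0 : ℝ), HasDerivAt (fun t => t ^ (N + 1) * sphCoefDeriv f Z t) 0 t := by
      intro t ht
      obtain ⟨-, U'', h2, h3⟩ := hrad t
      convert! (hasDerivAt_pow (N + 1) t).mul h2 using 1
      simp only [hL, zero_mul, integral_zero, mul_zero] at h3
      have ht0 : t ≠ 0 := (ne_of_gt ht)
      have h4 : t * (t * U'' + (N + 1) * sphCoefDeriv f Z t) = 0 := by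
        push_cast at h3
        linear_combination h3
      have h5 := (mul_eq_zero.1 h4).resolve_left ht0
      rw [add_tsub_cancel_right]
      push_cast
      linear_combination (-t ^ N) * h5
    exact isOpen_Ioi.exists_is_const_of_deriv_eq_zero isPreconnected_Ioi
      (fun t ht => (hder t ht).differentiableAt.differentiableWithinAt) (fun t ht => (hder t ht).deriv)
  obtain ⟨C, hC⟩ := hconst
  have hC0 : C = 0 := by
    obtain ⟨-, U'', h2, -⟩ := hrad 0
    have h3 : ContinuousAt (fun t => t ^ (N + 1) * sphCoefDeriv f Z t) 0 :=
      (continuousAt_pow 0 (N + 1)).mul h2.continuousAt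
    have h4 := h3.tendsto.mono_left (nhdsWithin_le_nhds (s := Set.Ioi 0))
    simp only [ne_eq, Nat.add_eq_zero_iff, one_ne_zero, and_false, not_false_eq_true, zero_pow,
      zero_mul] at h4
    refine tendsto_nhds_unique (tendsto_const_nhds.congr' ?_) h4
    filter_upwards [self_mem_nhdsWithin] with t ht using (hC t ht).symm
  have hder0 : ∀ t ∈ Set.Ioi (0 : ℝ), HasDerivAt (sphCoef f Z) 0 t := by
    intro t ht
    have h1 := (hrad t).1
    have h2 := hC t ht
    rw [hC0] at h2
    rwa [(mul_eq_zero.1 h2).resolve_left (pow_ne_zero _ (ne_of_gt ht))] at h1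
  obtain ⟨D, hD⟩ := isOpen_Ioi.exists_is_const_of_deriv_eq_zero isPreconnected_Ioi
    (fun t ht => (hder0 t ht).differentiableAt.differentiableWithinAt) (fun t ht => (hder0 t ht).deriv)
  have hD0 : sphCoef f Z 0 = D := by
    have h4 := (hrad 0).1.continuousAt.tendsto.mono_left (nhdsWithin_le_nhds (s := Set.Ioi 0))
    refine (tendsto_nhds_unique (tendsto_const_nhds.congr' ?_) h4).symm
    filter_upwards [self_mem_nhdsWithin] with t ht using (hD t ht).symm
  have h1 := hD r hr
  rw [← hD0] at h1
  simp only [sphCoef, hZ, mul_one, zero_smul, integral_const, smul_eq_mul] at h1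
  rw [h1, mul_comm]

/-- Expand the nonnegative integral of `(f(x + rξ) - f(x))²` and use the mean value property for the
cross term. -/
theorem sq_mul_le_integral_sphere (hn : 1 ≤ n) {f : Euc (n + 1) → ℝ} (hf : ContDiff ℝ 2 f)
    (hL : ∀ x, lap f x = 0) (x : Euc (n + 1)) {r : ℝ} (hr : 0 < r) :
    f x ^ 2 * (surf n).real Set.univ
      ≤ ∫ ξ : Sph n, f (x + r • (ξ : Euc (n + 1))) ^ 2 ∂surf n := by
  have hf' : ContDiff ℝ 2 fun y => f (x + y) := hf.comp (contDiff_const.add contDiff_id)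
  have hL' : ∀ y, lap (fun y => f (x + y)) y = 0 := by
    intro y
    have e : fderiv ℝ (fun y => f (x + y)) = fun y => fderiv ℝ f (x + y) := by
      ext1 y; exact fderiv_comp_add_left x
    have := hL (x + y)
    simpa only [lap, e, fderiv_comp_add_left] using this
  have hm := integral_sphere_eq_of_lap_eq_zero hn hf' hL' hr
  simp only [add_zero] at hm
  have hc : Continuous fun ξ : Sph n => f (x + r • (ξ : Euc (n + 1))) :=
    hf.continuous.comp (by fun_prop)
  have hnn : 0 ≤ ∫ ξ : Sph n, (f (x + r • (ξ : Euc (n + 1))) - f x) ^ 2 ∂surf n :=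
    integral_nonneg fun ξ => sq_nonneg _
  have i1 : Integrable (fun ξ : Sph n => f (x + r • (ξ : Euc (n + 1))) ^ 2) (surf n) :=
    (hc.pow 2).integrable_of_compactSpace
  have i2 : Integrable (fun ξ : Sph n => 2 * f x * f (x + r • (ξ : Euc (n + 1)))) (surf n) :=
    (continuous_const.mul hc).integrable_of_compactSpace
  have e : ∀ ξ : Sph n, (f (x + r • (ξ : Euc (n + 1))) - f x) ^ 2
      = f (x + r • (ξ : Euc (n + 1))) ^ 2 - 2 * f x * f (x + r • (ξ : Euc (n + 1))) + f x ^ 2 :=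
    fun ξ => by ring
  simp only [e] at hnn
  have i3 : Integrable (fun ξ : Sph n => f (x + r • (ξ : Euc (n + 1))) ^ 2
      - 2 * f x * f (x + r • (ξ : Euc (n + 1)))) (surf n) := i1.sub i2
  rw [integral_add i3 (integrable_const _), integral_sub i1 i2, integral_const_mul, hm,
    integral_const, smul_eq_mul] at hnn
  linarith

/-! ### A pointwise bound for solid harmonics -/

theorem lintegral_polar {g : Euc (n + 1) → ENNReal} (hg : Measurable g) :
    ∫⁻ x, g x = ∫⁻ t : Set.Ioi (0 : ℝ), ∫⁻ ξ : Sph n, g ((t : ℝ) • (ξ : Euc (n + 1))) ∂surf n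
      ∂(Measure.volumeIoiPow n) := by
  have hmp := (volume : Measure (Euc (n + 1))).measurePreserving_homeomorphUnitSphereProd
  have hfin : Module.finrank ℝ (Euc (n + 1)) - 1 = n := by simp
  rw [hfin] at hmp
  have hmeas : Measurable fun p : Sph n × Set.Ioi (0 : ℝ) => g ((p.2 : ℝ) • (p.1 : Euc (n + 1))) :=
    hg.comp ((measurable_subtype_coe.comp measurable_snd).smul
      (measurable_subtype_coe.comp measurable_fst))
  rw [← lintegral_prod_symm' _ hmeas, ← hmp.lintegral_comp hmeas]
  have h1 : ∀ x : ({0}ᶜ : Set (Euc (n + 1))),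
      g (((homeomorphUnitSphereProd (Euc (n + 1)) x).2 : ℝ) •
        ((homeomorphUnitSphereProd (Euc (n + 1)) x).1 : Euc (n + 1))) = g x := by
    intro x
    have hx : ‖(x : Euc (n + 1))‖ ≠ 0 := norm_ne_zero_iff.2 x.2
    simp [smul_smul, hx]
  simp only [h1]
  rw [lintegral_subtype_comap (measurableSet_singleton _).compl, restrict_compl_singleton]

/-- The sub-mean-value inequality bounds `Z(ξ)²` by the integral of `Z²` over the ball of radius `δ`
about `ξ`. That ball lies in the ball of radius `1 + δ` about `0`, where homogeneity reduces the
integral to the sphere. `K` is independent of `l`, and taking `δ` small makes the loss `(1+δ)^{2l}`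
harmless. -/
theorem IsSolidHarmonic.exists_bound (hn : 1 ≤ n) {δ : ℝ} (hδ : 0 < δ) :
    ∃ K : ℝ, ∀ (l : ℕ) (Z : Euc (n + 1) → ℝ), IsSolidHarmonic n l Z → ∀ ξ : Sph n,
      Z ξ ^ 2 ≤ K * (1 + δ) ^ (2 * l) * ∫ η : Sph n, Z η ^ 2 ∂surf n := by
  set ν := Measure.volumeIoiPow n
  set S := (surf n).real Set.univ with hS
  have hSpos : 0 < S := by
    rw [hS, Measure.toSphere_real_apply_univ]
    have : 0 < (volume : Measure (Euc (n + 1))).real (Metric.ball 0 1) :=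
      ENNReal.toReal_pos (Metric.measure_ball_pos _ _ one_pos).ne' measure_ball_lt_top.ne
    have h2 : 0 < Module.finrank ℝ (Euc (n + 1)) := by simp
    positivity
  -- `a` and `b` are the integrals of `t^n` over `(0, δ)` and `(0, 1 + δ)`, the radial factors of
  -- the two balls.
  set a : ℝ := δ ^ (n + 1) / (n + 1) with ha
  set b : ℝ := (1 + δ) ^ (n + 1) / (n + 1) with hb
  have hapos : 0 < a := by positivity
  have hbpos : 0 < b := by positivity
  refine ⟨b / (S * a), fun l Z hZ ξ => ?_⟩
  set I := ∫ η : Sph n, Z η ^ 2 ∂surf n with hI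
  have hZc : Continuous fun η : Sph n => Z η ^ 2 := hZ.continuous_sphere.pow 2
  have hI0 : 0 ≤ I := integral_nonneg fun η => sq_nonneg _
  have low : ENNReal.ofReal (Z ξ ^ 2 * S) * ENNReal.ofReal a
      ≤ ∫⁻ y in Metric.ball (0 : Euc (n + 1)) δ, ENNReal.ofReal (Z (ξ + y) ^ 2) := by
    have hm : Measurable fun y : Euc (n + 1) => ENNReal.ofReal (Z (ξ + y) ^ 2) :=
      (ENNReal.continuous_ofReal.comp ((hZ.contDiff.continuous.comp (by fun_prop)).pow 2)).measurable
    rw [← lintegral_indicator Metric.isOpen_ball.measurableSet,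
      lintegral_polar (hm.indicator Metric.isOpen_ball.measurableSet)]
    have hν : ν (Set.Iio ⟨δ, hδ⟩) = ENNReal.ofReal a := Measure.volumeIoiPow_apply_Iio n ⟨δ, hδ⟩
    rw [← hν, ← setLIntegral_const, ← lintegral_indicator measurableSet_Iio]
    refine lintegral_mono fun t => ?_
    by_cases ht : t ∈ Set.Iio (⟨δ, hδ⟩ : Set.Ioi (0 : ℝ))
    · have ht' : (t : ℝ) < δ := ht
      have ht0 : (0 : ℝ) < t := t.2
      rw [Set.indicator_of_mem ht]
      have hmem : ∀ η : Sph n, (t : ℝ) • (η : Euc (n + 1)) ∈ Metric.ball (0 : Euc (n + 1)) δ := fun η => by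
        simpa [norm_smul, abs_of_pos ht0] using ht'
      simp only [Set.indicator_of_mem (hmem _)]
      have hc : Continuous fun η : Sph n => Z ((ξ : Euc (n + 1)) + (t : ℝ) • (η : Euc (n + 1))) ^ 2 :=
        (hZ.contDiff.continuous.comp (by fun_prop)).pow 2
      rw [← ofReal_integral_eq_lintegral_ofReal hc.integrable_of_compactSpace
        (Eventually.of_forall fun η => sq_nonneg _)]
      exact ENNReal.ofReal_le_ofReal (sq_mul_le_integral_sphere hn hZ.contDiff hZ.harmonic ξ ht0)
    · rw [Set.indicator_of_notMem ht]
      exact bot_le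
  have up : ∫⁻ y in Metric.ball (0 : Euc (n + 1)) (1 + δ), ENNReal.ofReal (Z y ^ 2)
      ≤ ENNReal.ofReal ((1 + δ) ^ (2 * l) * I) * ENNReal.ofReal b := by
    have hm : Measurable fun y : Euc (n + 1) => ENNReal.ofReal (Z y ^ 2) :=
      (ENNReal.continuous_ofReal.comp (hZ.contDiff.continuous.pow 2)).measurable
    have h1δ : 0 < 1 + δ := by positivity
    rw [← lintegral_indicator Metric.isOpen_ball.measurableSet,
      lintegral_polar (hm.indicator Metric.isOpen_ball.measurableSet)]
    have hν : ν (Set.Iio ⟨1 + δ, h1δ⟩) = ENNReal.ofReal b :=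
      Measure.volumeIoiPow_apply_Iio n ⟨1 + δ, h1δ⟩
    rw [← hν, ← setLIntegral_const, ← lintegral_indicator measurableSet_Iio]
    refine lintegral_mono fun t => ?_
    have ht0 : (0 : ℝ) < t := t.2
    by_cases ht : t ∈ Set.Iio (⟨1 + δ, h1δ⟩ : Set.Ioi (0 : ℝ))
    · have ht' : (t : ℝ) < 1 + δ := ht
      rw [Set.indicator_of_mem ht]
      have hmem : ∀ η : Sph n, (t : ℝ) • (η : Euc (n + 1)) ∈
          Metric.ball (0 : Euc (n + 1)) (1 + δ) := fun η => by
        simpa [norm_smul, abs_of_pos ht0] using ht'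
      simp only [Set.indicator_of_mem (hmem _), hZ.homogeneous]
      have hc : Continuous fun η : Sph n => ((t : ℝ) ^ l * Z η) ^ 2 :=
        (continuous_const.mul hZ.continuous_sphere).pow 2
      rw [← ofReal_integral_eq_lintegral_ofReal hc.integrable_of_compactSpace
        (Eventually.of_forall fun η => sq_nonneg _)]
      refine ENNReal.ofReal_le_ofReal ?_
      simp only [mul_pow, integral_const_mul, ← pow_mul, mul_comm l 2]
      gcongr
    · rw [Set.indicator_of_notMem ht]
      have hmem : ∀ η : Sph n, (t : ℝ) • (η : Euc (n + 1)) ∉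
          Metric.ball (0 : Euc (n + 1)) (1 + δ) := fun η => by
        have : 1 + δ ≤ (t : ℝ) := not_lt.1 ht
        simpa [norm_smul, abs_of_pos ht0] using this
      simp only [Set.indicator_of_notMem (hmem _), lintegral_zero, le_refl]
  have mid : ∫⁻ y in Metric.ball (0 : Euc (n + 1)) δ, ENNReal.ofReal (Z (ξ + y) ^ 2)
      ≤ ∫⁻ y in Metric.ball (0 : Euc (n + 1)) (1 + δ), ENNReal.ofReal (Z y ^ 2) := by
    rw [← lintegral_indicator Metric.isOpen_ball.measurableSet,
      ← lintegral_indicator Metric.isOpen_ball.measurableSet,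
      ← lintegral_add_left_eq_self ((Metric.ball (0 : Euc (n + 1)) (1 + δ)).indicator _)
        (ξ : Euc (n + 1))]
    refine lintegral_mono fun y => ?_
    by_cases hy : y ∈ Metric.ball (0 : Euc (n + 1)) δ
    · rw [Set.indicator_of_mem hy, Set.indicator_of_mem]
      have hy' : ‖y‖ < δ := by simpa using hy
      have : ‖(ξ : Euc (n + 1)) + y‖ ≤ 1 + ‖y‖ := by
        simpa using norm_add_le (ξ : Euc (n + 1)) y
      simp only [Metric.mem_ball, dist_zero_right]
      linarith
    · rw [Set.indicator_of_notMem hy]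
      exact bot_le
  have h := (low.trans mid).trans up
  rw [← ENNReal.ofReal_mul (by positivity), ← ENNReal.ofReal_mul (by positivity),
    ENNReal.ofReal_le_ofReal_iff (by positivity)] at h
  have e : b / (S * a) * (1 + δ) ^ (2 * l) * I = ((1 + δ) ^ (2 * l) * I * b) / (S * a) := by ring
  rw [e, le_div_iff₀ (by positivity)]
  linarith

end

section
variable {n l : ℕ} {γ : ℝ} {f : Sph n → ℝ} {u Z : Euc (n + 1) → ℝ}

/-! ### Components of a solution -/

theorem IsPoissonSolution.contDiffOn {s : ℝ} (hu : IsPoissonSolution n s f u) :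
    ContDiffOn ℝ 2 u (Metric.ball 0 1) := by
  obtain ⟨-, F, H, hF, hH, hFH, -⟩ := hu
  have hsub := Metric.ball_subset_closedBall (x := (0 : Euc (n + 1))) (ε := 1)
  have hρ : ContDiff ℝ 2 fun x : Euc (n + 1) => rho ‖x‖ := by
    unfold rho
    exact (contDiff_const.sub (contDiff_norm_sq ℝ)).div_const 2
  have hne : ∀ x ∈ Metric.ball (0 : Euc (n + 1)) 1, rho ‖x‖ ≠ 0 := fun x hx =>
    (rho_pos (norm_nonneg x) (by simpa using hx)).ne'
  have hle : (2 : WithTop ℕ∞) ≤ ∞ := WithTop.coe_le_coe.2 le_top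
  exact ((((hF.mono hsub).of_le hle).mul (hρ.contDiffOn.rpow_const_of_ne hne)).add
    (((hH.mono hsub).of_le hle).mul (hρ.contDiffOn.rpow_const_of_ne hne))).congr hFH

theorem IsPoissonSolution.continuous_boundary {s : ℝ} (hu : IsPoissonSolution n s f u) :
    Continuous f := by
  obtain ⟨-, F, H, hF, hH, hFH, hFf⟩ := hu
  have : Continuous fun ξ : Sph n => F ξ :=
    hF.continuousOn.comp_continuous continuous_subtype_val fun ξ => by simp
  exact this.congr hFf

theorem IsPoissonSolution.isRadialSol (hn : 1 ≤ n) (hu : IsPoissonSolution n ((n : ℝ) / 2 + γ) f u)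
    (hZ : IsSolidHarmonic n l Z) :
    IsRadialSol n l ((n / 2 + γ) * (n - (n / 2 + γ))) (sphCoef u Z) (sphCoefDeriv u Z) := by
  intro r h0 h1
  have hu2 := hu.contDiffOn
  obtain ⟨hd, U'', hd', heq⟩ := sphCoef_radial hZ hu2 (r := r) (by rwa [abs_of_pos h0])
  refine ⟨hd, U'', hd', ?_⟩
  have hmem : ∀ ξ : Sph n, r • (ξ : Euc (n + 1)) ∈ Metric.ball (0 : Euc (n + 1)) 1 := fun ξ => by
    simpa [norm_smul, abs_of_pos h0] using h1
  have hnorm : ∀ ξ : Sph n, ‖r • (ξ : Euc (n + 1))‖ = r := fun ξ => by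
    simp [norm_smul, abs_of_pos h0]
  have hf1 : ContDiffOn ℝ 1 (fderiv ℝ u) (Metric.ball 0 1) :=
    hu2.fderiv_of_isOpen Metric.isOpen_ball (by norm_num)
  have k0 : Continuous fun ξ : Sph n => u (r • (ξ : Euc (n + 1))) :=
    hu2.continuousOn.comp_continuous (by fun_prop) hmem
  have k1 : Continuous fun ξ : Sph n => fderiv ℝ u (r • (ξ : Euc (n + 1))) :=
    hf1.continuousOn.comp_continuous (by fun_prop) hmem
  have k2 : Continuous fun ξ : Sph n => fderiv ℝ (fderiv ℝ u) (r • (ξ : Euc (n + 1))) :=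
    (hf1.continuousOn_fderiv_of_isOpen Metric.isOpen_ball le_rfl).comp_continuous (by fun_prop) hmem
  have z0 := hZ.continuous_sphere
  have m0 : Integrable (fun ξ : Sph n => (n / 2 + γ) * (n - (n / 2 + γ)) *
      (u (r • (ξ : Euc (n + 1))) * Z ξ)) (surf n) :=
    (continuous_const.mul (k0.mul z0)).integrable_of_compactSpace
  have m1 : Integrable (fun ξ : Sph n => (n - 1) * rho r * r *
      (fderiv ℝ u (r • (ξ : Euc (n + 1))) ξ * Z ξ)) (surf n) :=
    (continuous_const.mul ((k1.clm_apply continuous_subtype_val).mul z0)).integrable_of_compactSpace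
  have m2 : Integrable (fun ξ : Sph n => rho r ^ 2 * (lap u (r • (ξ : Euc (n + 1))) * Z ξ)) (surf n) :=
    (continuous_const.mul ((continuous_finsetSum _ fun i _ => (k2.clm_apply
      continuous_const).clm_apply continuous_const).mul z0)).integrable_of_compactSpace
  have m12 : Integrable (fun ξ : Sph n => rho r ^ 2 * (lap u (r • (ξ : Euc (n + 1))) * Z ξ)
      + (n - 1) * rho r * r * (fderiv ℝ u (r • (ξ : Euc (n + 1))) ξ * Z ξ)) (surf n) := m2.add m1
  have hpde : ∫ ξ : Sph n, (rho r ^ 2 * (lap u (r • (ξ : Euc (n + 1))) * Z ξ)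
      + (n - 1) * rho r * r * (fderiv ℝ u (r • (ξ : Euc (n + 1))) ξ * Z ξ)
      + (n / 2 + γ) * (n - (n / 2 + γ)) * (u (r • (ξ : Euc (n + 1))) * Z ξ)) ∂surf n = 0 := by
    rw [← integral_zero (Sph n) ℝ (μ := surf n)]
    refine integral_congr_ae (Eventually.of_forall fun ξ => ?_)
    have h := hu.1 _ (hmem ξ)
    rw [laplaceBeltrami_ballMetric hn hu2 (by rw [hnorm]; exact h1), hnorm, map_smul,
      smul_eq_mul] at h
    linear_combination (-Z ξ) * h
  rw [integral_add m12 m0, integral_add m2 m1, integral_const_mul, integral_const_mul,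
    integral_const_mul] at hpde
  have e0 : sphCoef u Z r = ∫ ξ : Sph n, u (r • (ξ : Euc (n + 1))) * Z ξ ∂surf n := rfl
  have e1 : sphCoefDeriv u Z r = ∫ ξ : Sph n, fderiv ℝ u (r • (ξ : Euc (n + 1))) ξ * Z ξ ∂surf n := rfl
  rw [← e0, ← e1] at hpde
  have hr0 := h0.ne'
  have hlap : ∫ ξ : Sph n, lap u (r • (ξ : Euc (n + 1))) * Z ξ ∂surf n
      = U'' + n / r * sphCoefDeriv u Z r - l * (l + n - 1) / r ^ 2 * sphCoef u Z r := by
    field_simp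
    linear_combination -heq
  rw [hlap] at hpde
  exact hpde

theorem IsPoissonSolution.continuousAt_sphCoef {s : ℝ} (hu : IsPoissonSolution n s f u)
    (hZ : IsSolidHarmonic n l Z) : ContinuousAt (sphCoef u Z) 0 :=
  (sphCoef_radial hZ hu.contDiffOn (r := 0) (by simp)).1.continuousAt

theorem IsPoissonSolution.regularAtZero {s : ℝ} (hn : 1 ≤ n) (hu : IsPoissonSolution n s f u)
    (hZ : IsSolidHarmonic n l Z) : RegularAtZero n (sphCoef u Z) (sphCoefDeriv u Z) := by
  obtain ⟨hd, U'', hd', -⟩ := sphCoef_radial hZ hu.contDiffOn (r := 0) (by simp)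
  refine ⟨?_, _, hd.continuousAt.tendsto.mono_left nhdsWithin_le_nhds⟩
  have h : Tendsto (fun r => r ^ n * sphCoefDeriv u Z r) (𝓝[>] 0) (𝓝 (0 ^ n * sphCoefDeriv u Z 0)) :=
    ((continuousAt_pow (0 : ℝ) n).mul hd'.continuousAt).tendsto.mono_left nhdsWithin_le_nhds
  rwa [zero_pow (by omega : n ≠ 0), zero_mul] at h

theorem tendsto_integral_sphere_boundary {F : Euc (n + 1) → ℝ}
    (hF : ContinuousOn F (Metric.closedBall 0 1)) {w : Sph n → ℝ} (hw : Continuous w) :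
    Tendsto (fun r : ℝ => ∫ ξ : Sph n, F (r • (ξ : Euc (n + 1))) * w ξ ∂surf n) (𝓝[<] 1)
      (𝓝 (∫ ξ : Sph n, F ξ * w ξ ∂surf n)) := by
  obtain ⟨M, hM⟩ := (isCompact_closedBall (0 : Euc (n + 1)) 1).exists_bound_of_continuousOn hF
  have hmem : ∀ r : ℝ, 0 < r → r < 1 → ∀ ξ : Sph n,
      r • (ξ : Euc (n + 1)) ∈ Metric.closedBall (0 : Euc (n + 1)) 1 := fun r h0 h1 ξ => by
    simpa [norm_smul, abs_of_pos h0] using h1.le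
  have hI1 : Set.Ioo (0 : ℝ) 1 ∈ 𝓝[<] (1 : ℝ) := Ioo_mem_nhdsLT (by norm_num)
  refine tendsto_integral_filter_of_dominated_convergence (fun ξ => M * |w ξ|) ?_ ?_
    (continuous_const.mul hw.abs).integrable_of_compactSpace ?_
  · filter_upwards [hI1] with r hr
    exact ((hF.comp_continuous (f := fun ξ : Sph n => r • (ξ : Euc (n + 1))) (by fun_prop)
      (hmem r hr.1 hr.2)).mul hw).aestronglyMeasurable
  · filter_upwards [hI1] with r hr
    refine Eventually.of_forall fun ξ => ?_
    rw [norm_mul, Real.norm_eq_abs (w ξ)]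
    exact mul_le_mul_of_nonneg_right (hM _ (hmem r hr.1 hr.2 ξ)) (abs_nonneg _)
  · refine Eventually.of_forall fun ξ => Tendsto.mul_const _ ?_
    have h1 : ContinuousWithinAt F (Metric.closedBall 0 1) (ξ : Euc (n + 1)) := hF _ (by simp)
    refine h1.tendsto.comp (tendsto_nhdsWithin_iff.2 ⟨?_, ?_⟩)
    · have : Continuous fun r : ℝ => r • (ξ : Euc (n + 1)) := by fun_prop
      simpa using (this.tendsto 1).mono_left nhdsWithin_le_nhds
    · filter_upwards [hI1] with r hr using hmem r hr.1 hr.2 ξ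

/-- After division by `ρ^{n-s}` the solution is `F + ρ^{2γ} H`, and the second term disappears at
the boundary because `γ > 0`. -/
theorem IsPoissonSolution.tendsto_boundary (hγ : 0 < γ)
    (hu : IsPoissonSolution n ((n : ℝ) / 2 + γ) f u) (hZ : IsSolidHarmonic n l Z) :
    Tendsto (fun r => sphCoef u Z r / rho r ^ ((n : ℝ) / 2 - γ)) (𝓝[<] 1)
      (𝓝 (∫ ξ : Sph n, f ξ * Z ξ ∂surf n)) := by
  obtain ⟨-, F, H, hF, hH, hFH, hFf⟩ := hu
  have hlF := tendsto_integral_sphere_boundary hF.continuousOn hZ.continuous_sphere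
  have hlH := tendsto_integral_sphere_boundary hH.continuousOn hZ.continuous_sphere
  have hlim := hlF.add ((tendsto_rho_rpow_zero (τ := 2 * γ) (by linarith)).mul hlH)
  simp only [zero_mul, add_zero, hFf] at hlim
  refine hlim.congr' ?_
  filter_upwards [Ioo_mem_nhdsLT (show (0 : ℝ) < 1 by norm_num)] with r hr
  have hρ := rho_pos hr.1.le hr.2
  have hρ0 := (Real.rpow_pos_of_pos hρ ((n : ℝ) / 2 - γ)).ne'
  have hmem : ∀ ξ : Sph n, r • (ξ : Euc (n + 1)) ∈ Metric.ball (0 : Euc (n + 1)) 1 := fun ξ => by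
    simpa [norm_smul, abs_of_pos hr.1] using hr.2
  have hnorm : ∀ ξ : Sph n, ‖r • (ξ : Euc (n + 1))‖ = r := fun ξ => by
    simp [norm_smul, abs_of_pos hr.1]
  have hcont : ∀ G : Euc (n + 1) → ℝ, ContDiffOn ℝ ∞ G (Metric.closedBall 0 1) →
      Integrable (fun ξ : Sph n => G (r • (ξ : Euc (n + 1))) * Z ξ) (surf n) := fun G hG =>
    ((hG.continuousOn.comp_continuous (f := fun ξ : Sph n => r • (ξ : Euc (n + 1))) (by fun_prop)
      fun ξ => Metric.ball_subset_closedBall (hmem ξ)).mul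
        hZ.continuous_sphere).integrable_of_compactSpace
  rw [eq_div_iff hρ0, add_mul, sphCoef, ← integral_const_mul, ← integral_mul_const, ← integral_mul_const,
    ← integral_add ((hcont F hF).mul_const _) (((hcont H hH).const_mul _).mul_const _)]
  refine integral_congr_ae (Eventually.of_forall fun ξ => ?_)
  have e1 : rho r ^ ((n : ℝ) - (n / 2 + γ)) = rho r ^ ((n : ℝ) / 2 - γ) := by congr 1; ring
  have e2 : rho r ^ ((n : ℝ) / 2 + γ) = rho r ^ ((n : ℝ) / 2 - γ) * rho r ^ (2 * γ) := by
    rw [← Real.rpow_add hρ]; congr 1; ring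
  simp only [hFH _ (hmem ξ), hnorm, e1, e2]
  ring

/-- Both sides are multiples of `regularSol`, and their limits at the boundary fix the constant. -/
theorem IsPoissonSolution.sphCoef_eq (hn : 1 ≤ n) (hγ : 0 < γ)
    (hu : IsPoissonSolution n ((n : ℝ) / 2 + γ) f u) (hZ : IsSolidHarmonic n l Z) {Φ : ℝ → ℝ}
    (hΦ : IsNormalizedSol n l γ Φ) {r : ℝ} (h0 : 0 < r) (h1 : r < 1) :
    sphCoef u Z r = Φ r * ∫ ξ : Sph n, f ξ * Z ξ ∂surf n := by
  obtain ⟨C, hC⟩ := (hu.isRadialSol hn hZ).eq_const_mul_of_regular hn isRadialSol_regularSol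
    (hu.regularAtZero hn hZ) (regularAtZero_regularSol hn) fun r h0 h1 => regularSol_pos hγ h0 h1
  obtain ⟨C₀, hC₀⟩ := hΦ.exists_eq
  have hI1 : Set.Ioo (0 : ℝ) 1 ∈ 𝓝[<] (1 : ℝ) := Ioo_mem_nhdsLT (by norm_num)
  have hC₀' : C₀ ≠ 0 := by
    rintro rfl
    refine one_ne_zero (tendsto_nhds_unique hΦ.tendsto (tendsto_const_nhds.congr' ?_))
    filter_upwards [hI1] with r hr
    rw [hC₀ r hr, zero_mul, zero_div]
  have hlim : C / C₀ = ∫ ξ : Sph n, f ξ * Z ξ ∂surf n := by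
    refine tendsto_nhds_unique ((hΦ.tendsto.const_mul (C / C₀)).congr' ?_ |>.trans (by rw [mul_one]))
      (hu.tendsto_boundary hγ hZ)
    filter_upwards [hI1] with r hr
    rw [hC r hr, hC₀ r hr]
    field_simp
  rw [← hlim, hC r ⟨h0, h1⟩, hC₀ r ⟨h0, h1⟩]
  field_simp

/-! ### Coefficients of the boundary value -/

variable {Y : ℕ → Sph n → ℝ}

theorem tendsto_integral_mul_of_eLpNorm {g : ℕ → Sph n → ℝ} (hg : ∀ N, Continuous (g N))
    (h : Tendsto (fun N => eLpNorm (g N) 2 (surf n)) atTop (𝓝 0)) {w : Sph n → ℝ} (hw : Continuous w) :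
    Tendsto (fun N => ∫ ξ, g N ξ * w ξ ∂surf n) atTop (𝓝 0) := by
  obtain ⟨M, hM⟩ := isCompact_univ.exists_bound_of_continuousOn hw.continuousOn
  rw [tendsto_zero_iff_enorm_tendsto_zero]
  have hbound : ∀ N, ‖∫ ξ, g N ξ * w ξ ∂surf n‖ₑ ≤ ENNReal.ofReal M *
      (eLpNorm (g N) 2 (surf n) * (surf n) Set.univ ^ (1 / (1 : ENNReal).toReal - 1 / (2 : ENNReal).toReal)) := by
    intro N
    calc ‖∫ ξ, g N ξ * w ξ ∂surf n‖ₑ ≤ ∫⁻ ξ, ‖g N ξ * w ξ‖ₑ ∂surf n :=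
          enorm_integral_le_lintegral_enorm _
      _ ≤ ∫⁻ ξ, ENNReal.ofReal M * ‖g N ξ‖ₑ ∂surf n := by
          refine lintegral_mono fun ξ => ?_
          rw [enorm_mul, mul_comm]
          gcongr
          rw [← ofReal_norm]
          exact ENNReal.ofReal_le_ofReal (hM ξ trivial)
      _ = ENNReal.ofReal M * eLpNorm (g N) 1 (surf n) := by
          rw [lintegral_const_mul _ (hg N).enorm.measurable, eLpNorm_one_eq_lintegral_enorm]
      _ ≤ _ := by
          gcongr
          exact eLpNorm_le_eLpNorm_mul_rpow_measure_univ (by norm_num) (hg N).aestronglyMeasurable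
  have hlim : Tendsto (fun N => ENNReal.ofReal M * (eLpNorm (g N) 2 (surf n) *
      (surf n) Set.univ ^ (1 / (1 : ENNReal).toReal - 1 / (2 : ENNReal).toReal))) atTop (𝓝 0) := by
    have hfin : (surf n) Set.univ ^ (1 / (1 : ENNReal).toReal - 1 / (2 : ENNReal).toReal) ≠ ⊤ :=
      ENNReal.rpow_ne_top_of_nonneg (by norm_num) (measure_ne_top _ _)
    have h1 := ENNReal.Tendsto.mul_const h (Or.inr hfin)
    rw [zero_mul] at h1
    have h2 := ENNReal.Tendsto.const_mul h1 (Or.inr (ENNReal.ofReal_ne_top (r := M)))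
    rwa [mul_zero] at h2
  exact tendsto_of_tendsto_of_tendsto_of_le_of_le tendsto_const_nhds hlim (fun _ => bot_le) hbound

theorem IsHarmonicExpansion.exists_poly (hY : IsHarmonicExpansion n f Y) (l : ℕ) :
    ∃ P : MvPolynomial (Fin (n + 1)) ℝ, P.IsHomogeneous l ∧ polyLap P = 0 ∧
      Y l = fun ξ : Sph n => polyFun P ξ := by
  obtain ⟨P, h1, h2, h3⟩ := hY.1 l
  exact ⟨P, h1, h2, funext h3⟩

theorem IsHarmonicExpansion.continuous (hY : IsHarmonicExpansion n f Y) (l : ℕ) :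
    Continuous (Y l) := by
  obtain ⟨P, -, -, hP⟩ := hY.exists_poly l
  rw [hP]; exact continuous_polyFun_sphere P

theorem IsHarmonicExpansion.integral_mul (hn : 1 ≤ n) (hY : IsHarmonicExpansion n f Y)
    (hZ : IsSolidHarmonic n l Z) {k : ℕ} (hk : k ≠ l) : ∫ ξ : Sph n, Y k ξ * Z ξ ∂surf n = 0 := by
  obtain ⟨P, h1, h2, hP⟩ := hY.exists_poly k
  rw [hP]
  exact hZ.integral_mul_eq_zero hn (isSolidHarmonic_polyFun h1 h2) hk

/-- By orthogonality the pairing of the remainder with `Z` no longer depends on `N` once `N > l`,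
while `L²` convergence sends it to zero. -/
theorem IsHarmonicExpansion.integral_boundary_mul (hn : 1 ≤ n) (hf : Continuous f)
    (hY : IsHarmonicExpansion n f Y) (hZ : IsSolidHarmonic n l Z) :
    ∫ ξ : Sph n, f ξ * Z ξ ∂surf n = ∫ ξ : Sph n, Y l ξ * Z ξ ∂surf n := by
  have hz := hZ.continuous_sphere
  have hlim : Tendsto (fun N => ∫ ξ : Sph n, (f ξ - ∑ k ∈ Finset.range N, Y k ξ) * Z ξ ∂surf n) atTop
      (𝓝 0) := tendsto_integral_mul_of_eLpNorm (fun N => hf.sub (continuous_finsetSum (Finset.range N) fun k _ => hY.continuous k)) hY.2 hz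
  refine sub_eq_zero.1 (tendsto_nhds_unique (tendsto_const_nhds.congr' ?_) hlim)
  filter_upwards [eventually_gt_atTop l] with N hN
  have i1 : Integrable (fun ξ : Sph n => f ξ * Z ξ) (surf n) := (hf.mul hz).integrable_of_compactSpace
  have i2 : ∀ k, Integrable (fun ξ : Sph n => Y k ξ * Z ξ) (surf n) := fun k =>
    ((hY.continuous k).mul hz).integrable_of_compactSpace
  have e : ∀ ξ : Sph n, (f ξ - ∑ k ∈ Finset.range N, Y k ξ) * Z ξ
      = f ξ * Z ξ - ∑ k ∈ Finset.range N, Y k ξ * Z ξ := fun ξ => by rw [sub_mul, Finset.sum_mul]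
  simp only [e]
  rw [integral_sub i1 (integrable_finsetSum _ fun k _ => i2 k), integral_finsetSum _ fun k _ => i2 k,
    Finset.sum_eq_single_of_mem l (Finset.mem_range.2 hN) fun k _ hk => hY.integral_mul hn hZ hk]

/-! ### The expansion of a solution -/

theorem IsNormalizedSol.abs_le (hγ : 0 < γ) {Φ : ℝ → ℝ} (hΦ : IsNormalizedSol n l γ Φ) {r r' : ℝ}
    (h0 : 0 < r) (h : r ≤ r') (h1 : r' < 1) :
    |Φ r| ≤ (r / r') ^ l * (rho r / rho r') ^ ((n : ℝ) / 2 + γ) * |Φ r'| := by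
  obtain ⟨C, hC⟩ := hΦ.exists_eq
  have h0' := h0.trans_le h
  have h1' := h.trans_lt h1
  rw [hC r ⟨h0, h1'⟩, hC r' ⟨h0', h1⟩, abs_mul, abs_mul,
    abs_of_pos (regularSol_pos (n := n) (l := l) hγ h0 h1'),
    abs_of_pos (regularSol_pos (n := n) (l := l) hγ h0' h1)]
  have := mul_le_mul_of_nonneg_left (regularSol_le (n := n) (l := l) hγ h0 h h1) (abs_nonneg C)
  linarith

/-- Bessel's inequality for one function, from the integral of `(v - a w)²`. There is no division by
the norm of `w`, so `w = 0` is allowed. -/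
theorem sq_mul_integral_sq_le {v w : Sph n → ℝ} (hv : Continuous v) (hw : Continuous w) {a : ℝ}
    (h : ∫ η, v η * w η ∂surf n = a * ∫ η, w η ^ 2 ∂surf n) :
    a ^ 2 * ∫ η, w η ^ 2 ∂surf n ≤ ∫ η, v η ^ 2 ∂surf n := by
  have i1 : Integrable (fun η => v η ^ 2) (surf n) := (hv.pow 2).integrable_of_compactSpace
  have i2 : Integrable (fun η => 2 * a * (v η * w η)) (surf n) :=
    (continuous_const.mul (hv.mul hw)).integrable_of_compactSpace
  have i3 : Integrable (fun η => a ^ 2 * w η ^ 2) (surf n) :=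
    (continuous_const.mul (hw.pow 2)).integrable_of_compactSpace
  have i12 : Integrable (fun η => v η ^ 2 - 2 * a * (v η * w η)) (surf n) := i1.sub i2
  have hnn : 0 ≤ ∫ η, (v η - a * w η) ^ 2 ∂surf n := integral_nonneg fun η => sq_nonneg _
  have e : ∀ η, (v η - a * w η) ^ 2 = v η ^ 2 - 2 * a * (v η * w η) + a ^ 2 * w η ^ 2 :=
    fun η => by ring
  simp only [e] at hnn
  rw [integral_add i12 i3, integral_sub i1 i2, integral_const_mul, integral_const_mul, h] at hnn
  linarith

theorem sq_mul_le_geometric {a b p c K d t y M q : ℝ} (ha : |a| ≤ t ^ l * c * |b|)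
    (hp : p ^ 2 ≤ K * d ^ (2 * l) * y) (hK : 0 ≤ K) (hb : b ^ 2 * y ≤ M)
    (hq : t * d = q) : (a * p) ^ 2 ≤ c ^ 2 * (K * M) * (q ^ l) ^ 2 := by
  have ha' : a ^ 2 ≤ (t ^ l * c * |b|) ^ 2 := by
    rw [← sq_abs a]
    exact pow_le_pow_left₀ (abs_nonneg a) ha 2
  calc (a * p) ^ 2 = a ^ 2 * p ^ 2 := mul_pow _ _ _
    _ ≤ (t ^ l * c * |b|) ^ 2 * (K * d ^ (2 * l) * y) :=
        mul_le_mul ha' hp (sq_nonneg p) (sq_nonneg _)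
    _ = c ^ 2 * K * (q ^ l) ^ 2 * (b ^ 2 * y) := by
        rw [← hq, mul_pow, mul_pow (t ^ l), sq_abs, mul_pow t d]; ring
    _ ≤ c ^ 2 * K * (q ^ l) ^ 2 * M := mul_le_mul_of_nonneg_left hb (by positivity)
    _ = _ := by ring

/-- Pass to a radius `r' > r`. The gain `(r/r')^l` of the regular solution beats the loss `(1+δ)^l`
in the pointwise bound on `Y_l`, and what remains, the `L²` norm of `Φ_l(r') Y_l`, is at most that
of `u` on the sphere of radius `r'`. -/
theorem IsPoissonSolution.exists_geometric_bound (hn : 1 ≤ n) (hγ : 0 < γ)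
    (hu : IsPoissonSolution n ((n : ℝ) / 2 + γ) f u) (hY : IsHarmonicExpansion n f Y)
    {Φ : ℕ → ℝ → ℝ} (hΦ : ∀ l, IsNormalizedSol n l γ (Φ l)) {r : ℝ} (h0 : 0 < r) (h1 : r < 1) :
    ∃ A q : ℝ, 0 ≤ q ∧ q < 1 ∧ ∀ l ξ, |Φ l r * Y l ξ| ≤ A * q ^ l := by
  obtain ⟨r', hrr', hr'1⟩ := exists_between h1
  have hr'0 := h0.trans hrr'
  obtain ⟨q, hq, hq1⟩ := exists_between ((div_lt_one hr'0).2 hrr')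
  have hq0 : 0 < q := (div_pos h0 hr'0).trans hq
  -- Chosen so that `(r/r')(1 + δ) = q`; it is positive because `q > r/r'`.
  set δ : ℝ := q * r' / r - 1 with hδ
  have hδ0 : 0 < δ := by
    rw [hδ, sub_pos, lt_div_iff₀ h0, one_mul]
    exact (div_lt_iff₀ hr'0).1 hq
  have hδq : r / r' * (1 + δ) = q := by
    rw [hδ]; field_simp; ring
  obtain ⟨K, hK⟩ := IsSolidHarmonic.exists_bound hn hδ0
  set c := (rho r / rho r') ^ ((n : ℝ) / 2 + γ)
  have hmem : ∀ ξ : Sph n, r' • (ξ : Euc (n + 1)) ∈ Metric.ball (0 : Euc (n + 1)) 1 := fun ξ => by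
    simpa [norm_smul, abs_of_pos hr'0] using hr'1
  have huc : Continuous fun ξ : Sph n => u (r' • (ξ : Euc (n + 1))) :=
    hu.contDiffOn.continuousOn.comp_continuous (by fun_prop) hmem
  set M := ∫ ξ : Sph n, u (r' • (ξ : Euc (n + 1))) ^ 2 ∂surf n with hM
  refine ⟨√(c ^ 2 * (|K| * M)), q, hq0.le, hq1, fun l ξ => ?_⟩
  obtain ⟨P, hP1, hP2, hP⟩ := hY.exists_poly l
  have hH := isSolidHarmonic_polyFun hP1 hP2
  have hsup := hK l _ hH ξ
  set y := ∫ η : Sph n, polyFun P η ^ 2 ∂surf n with hy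
  have hy0 : 0 ≤ y := integral_nonneg fun η => sq_nonneg _
  have hcoef : ∫ η : Sph n, u (r' • (η : Euc (n + 1))) * polyFun P η ∂surf n = Φ l r' * y := by
    have := hu.sphCoef_eq hn hγ hH (hΦ l) hr'0 hr'1
    rw [hY.integral_boundary_mul hn hu.continuous_boundary hH, hP] at this
    simpa [sphCoef, hy, sq] using this
  have hbessel := sq_mul_integral_sq_le huc (continuous_polyFun_sphere P) hcoef
  have hsup' : polyFun P ξ ^ 2 ≤ |K| * (1 + δ) ^ (2 * l) * y :=
    hsup.trans (mul_le_mul_of_nonneg_right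
      (mul_le_mul_of_nonneg_right (le_abs_self K) (by positivity)) hy0)
  have hM0 : 0 ≤ M := integral_nonneg fun η => sq_nonneg _
  have hsq := sq_mul_le_geometric ((hΦ l).abs_le hγ h0 hrr'.le hr'1) hsup' (abs_nonneg K)
    hbessel hδq
  rw [show Y l ξ = polyFun P ξ by rw [hP]]
  have := Real.abs_le_sqrt hsq
  rwa [Real.sqrt_mul (by positivity), Real.sqrt_sq (by positivity)] at this

/-- The geometric bound is uniform on the sphere, so the sum is continuous and may be integrated
termwise. Its difference from `u` is then orthogonal to all spherical harmonics. -/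
theorem IsPoissonSolution.hasSum (hn : 1 ≤ n) (hγ : 0 < γ)
    (hu : IsPoissonSolution n ((n : ℝ) / 2 + γ) f u) (hY : IsHarmonicExpansion n f Y)
    {Φ : ℕ → ℝ → ℝ} (hΦ : ∀ l, IsNormalizedSol n l γ (Φ l)) {r : ℝ} (h0 : 0 < r) (h1 : r < 1)
    (ξ : Sph n) : HasSum (fun l => Φ l r * Y l ξ) (u (r • (ξ : Euc (n + 1)))) := by
  obtain ⟨A, q, hq0, hq1, hbd⟩ := hu.exists_geometric_bound hn hγ hY hΦ h0 h1
  have hgeo : Summable fun l : ℕ => A * q ^ l := (summable_geometric_of_lt_one hq0 hq1).mul_left A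
  have hsum : ∀ η : Sph n, Summable fun l => Φ l r * Y l η := fun η =>
    Summable.of_norm_bounded hgeo fun l => hbd l η
  have hmem : ∀ ξ : Sph n, r • (ξ : Euc (n + 1)) ∈ Metric.ball (0 : Euc (n + 1)) 1 := fun ξ => by
    simpa [norm_smul, abs_of_pos h0] using h1
  have huc : Continuous fun ξ : Sph n => u (r • (ξ : Euc (n + 1))) :=
    hu.contDiffOn.continuousOn.comp_continuous (by fun_prop) hmem
  have hSc : Continuous fun η : Sph n => ∑' l, Φ l r * Y l η :=
    continuous_tsum (fun l => continuous_const.mul (hY.continuous l)) hgeo fun l η => hbd l η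
  have hzero : (fun η : Sph n => (∑' l, Φ l r * Y l η) - u (r • (η : Euc (n + 1)))) = 0 := by
    refine eq_zero_of_orthogonal (hSc.sub huc) fun k H hH hL => ?_
    have hZ := isSolidHarmonic_polyFun hH hL
    have hz := hZ.continuous_sphere
    obtain ⟨B, hB⟩ := isCompact_univ.exists_bound_of_continuousOn hz.continuousOn
    have hInt : ∀ l, Integrable (fun η : Sph n => Φ l r * Y l η * polyFun H η) (surf n) := fun l =>
      ((continuous_const.mul (hY.continuous l)).mul hz).integrable_of_compactSpace
    have hswap := hasSum_integral_of_summable_integral_norm hInt (by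
      refine Summable.of_nonneg_of_le (fun l => integral_nonneg fun η => norm_nonneg _) (fun l => ?_)
        (hgeo.mul_right (B * (surf n).real Set.univ))
      calc ∫ η : Sph n, ‖Φ l r * Y l η * polyFun H η‖ ∂surf n
          ≤ ∫ η : Sph n, A * q ^ l * B ∂surf n := by
            refine integral_mono (hInt l).norm (integrable_const _) fun η => ?_
            simp only [norm_mul (Φ l r * Y l η)]
            exact mul_le_mul (hbd l η) (hB η trivial) (norm_nonneg _)
              ((abs_nonneg _).trans (hbd l η))
        _ = A * q ^ l * (B * (surf n).real Set.univ) := by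
            rw [integral_const, smul_eq_mul]; ring)
    have hone : HasSum (fun l => ∫ η : Sph n, Φ l r * Y l η * polyFun H η ∂surf n)
        (Φ k r * ∫ η : Sph n, Y k η * polyFun H η ∂surf n) := by
      have hterm : ∀ l, ∫ η : Sph n, Φ l r * Y l η * polyFun H η ∂surf n
          = Φ l r * ∫ η : Sph n, Y l η * polyFun H η ∂surf n := fun l => by
        rw [← integral_const_mul]; simp only [mul_assoc]
      simp only [hterm]
      exact hasSum_single k fun l hl => by rw [hY.integral_mul hn hZ hl, mul_zero]
    have hS : ∫ η : Sph n, (∑' l, Φ l r * Y l η) * polyFun H η ∂surf n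
        = Φ k r * ∫ η : Sph n, Y k η * polyFun H η ∂surf n := by
      rw [← hswap.unique hone]
      simp only [tsum_mul_right]
    have hU : ∫ η : Sph n, u (r • (η : Euc (n + 1))) * polyFun H η ∂surf n
        = Φ k r * ∫ η : Sph n, Y k η * polyFun H η ∂surf n := by
      rw [← hY.integral_boundary_mul hn hu.continuous_boundary hZ]
      exact hu.sphCoef_eq hn hγ hZ (hΦ k) h0 h1
    simp only [sub_mul]
    have i1 : Integrable (fun η : Sph n => (∑' l, Φ l r * Y l η) * polyFun H η) (surf n) :=
      (hSc.mul hz).integrable_of_compactSpace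
    have i2 : Integrable (fun η : Sph n => u (r • (η : Euc (n + 1))) * polyFun H η) (surf n) :=
      (huc.mul hz).integrable_of_compactSpace
    rw [integral_sub i1 i2, hS, hU, sub_self]
  have := congrFun hzero ξ
  simp only [Pi.zero_apply, sub_eq_zero] at this
  rw [← this]
  exact (hsum ξ).hasSum

theorem IsPoissonSolution.hasSum_generic (hn : 1 ≤ n) (hγ : 0 < γ) (hγn : γ < (n : ℝ) / 2)
    (hnot : ∀ k : ℕ, γ ≠ (k : ℝ) / 2)
    (hu : IsPoissonSolution n ((n : ℝ) / 2 + γ) f u) (hY : IsHarmonicExpansion n f Y)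
    {r : ℝ} (h0 : 0 < r) (h1 : r < 1) (ξ : Sph n) :
    HasSum (fun l => genericFactor n γ l r * (r ^ l * Y l ξ)) (u (r • (ξ : Euc (n + 1)))) := by
  have := hu.hasSum hn hγ hY (fun l => isNormalizedSol_generic l hn hγ hγn hnot) h0 h1 ξ
  convert! this using 2 with l
  ring

/-- The value of a solution at the origin. -/
theorem IsPoissonSolution.apply_zero (hn : 1 ≤ n) (hγ : 0 < γ)
    (hu : IsPoissonSolution n ((n : ℝ) / 2 + γ) f u) (hY : IsHarmonicExpansion n f Y)
    {Φ : ℝ → ℝ} (hΦ : IsNormalizedSol n 0 γ Φ) (hc : ContinuousAt Φ 0) (ξ : Sph n) :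
    u 0 = Φ 0 * Y 0 ξ := by
  have hone := isSolidHarmonic_one n
  obtain ⟨P, hP1, hP2, hP⟩ := hY.exists_poly 0
  have hYc : ∀ η : Sph n, Y 0 η = Y 0 ξ := by
    intro η
    rw [← MvPolynomial.totalDegree_zero_iff_isHomogeneous,
      MvPolynomial.totalDegree_eq_zero_iff_eq_C] at hP1
    simp only [hP, polyFun]
    rw [hP1]
    simp
  have hS : (surf n).real Set.univ ≠ 0 := by
    have := Measure.toSphere_ne_zero (volume : Measure (Euc (n + 1)))
    exact (measureReal_ne_zero_iff).2 (Measure.measure_univ_ne_zero.2 this)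
  -- The component along `1` at radius `0` is `u 0` times the area of the sphere; the formula for `r
  -- > 0` extends to it by continuity.
  have hl1 := (hu.continuousAt_sphCoef hone).tendsto.mono_left (nhdsWithin_le_nhds (s := Set.Ioi 0))
  have hl2 := (hc.tendsto.mono_left (nhdsWithin_le_nhds (s := Set.Ioi 0))).mul_const
    (∫ ξ : Sph n, f ξ * 1 ∂surf n)
  have h := tendsto_nhds_unique hl1 (hl2.congr' (by
    filter_upwards [Ioo_mem_nhdsGT (show (0 : ℝ) < 1 by norm_num)] with r hr
    exact (hu.sphCoef_eq hn hγ hone hΦ hr.1 hr.2).symm))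
  rw [hY.integral_boundary_mul hn hu.continuous_boundary hone] at h
  simp only [sphCoef, zero_smul, mul_one, hYc, integral_const, smul_eq_mul] at h
  refine mul_left_cancel₀ hS ?_
  rw [h]
  ring

theorem IsPoissonSolution.hasSum_halfInt {m : ℕ} (hn : 1 ≤ n) (hγ : γ = (m : ℝ) + 1 / 2)
    (hu : IsPoissonSolution n ((n : ℝ) / 2 + γ) f u) (hY : IsHarmonicExpansion n f Y)
    {r : ℝ} (h0 : 0 ≤ r) (h1 : r < 1) (ξ : Sph n) :
    HasSum (fun l => rho r ^ (((n : ℝ) - 1) / 2 - m) * (halfIntFactor n m l r * (r ^ l * Y l ξ)))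
      (u (r • (ξ : Euc (n + 1)))) := by
  have hγ0 : 0 < γ := by rw [hγ]; positivity
  have hexp : ((n : ℝ) - 1) / 2 - m = n / 2 - γ := by rw [hγ]; ring
  rw [hexp]
  have hΦ := fun l => isNormalizedSol_halfInt (n := n) (m := m) l hn hγ
  -- The radial analysis covers only `0 < r`. At the origin every term with `l > 0` vanishes.
  rcases h0.eq_or_lt with rfl | h0
  · have hc : ContinuousAt (fun r : ℝ => r ^ 0 * (rho r ^ ((n : ℝ) / 2 - γ) * halfIntFactor n m 0 r)) 0 := by
      refine (continuousAt_pow 0 0).mul ((continuous_rho.continuousAt.rpow_const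
        (Or.inl (by simp [rho]))).mul ?_)
      unfold halfIntFactor
      have := continuous_rho
      exact Continuous.continuousAt (by fun_prop)
    rw [zero_smul, hu.apply_zero hn hγ0 hY (hΦ 0) hc ξ]
    have := hasSum_single (f := fun l => rho 0 ^ ((n : ℝ) / 2 - γ) *
      (halfIntFactor n m l 0 * ((0 : ℝ) ^ l * Y l ξ))) 0 fun l hl => by simp [hl]
    convert! this using 1
    ring
  · have := hu.hasSum hn hγ0 hY hΦ h0 h1 ξ
    convert! this using 2 with l
    ring

/-! ### Constant boundary value -/

/-- The expansion of the constant function `1`. -/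
def oneExpansion (n l : ℕ) : Sph n → ℝ := fun _ => if l = 0 then 1 else 0

theorem isHarmonicExpansion_one (n : ℕ) : IsHarmonicExpansion n (fun _ => 1) (oneExpansion n) := by
  refine ⟨fun l => ?_, ?_⟩
  · rcases eq_or_ne l 0 with rfl | hl
    · exact ⟨1, MvPolynomial.isHomogeneous_one _ _, by simp, by simp [oneExpansion]⟩
    · exact ⟨0, MvPolynomial.isHomogeneous_zero _ _ _, by simp, by simp [oneExpansion, hl]⟩
  · refine tendsto_const_nhds.congr' ?_
    filter_upwards [eventually_gt_atTop 0] with N hN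
    have : (fun ξ : Sph n => (1 : ℝ) - ∑ l ∈ Finset.range N, oneExpansion n l ξ) = fun _ => 0 := by
      ext ξ
      simp [oneExpansion, hN]
    rw [this]
    simp

theorem exists_smul_sphere_eq (x : Euc (n + 1)) : ∃ ξ : Sph n, ‖x‖ • (ξ : Euc (n + 1)) = x := by
  rcases eq_or_ne x 0 with rfl | hx
  · exact ⟨⟨EuclideanSpace.single 0 1, by simp⟩, by simp⟩
  · have hx' : ‖x‖ ≠ 0 := norm_ne_zero_iff.2 hx
    exact ⟨⟨‖x‖⁻¹ • x, by simp [norm_smul, hx']⟩, by simp [smul_smul, hx']⟩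

end

end HypPoisson
end

/-! ### Assembly of the three statements -/

open HypPoisson in
theorem lemma3p2 (n : ℕ) (γ s : ℝ) (hγ0 : 0 < γ) (hγn : γ < (n : ℝ) / 2)
    (hs : s = (n : ℝ) / 2 + γ) :
    (∀ (f : Sph n → ℝ) (Y : ℕ → Sph n → ℝ) (u : Euc (n + 1) → ℝ),
      IsPoissonSolution n s f u → IsHarmonicExpansion n f Y →
      ((∀ k : ℕ, γ ≠ (k : ℝ) / 2) → ∀ (r : ℝ) (ξ : Sph n), 0 < r → r < 1 →
        HasSum (fun l : ℕ =>
            (rho r ^ ((n : ℝ) - s) * lowerFactor n γ l r +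
              rho r ^ s * scatConst γ * upperFactor n γ l r) * (r ^ l * Y l ξ))
          (u (r • (ξ : Euc (n + 1)))) ∧
        ((∃ A, SeriesConvergesTo (fun l => lowerFactor n γ l r * (r ^ l * Y l ξ)) A) ↔
          (∃ B, SeriesConvergesTo (fun l => upperFactor n γ l r * (r ^ l * Y l ξ)) B)) ∧
        ∀ A B : ℝ,
          SeriesConvergesTo (fun l => lowerFactor n γ l r * (r ^ l * Y l ξ)) A →
          SeriesConvergesTo (fun l => upperFactor n γ l r * (r ^ l * Y l ξ)) B →
          u (r • (ξ : Euc (n + 1))) =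
            rho r ^ ((n : ℝ) - s) * A + rho r ^ s * scatConst γ * B) ∧
      (∀ m : ℕ, γ = (m : ℝ) + 1 / 2 → ∀ (r : ℝ) (ξ : Sph n), 0 ≤ r → r < 1 →
        HasSum (fun l : ℕ =>
            rho r ^ (((n : ℝ) - 1) / 2 - m) * (halfIntFactor n m l r * (r ^ l * Y l ξ)))
          (u (r • (ξ : Euc (n + 1)))))) ∧
    (∀ ϑ : Euc (n + 1) → ℝ, IsPoissonSolution n s (fun _ => 1) ϑ →
      ((∀ k : ℕ, γ ≠ (k : ℝ) / 2) → ∀ x : Euc (n + 1), 0 < ‖x‖ → ‖x‖ < 1 →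
        ϑ x = rho ‖x‖ ^ ((n : ℝ) / 2 - γ) * lowerFactor n γ 0 ‖x‖ +
          rho ‖x‖ ^ ((n : ℝ) / 2 + γ) * scatConst γ * upperFactor n γ 0 ‖x‖) ∧
      (∀ m : ℕ, γ = (m : ℝ) + 1 / 2 → ∀ x : Euc (n + 1), ‖x‖ < 1 →
        ϑ x = rho ‖x‖ ^ (((n : ℝ) - 1) / 2 - m) * halfIntFactor n m 0 ‖x‖)) := by
  have hn : 1 ≤ n := by
    rcases Nat.eq_zero_or_pos n with rfl | h
    · simp at hγn; linarith
    · exact h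
  subst hs
  have hexp : (n : ℝ) - (n / 2 + γ) = n / 2 - γ := by ring
  refine ⟨fun f Y u hu hY => ⟨fun hnot r ξ h0 h1 => ?_, fun m hm r ξ h0 h1 =>
    hu.hasSum_halfInt hn hm hY h0 h1 ξ⟩, fun ϑ hu => ⟨fun hnot x h0 h1 => ?_, fun m hm x h1 => ?_⟩⟩
  · rw [hexp]
    have hsum := hu.hasSum_generic hn hγ0 hγn hnot hY h0 h1 ξ
    have hρ := rho_pos h0.le h1
    set p := rho r ^ ((n : ℝ) / 2 - γ) with hp
    set q := rho r ^ ((n : ℝ) / 2 + γ) * scatConst γ with hq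
    have hp0 : p ≠ 0 := (Real.rpow_pos_of_pos hρ _).ne'
    -- The nonvanishing of `Γ(-γ)` needs `γ` not to be an integer.
    have hq0 : q ≠ 0 := by
      have h1 : Real.Gamma (-γ) ≠ 0 := Real.Gamma_ne_zero fun m hm =>
        hnot (2 * m) (by push_cast; linarith)
      have h2 := (Real.Gamma_pos_of_pos hγ0).ne'
      have h3 : (2 : ℝ) ^ (2 * γ) ≠ 0 := (Real.rpow_pos_of_pos two_pos _).ne'
      exact mul_ne_zero (Real.rpow_pos_of_pos hρ _).ne' (div_ne_zero h1 (mul_ne_zero h3 h2))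
    -- The combination of partial sums with coefficients `p` and `q` converges, and both
    -- coefficients are nonzero, so convergence of either series forces that of the other.
    have hpart : Tendsto (fun N => p * (∑ l ∈ Finset.range N, lowerFactor n γ l r * (r ^ l * Y l ξ))
        + q * ∑ l ∈ Finset.range N, upperFactor n γ l r * (r ^ l * Y l ξ)) atTop
        (𝓝 (u (r • (ξ : Euc (n + 1))))) := by
      refine hsum.tendsto_sum_nat.congr fun N => ?_
      rw [Finset.mul_sum, Finset.mul_sum, ← Finset.sum_add_distrib]
      refine Finset.sum_congr rfl fun l _ => ?_
      rw [genericFactor]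
      ring
    refine ⟨hsum, ⟨?_, ?_⟩, fun A B hA hB =>
      tendsto_nhds_unique hpart ((hA.const_mul p).add (hB.const_mul q))⟩
    · rintro ⟨A, hA⟩
      refine ⟨_, ((hpart.sub (hA.const_mul p)).div_const q).congr fun N => ?_⟩
      field_simp
      ring
    · rintro ⟨B, hB⟩
      refine ⟨_, ((hpart.sub (hB.const_mul q)).div_const p).congr fun N => ?_⟩
      field_simp
      ring
  · obtain ⟨ξ, hξ⟩ := exists_smul_sphere_eq x
    have hsum := hu.hasSum_generic hn hγ0 hγn hnot (isHarmonicExpansion_one n) h0 h1 ξ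
    rw [hξ] at hsum
    rw [hsum.unique (hasSum_single 0 fun l hl => by simp [oneExpansion, hl])]
    simp [oneExpansion, genericFactor]
  · obtain ⟨ξ, hξ⟩ := exists_smul_sphere_eq x
    have hsum := hu.hasSum_halfInt hn hm (isHarmonicExpansion_one n) (norm_nonneg x) h1 ξ
    rw [hξ] at hsum
    rw [hsum.unique (hasSum_single 0 fun l hl => by simp [oneExpansion, hl])]
    simp [oneExpansion]
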